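/- Let $\mathcal M$ be a matroid of rank $r$ on the ground set $E=\{0,\dots,n-1\}$, accessible only through an independence oracle, let $u:E\to\mathbb Z_{\ge 0}$ be integer capacities and let $k\ge 0$ be an integer. For sets $S_1,\dots,S_k\subseteq E$ write $x_S(e)=|\{i: e\in S_i\}|$; $e$ is *uncovered* if $x_S(e)<u(e)$, *covered* if $x_S(e)\ge u(e)$ and *overpacked* if $x_S(e)>u(e)$. Let $\mathrm{OPT}=\max\sum_{e}\min\{u(e),x_B(e)\}$ over all families of $k$ bases $B_1,\dots,B_k$ of $\mathcal M$. A *packing* is a family of independent sets $I_1,\dots,I_k$ with $x_I(e)\le u(e)$ for all $e$; its size is $\sum_i|I_i|$. It is *maximal* if every uncovered element lies in $\mathrm{span}(I_i)$ for every $i$, and *decreasing* if $I_{i+1}\subseteq\mathrm{span}(I_i)$ for $1\le i<k$. Algorithms are deterministic and adaptive; they know $n$, $k$, $u$ and any other stated input, and their cost is the number of independence queries. Logarithms are natural, with $\log 0=0$. There is an absolute constant $C>0$ such that the following hold. 1. (Approximate push-relabel.) For every $\varepsilon\in(0,1)$ there is an algorithm with at most $C\,(n+\mathrm{OPT}\,\log(kr)/\varepsilon)$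 queries that computes bases $B_1,\dots,B_k$, levels $\ell:E\to\mathbb Z_{\ge0}$ and, for each $i$ and each $e\in B_i$, an insertion level $\ell_i(e)\le \ell(e)$, such that, with $B_{i,\ge j}=\{e\in B_i:\ell_i(e)\ge j\}$ and for some integer $h>1/\varepsilon+2$: overpacked elements (with respect to $B$) have level $0$; $B_{i,\ge j}$ spans $\{e:\ell(e)>j\}$ for all $i,j$; uncovered elements have level at least $h$; and $B_{i,\ge j}$ spans $B_{i+1,\ge j}$ for all $j$ and $1\le i<k$. It also computes a maximal, decreasing packing $I_1,\dots,I_k$ with $B_{i,\ge1}\subseteq I_i$ for all $i$, with $x_I(e)=\min\{u(e),x_B(e)\}$ for all $e$, and of size at least $(1-\varepsilon)\mathrm{OPT}$. 2. (One augmentation.) Given a maximal, decreasing packing $I$, let its exchange graph have vertices $s$, $t$ and $e^{(i)}$ ($e\in E$, $1\le i\le k$), and arcs $(s,e^{(i)})$ for $e$ uncovered, $e\notin I_i$; $(e^{(i)},d^{(i)})$ for $e\notin I_i$, $d\in I_i$, $I_i-d+e$ independent; $(d^{(i)},d^{(j)})$ for $d$ covered, $d\in I_i\setminus I_j$; and $(e^{(i)},t)$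 for $e\notin\mathrm{span}(I_i)$. There is an algorithm with at most $C\,(n+\mathrm{OPT}\,\log r)$ queries that either returns a simple $(s,t)$-path such that performing all its exchanges (replacing each $I_i$ by $I_i\,\triangle\,\{e: e^{(i)}\text{ lies on the path}\}$) gives a maximal, decreasing packing of size one larger, or reports that there is none; in the latter case the graph has no $(s,t)$-path and $I$ has maximum size. 3. (Extension to an optimum.) There is an algorithm that extends any given maximal, decreasing packing $I$ to a packing $J$ of maximum size, with $x_J\ge x_I$, and with $q=\mathrm{OPT}-\sum_i|I_i|$ makes at most $$C\left(n+(q+1)\,\min\{\,n+\mathrm{OPT}\,\log r,\ rk\log(kr)\,\}\right)$$ queries: after one preprocessing pass of $O(n)$ queries, each additional element (and the final certification of optimality) costs amortized $O(\min\{n+\mathrm{OPT}\log r,\ rk\log(kr)\})$ queries. 4. (Exact algorithm.) There is an algorithm that computes a packing of $k$ independent sets of maximum size with at most $$C\left(n+\mathrm{OPT}\sqrt{\bigl(n'+\mathrm{OPT}\,\log r\bigr)\log(kr)}\right),\qquad n'=\min\{n,\ kr\log r\},$$ queries, and, in the uncapacitated case $u\equiv1$, the same algorithm makes at most $C\,n^{3/2}\log(n+1)$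 queries, for every $k$ and $r$. -/

import Mathlib

/-- A deterministic adaptive algorithm in the independence-oracle model on the ground set
`Fin n`: it either stops with a result, or asks whether some set `S` is independent and goes on
depending on the answer. -/
inductive OracleAlg (n : ℕ) (β : Type) : Type where
  | result (b : β) : OracleAlg n β
  | query (S : Finset (Fin n)) (next : Bool → OracleAlg n β) : OracleAlg n β

namespace OracleAlg

/-- The result of the algorithm when the queries are answered by `oracle`. -/
def run {n : ℕ} {β : Type} (oracle : Finset (Fin n) → Bool) : OracleAlg n β → β
  | result b => b
  | query S next => run oracle (next (oracle S))

/-- The number of queries made when the queries are answered by `oracle`. -/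
def queries {n : ℕ} {β : Type} (oracle : Finset (Fin n) → Bool) : OracleAlg n β → ℕ
  | result _ => 0
  | query S next => queries oracle (next (oracle S)) + 1

end OracleAlg

open Classical in
/-- The independence oracle of a matroid. -/
noncomputable def indepOracle {n : ℕ} (M : Matroid (Fin n)) (S : Finset (Fin n)) : Bool :=
  decide (M.Indep (S : Set (Fin n)))

/-- The rank of a matroid on a finite ground set, as a natural number. -/
noncomputable def matroidRank {n : ℕ} (M : Matroid (Fin n)) : ℕ := M.eRank.toNat

section Packings

variable {n k : ℕ}

/-- The number of sets of the family that contain `e`. -/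
def numCovered (I : Fin k → Finset (Fin n)) (e : Fin n) : ℕ :=
  (Finset.univ.filter (fun i => e ∈ I i)).card

/-- The objective of `k`-fold matroid union: every element is counted with its multiplicity in
the family, up to its capacity. -/
def unionValue (u : Fin n → ℕ) (B : Fin k → Finset (Fin n)) : ℕ :=
  ∑ e, min (u e) (numCovered B e)

open Classical in
/-- The optimum of `k`-fold matroid union: the maximum objective over all families of `k` bases. -/
noncomputable def unionOpt (M : Matroid (Fin n)) (u : Fin n → ℕ) (k : ℕ) : ℕ :=
  (Finset.univ.filter
    (fun B : Fin k → Finset (Fin n) => ∀ i, M.IsBase (B i : Set (Fin n)))).sup (unionValue u)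

/-- `I` is a packing of `k` independent sets: no element is used more often than its capacity. -/
def IsPacking (M : Matroid (Fin n)) (u : Fin n → ℕ) (I : Fin k → Finset (Fin n)) : Prop :=
  (∀ i, M.Indep (I i : Set (Fin n))) ∧ ∀ e, numCovered I e ≤ u e

/-- The total capacity used by a packing. -/
def packingSize (I : Fin k → Finset (Fin n)) : ℕ := ∑ i, (I i).card

/-- `I` is a packing of `k` independent sets of maximum capacity. -/
def IsMaximumPacking (M : Matroid (Fin n)) (u : Fin n → ℕ) (I : Fin k → Finset (Fin n)) : Prop :=
  IsPacking M u I ∧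
    ∀ J : Fin k → Finset (Fin n), IsPacking M u J → packingSize J ≤ packingSize I

/-- Every uncovered element is spanned by each set of the family. -/
def IsMaximalFamily (M : Matroid (Fin n)) (u : Fin n → ℕ) (I : Fin k → Finset (Fin n)) : Prop :=
  ∀ e, numCovered I e < u e → ∀ i, e ∈ M.closure (I i : Set (Fin n))

/-- Each set of the family spans the next one. -/
def IsDecreasing (M : Matroid (Fin n)) (I : Fin k → Finset (Fin n)) : Prop :=
  ∀ i j : Fin k, i.val + 1 = j.val → (I j : Set (Fin n)) ⊆ M.closure (I i : Set (Fin n))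

/-- A packing of `k` independent sets that is maximal and in decreasing order. -/
def IsGoodPacking (M : Matroid (Fin n)) (u : Fin n → ℕ) (I : Fin k → Finset (Fin n)) : Prop :=
  IsPacking M u I ∧ IsMaximalFamily M u I ∧ IsDecreasing M I

end Packings

/-- A configuration of the matroid push-relabel algorithm: `k` sets, the current level of every
element, and, for each set and each of its elements, the level at which the element was inserted
into that set (the value of `insLevel i e` is irrelevant when `e ∉ base i`). -/
structure PushRelabelConfig (n k : ℕ) : Type where
  base : Fin k → Finset (Fin n)
  level : Fin n → ℕ
  insLevel : Fin k → Fin n → ℕ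

namespace PushRelabelConfig

variable {n k : ℕ}

/-- The elements of the `i`-th base that were inserted at level at least `j`. -/
def upper (P : PushRelabelConfig n k) (i : Fin k) (j : ℕ) : Finset (Fin n) :=
  (P.base i).filter (fun e => j ≤ P.insLevel i e)

/-- The push-relabel invariants with height `h`, with the bases in (level-wise) decreasing
order. -/
structure Valid (M : Matroid (Fin n)) (u : Fin n → ℕ) (h : ℕ) (P : PushRelabelConfig n k) :
    Prop where
  isBase : ∀ i, M.IsBase (P.base i : Set (Fin n))
  /-- Levels never decrease, so an element was inserted at no more than its current level. -/
  insLevel_le : ∀ i, ∀ e ∈ P.base i, P.insLevel i e ≤ P.level e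
  overpacked : ∀ e, u e < numCovered P.base e → P.level e = 0
  span : ∀ (i : Fin k) (j : ℕ) (e : Fin n), j < P.level e →
    e ∈ M.closure (P.upper i j : Set (Fin n))
  uncovered : ∀ e, numCovered P.base e < u e → h ≤ P.level e
  decreasing : ∀ j, IsDecreasing M (fun i => P.upper i j)

/-- `I` is a trimming of the bases to their useful part: the multiplicity of every element is cut
down to its capacity, and all elements inserted at a positive level stay in place. -/
def IsTrimming (u : Fin n → ℕ) (P : PushRelabelConfig n k) (I : Fin k → Finset (Fin n)) : Prop :=
  (∀ e, numCovered I e = min (u e) (numCovered P.base e)) ∧ ∀ i, P.upper i 1 ⊆ I i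

end PushRelabelConfig

section Exchange

variable {n k : ℕ}

/-- The vertices of the exchange graph: `s`, `t`, and a copy of every element for every index. -/
inductive AuxVertex (n k : ℕ) : Type where
  | source : AuxVertex n k
  | sink : AuxVertex n k
  | node (e : Fin n) (i : Fin k) : AuxVertex n k

/-- The arcs of the exchange graph of the family `I`. -/
inductive ExchangeArc (M : Matroid (Fin n)) (u : Fin n → ℕ) (I : Fin k → Finset (Fin n)) :
    AuxVertex n k → AuxVertex n k → Prop where
  /-- start to exchange an uncovered element into a set -/
  | start (e : Fin n) (i : Fin k) (he : numCovered I e < u e) (hi : e ∉ I i) :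
      ExchangeArc M u I .source (.node e i)
  /-- exchange `e` for `d` in `I i` -/
  | exchange (e d : Fin n) (i : Fin k) (he : e ∉ I i) (hd : d ∈ I i)
      (hind : M.Indep (insert e ((I i : Set (Fin n)) \ {d}))) :
      ExchangeArc M u I (.node e i) (.node d i)
  /-- remove a covered element `d` from `I i` and use it for `I j` -/
  | shuffle (d : Fin n) (i j : Fin k) (hi : d ∈ I i) (hj : d ∉ I j) (hd : u d ≤ numCovered I d) :
      ExchangeArc M u I (.node d i) (.node d j)
  /-- insert `e` into `I i` -/
  | finish (e : Fin n) (i : Fin k) (he : e ∉ M.closure (I i : Set (Fin n))) :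
      ExchangeArc M u I (.node e i) .sink

/-- `p` lists the inner vertices of an `(s,t)`-path without repetition in the exchange graph. -/
def IsSTPath (M : Matroid (Fin n)) (u : Fin n → ℕ) (I : Fin k → Finset (Fin n))
    (p : List (Fin n × Fin k)) : Prop :=
  p.Nodup ∧ List.IsChain (ExchangeArc M u I)
    (AuxVertex.source :: (p.map (fun x => AuxVertex.node x.1 x.2) ++ [AuxVertex.sink]))

/-- Perform all exchanges along `p`: for every vertex `(e, i)` of `p`, the element `e` is removed
from `I i` if it is there, and inserted otherwise. -/
def augmentAlong (I : Fin k → Finset (Fin n)) (p : List (Fin n × Fin k)) :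
    Fin k → Finset (Fin n) :=
  fun i => symmDiff (I i) (Finset.univ.filter (fun e => (e, i) ∈ p))

end Exchange

/-! Everything rests on the easy half of matroid union duality, `unionValue_le`: if sets `T i` all
span `S`, no family of independent sets scores more than the capacity outside `S` plus the total
size of the `T i`. The algorithms maintain spanning relations that make this bound tight or nearly
tight. Keeping the families decreasing is what makes this cheap: the last set spans least, so one
query about it settles all indices in the positive case, and the first set that fails to span an
element is found by binary search.

Push-relabel. For each positive level `j` below the height, the bound is applied to the elements of
level above `j` and to the parts of the bases inserted at level at least `j`. The loss is the number
of copies whose insertion level and current level are both `j`. Summed over `j` these losses are at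
most the current value, so the average loss is a small fraction
(`PushRelabelConfig.Valid.unionOpt_le`). A push inserts an uncovered element at its level into the
first base that does not span it there. This preserves all spans (`PushInv.push`) and increases the
sum of the insertion levels, which never exceeds height times OPT because elements inserted at
positive level are not overpacked (`PushInv.totalLevel_le_unionOpt`). Copies of level zero are
ordered by index; this finer order lets the bases be trimmed to a decreasing packing
(`TrimInv.insert`).

Augmentation. Subsets `T i` of the packed sets that span one common flat containing all uncovered
elements are both an optimality certificate and a cut in the exchange graph
(`IsTight.isMaximumPacking`, `IsTight.not_isSTPath`). The search grows visited sets `D i` towards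
such a family. As the family is decreasing, a newly visited element has to be spanned only by the
last and by the preceding visited set, instead of by all `k` (`SearchInv.isTight`). Missing circuit
elements are found by binary search, at logarithmic cost per newly visited element
(`solvable_circuit`). Paths need not be shortest: an element is removed from a set only while
everything inserted earlier there is spanned without it (`ExchangeTrace.augment`). The tight family
left by failed searches survives later augmentations, so the scan of the ground set is paid once
(`solvable_augment`, `solvable_extend`).

The exact algorithm approximates and then augments, with an accuracy that balances the two costs
(`balanced_accuracy`). Two degenerate cases are treated apart: rank at most one, where logarithms
vanish but the matroid is known after linearly many queries (`Solvable.of_matroidRank_of_imp`), and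
very large `k`, where all copies fit into different sets (`exists_spread`). -/

/-! ### Composing query algorithms and their specifications. -/

namespace OracleAlg

variable {n : ℕ} {β γ : Type}

/-- Run an algorithm, then continue with its result. -/
def bind : OracleAlg n β → (β → OracleAlg n γ) → OracleAlg n γ
  | result b, f => f b
  | query S next, f => query S fun a => bind (next a) f

theorem run_bind (o : Finset (Fin n) → Bool) (A : OracleAlg n β) (f : β → OracleAlg n γ) :
    (A.bind f).run o = (f (A.run o)).run o := by
  induction A with
  | result b => rfl
  | query S next ih => exact ih (o S)

theorem queries_bind (o : Finset (Fin n) → Bool) (A : OracleAlg n β) (f : β → OracleAlg n γ) :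
    (A.bind f).queries o = A.queries o + (f (A.run o)).queries o := by
  induction A with
  | result b => simp [bind, queries, run]
  | query S next ih => simp only [bind, queries, run, ih (o S)]; omega

end OracleAlg

/-- Some algorithm produces, on every matroid with the property `pre`, a result and a number of
queries that satisfy `post`. -/
def Solvable {n : ℕ} {β : Type} (pre : Matroid (Fin n) → Prop)
    (post : Matroid (Fin n) → β → ℕ → Prop) : Prop :=
  ∃ A : OracleAlg n β, ∀ M, pre M → post M (A.run (indepOracle M)) (A.queries (indepOracle M))

/-- The property `p` is decided by one query on all matroids with the property `pre`. -/
def Testable {n : ℕ} (pre p : Matroid (Fin n) → Prop) : Prop :=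
  ∃ (S : Finset (Fin n)) (b : Bool), ∀ M, pre M → (p M ↔ indepOracle M S = b)

section Solvable

variable {n : ℕ} {β γ : Type} {pre pre' p : Matroid (Fin n) → Prop}
  {post post' : Matroid (Fin n) → β → ℕ → Prop}

theorem indepOracle_eq_true {M : Matroid (Fin n)} {S : Finset (Fin n)} :
    indepOracle M S = true ↔ M.Indep (S : Set (Fin n)) := by
  simp [indepOracle]

theorem indepOracle_eq_false {M : Matroid (Fin n)} {S : Finset (Fin n)} :
    indepOracle M S = false ↔ ¬ M.Indep (S : Set (Fin n)) := by
  simp [indepOracle]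

theorem Solvable.pure (b : β) (h : ∀ M, pre M → post M b 0) : Solvable pre post :=
  ⟨.result b, h⟩

theorem Solvable.mono (h : Solvable pre post) (hpre : ∀ M, pre' M → pre M)
    (hpost : ∀ M b c, pre' M → post M b c → post' M b c) : Solvable pre' post' :=
  h.imp fun _ hA M hM => hpost M _ _ hM (hA M (hpre M hM))

/-- What a result reveals about the matroid becomes part of the precondition of the continuation.
The continuation is chosen for each result separately, so it learns about the matroid only through
results. -/
theorem Solvable.bind {Q : Matroid (Fin n) → γ → ℕ → Prop} (h : Solvable pre Q)
    (h' : ∀ g, Solvable (fun M => pre M ∧ ∃ c, Q M g c)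
      (fun M b c' => ∀ c, Q M g c → post M b (c + c'))) : Solvable pre post := by
  obtain ⟨A, hA⟩ := h
  choose f hf using h'
  refine ⟨A.bind f, fun M hM => ?_⟩
  rw [A.run_bind, A.queries_bind]
  exact hf _ M ⟨hM, _, hA M hM⟩ _ (hA M hM)

theorem Solvable.test (hp : Testable pre p)
    (h₁ : Solvable (fun M => pre M ∧ p M) (fun M b c => post M b (c + 1)))
    (h₂ : Solvable (fun M => pre M ∧ ¬ p M) (fun M b c => post M b (c + 1))) :
    Solvable pre post := by
  obtain ⟨S, b, hS⟩ := hp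
  obtain ⟨A₁, hA₁⟩ := h₁
  obtain ⟨A₂, hA₂⟩ := h₂
  refine ⟨.query S fun a => if a = b then A₁ else A₂, fun M hM => ?_⟩
  simp only [OracleAlg.run, OracleAlg.queries]
  by_cases h : indepOracle M S = b
  · simpa only [h, if_true] using hA₁ M ⟨hM, (hS M hM).2 h⟩
  · simpa only [h, if_false] using hA₂ M ⟨hM, fun h' => h ((hS M hM).1 h')⟩

theorem Testable.not (hp : Testable pre p) : Testable pre (fun M => ¬ p M) := by
  obtain ⟨S, b, hS⟩ := hp
  refine ⟨S, !b, fun M hM => ?_⟩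
  simp only [hS M hM]
  cases b <;> simp

theorem Testable.mono (hp : Testable pre p) (h : ∀ M, pre' M → pre M) : Testable pre' p := by
  obtain ⟨S, b, hS⟩ := hp
  exact ⟨S, b, fun M hM => hS M (h M hM)⟩

/-! ### Search primitives with an independence oracle. -/

/-- Membership of `e` in the closure of a known independent set takes one query. -/
theorem testable_mem_closure {D : Finset (Fin n)} (e : Fin n)
    (h : ∀ M, pre M → M.E = Set.univ ∧ M.Indep (D : Set (Fin n))) :
    Testable pre (fun M => e ∈ M.closure (D : Set (Fin n))) := by
  by_cases he : e ∈ D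
  · refine ⟨D, true, fun M hM => ?_⟩
    obtain ⟨hE, hD⟩ := h M hM
    simp only [indepOracle_eq_true, hD, iff_true]
    exact M.mem_closure_of_mem' (by simpa using he) (by simp [hE])
  · refine ⟨insert e D, false, fun M hM => ?_⟩
    obtain ⟨hE, hD⟩ := h M hM
    rw [indepOracle_eq_false, Finset.coe_insert, hD.insert_indep_iff_of_notMem (by simpa using he)]
    simp [hE]

/-- Binary search for a place where a property becomes true. -/
theorem solvable_bsearch {q : Matroid (Fin n) → ℕ → Prop} (m lo hi : ℕ) (hlt : lo < hi)
    (hm : hi - lo ≤ 2 ^ m) (hlo : ∀ M, pre M → ¬ q M lo) (hhi : ∀ M, pre M → q M hi)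
    (ht : ∀ t, lo < t → t < hi → Testable pre (fun M => q M t)) :
    Solvable pre (fun M t c => lo ≤ t ∧ t < hi ∧ ¬ q M t ∧ q M (t + 1) ∧ c ≤ m) := by
  induction m generalizing lo hi pre with
  | zero =>
    obtain rfl : hi = lo + 1 := by simp at hm; omega
    exact .pure lo fun M hM => ⟨le_rfl, hlt, hlo M hM, hhi M hM, le_rfl⟩
  | succ m ih =>
    by_cases h1 : hi = lo + 1
    · subst h1
      exact .pure lo fun M hM => ⟨le_rfl, hlt, hlo M hM, hhi M hM, Nat.zero_le _⟩
    rw [pow_succ] at hm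
    -- No monotonicity of `q` is needed: the invariant is only that `q` fails at `lo` and holds at
    -- `hi`.
    obtain ⟨mid, hmid⟩ : ∃ mid, mid = lo + (hi - lo) / 2 := ⟨_, rfl⟩
    refine .test (ht mid (by omega) (by omega)) ?_ ?_
    · refine (ih (pre := fun M => pre M ∧ q M mid) lo mid (by omega) (by omega)
        (fun M hM => hlo M hM.1) (fun M hM => hM.2)
        (fun t h h' => (ht t h (by omega)).mono fun M hM => hM.1)).mono (fun _ h => h) ?_
      rintro M t c - ⟨h1, h2, h3, h4, h5⟩
      exact ⟨h1, by omega, h3, h4, by omega⟩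
    · refine (ih (pre := fun M => pre M ∧ ¬ q M mid) mid hi (by omega) (by omega)
        (fun M hM => hM.2) (fun M hM => hhi M hM.1)
        (fun t h h' => (ht t (by omega) h').mono fun M hM => hM.1)).mono (fun _ h => h) ?_
      rintro M t c - ⟨h1, h2, h3, h4, h5⟩
      exact ⟨by omega, h2, h3, h4, by omega⟩

theorem mem_closure_of_mem_set {M : Matroid (Fin n)} (hE : M.E = Set.univ) {S : Set (Fin n)}
    {x : Fin n} (h : x ∈ S) : x ∈ M.closure S :=
  M.mem_closure_of_mem' h (by simp [hE])

/-- In a known independent set that spans `e`, find the last element that is needed to span `e`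
when the elements are taken in the order of decreasing key. -/
theorem solvable_pivot (B : Finset (Fin n)) (key : Fin n → ℕ) (e : Fin n)
    (h : ∀ M, pre M → M.E = Set.univ ∧ M.Indep (B : Set (Fin n)) ∧
      e ∈ M.closure (B : Set (Fin n)) ∧ e ∉ M.closure ∅) :
    Solvable pre (fun M d c => d ∈ B ∧ (∃ S : Finset (Fin n), S ⊆ B ∧ d ∉ S ∧
      (∀ x ∈ B, key d < key x → x ∈ S) ∧ (∀ x ∈ S, key d ≤ key x) ∧
      e ∉ M.closure (S : Set (Fin n)) ∧ e ∈ M.closure (insert d (S : Set (Fin n)))) ∧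
      c ≤ Nat.clog 2 B.card) := by
  classical
  -- If no matroid satisfies the precondition, any answer is correct. Otherwise a witness shows that
  -- `B` is nonempty, because it spans the non-loop `e`.
  by_cases hne : ∃ M, pre M
  swap
  · exact .pure e fun M hM => (hne ⟨M, hM⟩).elim
  let r : Fin n → Fin n → Prop := fun x y => key y ≤ key x
  let l := B.toList.insertionSort r
  have hperm : l.Perm B.toList := List.perm_insertionSort _ _
  have : Std.Total r := ⟨fun x y => le_total (key y) (key x)⟩
  have : IsTrans (Fin n) r := ⟨fun x y z h h' => le_trans h' h⟩
  have hsort : l.Pairwise r := List.pairwise_insertionSort _ _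
  have hnodup : l.Nodup := hperm.nodup_iff.2 B.nodup_toList
  have hmem : ∀ x, x ∈ l ↔ x ∈ B := fun x => by rw [hperm.mem_iff, Finset.mem_toList]
  have hlen : l.length = B.card := by rw [hperm.length_eq, Finset.length_toList]
  have hsub : ∀ t, (l.take t).toFinset ⊆ B := fun t x hx => by
    rw [List.mem_toFinset] at hx
    exact (hmem x).1 (List.mem_of_mem_take hx)
  have hpos : 0 < B.card := by
    obtain ⟨M, hM⟩ := hne
    obtain ⟨_, _, h1, h2⟩ := h M hM
    rcases B.eq_empty_or_nonempty with rfl | hB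
    · simp at h1 h2; exact (h2 h1).elim
    · exact hB.card_pos
  have hfull : (l.take B.card).toFinset = B := by
    rw [← hlen, List.take_length]; ext x; simp [hmem]
  refine Solvable.bind (solvable_bsearch
    (q := fun M t => e ∈ M.closure ((l.take t).toFinset : Set (Fin n))) (Nat.clog 2 B.card) 0 B.card
    hpos (by simpa using Nat.le_pow_clog (by norm_num) _) (fun M hM => by simpa using (h M hM).2.2.2)
    (fun M hM => by rw [hfull]; exact (h M hM).2.2.1)
    (fun t _ _ => testable_mem_closure e fun M hM =>
      ⟨(h M hM).1, (h M hM).2.1.subset (by exact_mod_cast hsub t)⟩)) fun t => ?_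
  by_cases ht : t < l.length
  swap
  · exact .pure e fun M ⟨_, c, _, h', _⟩ => absurd h' (by omega)
  refine .pure l[t] fun M _ c ⟨_, _, h3, h4, h5⟩ =>
    ⟨(hmem _).1 (List.getElem_mem ht), ⟨(l.take t).toFinset, hsub t, ?_, ?_, ?_, h3, ?_⟩, h5⟩
  · rw [List.mem_toFinset, List.mem_take_iff_getElem]
    rintro ⟨i, hi, hi'⟩
    have := (hnodup.getElem_inj_iff).1 hi'
    omega
  · intro x hx hlt
    obtain ⟨i, hi, rfl⟩ := List.mem_iff_getElem.1 ((hmem x).2 hx)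
    rw [List.mem_toFinset, List.mem_take_iff_getElem]
    refine ⟨i, ?_, rfl⟩
    by_contra hcon
    rcases (show t ≤ i by omega).eq_or_lt with rfl | hlt'
    · exact lt_irrefl _ hlt
    · exact absurd (List.pairwise_iff_getElem.1 hsort t i ht hi hlt') (not_le.2 hlt)
  · intro x hx
    rw [List.mem_toFinset, List.mem_take_iff_getElem] at hx
    obtain ⟨i, hi, rfl⟩ := hx
    exact List.pairwise_iff_getElem.1 hsort i t (by omega) ht (by omega)
  · convert h4 using 2
    ext x
    have hx : x ∈ l.take (t + 1) ↔ x ∈ l.take t ∨ x = l[t] := by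
      rw [show l.take (t + 1) = l.take t ++ [l[t]] by rw [List.take_add_one]; simp [ht],
        List.mem_append, List.mem_singleton]
    simp [hx, or_comm]

/-- Find the first set of a known family that does not span `e`. -/
theorem solvable_first_unspanned {k : ℕ} (J : Fin k → Finset (Fin n)) (e : Fin n) (m : Fin k)
    (h : ∀ M, pre M → M.E = Set.univ ∧ (∀ i ≤ m, M.Indep (J i : Set (Fin n))) ∧
      e ∉ M.closure (J m : Set (Fin n))) :
    Solvable pre (fun M i c => i ≤ m ∧ e ∉ M.closure (J i : Set (Fin n)) ∧
      (∀ i' : Fin k, i'.val + 1 = i.val → e ∈ M.closure (J i' : Set (Fin n))) ∧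
      c ≤ Nat.clog 2 (m.val + 1)) := by
  -- Indices are shifted by one: position `0` stands for a fictitious set before the first one that
  -- spans everything, so the search may return the first set.
  refine Solvable.bind (solvable_bsearch
    (q := fun M t => ∃ i : Fin k, i.val + 1 = t ∧ e ∉ M.closure (J i : Set (Fin n)))
    (Nat.clog 2 (m.val + 1)) 0 (m.val + 1) (by omega)
    ((Nat.sub_le _ _).trans (Nat.le_pow_clog (by norm_num) _)) (fun M hM => by simp)
    (fun M hM => ⟨m, rfl, (h M hM).2.2⟩) (fun t h0 htm => ?_)) fun t => ?_
  · obtain ⟨i, hi⟩ : ∃ i : Fin k, i.val + 1 = t := ⟨⟨t - 1, by omega⟩, by simp; omega⟩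
    have := (testable_mem_closure (pre := pre) (D := J i) e fun M hM =>
      ⟨(h M hM).1, (h M hM).2.1 i (by rw [Fin.le_def]; omega)⟩).not
    convert this using 3 with M
    constructor
    · rintro ⟨i', hi', h'⟩
      obtain rfl : i' = i := Fin.ext (by omega)
      exact h'
    · exact fun h' => ⟨i, hi, h'⟩
  · by_cases ht : t < m.val + 1
    swap
    · exact .pure m fun M ⟨_, c, _, h', _⟩ => absurd h' ht
    refine .pure ⟨t, by omega⟩ fun M _ c ⟨_, _, h3, ⟨i, hi, h4⟩, h5⟩ => ⟨?_, ?_, ?_, h5⟩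
    · rw [Fin.le_def]; simp; omega
    · rwa [show (⟨t, by omega⟩ : Fin k) = i from Fin.ext (by simp; omega)]
    · intro i' hi'
      by_contra hcon
      exact h3 ⟨i', by simpa using hi', hcon⟩

/-- Find a base and all loops with at most `2 * n` queries. -/
theorem solvable_base_loops (hE : ∀ M, pre M → M.E = Set.univ) :
    Solvable pre (fun M (x : Finset (Fin n) × Finset (Fin n)) c =>
      M.IsBase (x.1 : Set (Fin n)) ∧ (∀ e, e ∈ x.2 ↔ e ∈ M.closure ∅) ∧ c ≤ 2 * n) := by
  classical
  -- `T` is the set of unprocessed elements, `I` spans all others, and `L` collects the loops among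
  -- them. Each element costs a loop test and, if it is no loop, a span test.
  have greedy : ∀ (T I L : Finset (Fin n)) (pre' : Matroid (Fin n) → Prop),
      (∀ M, pre' M → M.E = Set.univ ∧ M.Indep (I : Set (Fin n)) ∧
        (∀ e ∉ T, e ∈ M.closure (I : Set (Fin n))) ∧ (∀ e ∉ T, e ∈ L ↔ e ∈ M.closure ∅) ∧
        ∀ e ∈ L, e ∉ T) →
      Solvable pre' (fun M (x : Finset (Fin n) × Finset (Fin n)) c =>
        M.IsBase (x.1 : Set (Fin n)) ∧ (∀ e, e ∈ x.2 ↔ e ∈ M.closure ∅) ∧ c ≤ 2 * T.card) := by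
    intro T
    induction T using Finset.induction_on with
    | empty =>
      intro I L pre' h
      refine .pure (I, L) fun M hM => ?_
      obtain ⟨hE, hI, h1, h2, -⟩ := h M hM
      exact ⟨hI.isBase_of_ground_subset_closure fun e _ => h1 e (by simp), fun e => h2 e (by simp),
        by simp⟩
    | insert e T heT ih =>
      intro I L pre' h
      refine .test (testable_mem_closure (D := ∅) e fun M hM => ⟨(h M hM).1, by simp⟩) ?_ ?_
      · refine (ih I (insert e L) (fun M => pre' M ∧ e ∈ M.closure ((∅ : Finset (Fin n)) : Set (Fin n)))
          ?_).mono (fun M hM => hM) ?_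
        · rintro M ⟨hM, he⟩
          simp only [Finset.coe_empty] at he
          obtain ⟨hE, hI, h1, h2, h3⟩ := h M hM
          refine ⟨hE, hI, fun f hf => ?_, fun f hf => ?_, fun f hf => ?_⟩
          · rcases eq_or_ne f e with rfl | hfe
            · exact M.closure_subset_closure (Set.empty_subset _) he
            · exact h1 f (by simp [hfe, hf])
          · rcases eq_or_ne f e with rfl | hfe
            · simp [he]
            · simpa [hfe] using h2 f (by simp [hfe, hf])
          · rcases Finset.mem_insert.1 hf with rfl | hf
            · exact heT
            · exact fun hfT => h3 f hf (Finset.mem_insert_of_mem hfT)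
        · rintro M x c - ⟨h1, h2, h3⟩
          refine ⟨h1, h2, ?_⟩
          rw [Finset.card_insert_of_notMem heT]; omega
      · refine .test (testable_mem_closure (D := I) e
          fun M hM => ⟨(h M hM.1).1, (h M hM.1).2.1⟩) ?_ ?_
        · refine (ih I L (fun M => pre' M ∧ e ∉ M.closure ((∅ : Finset (Fin n)) : Set (Fin n)) ∧
            e ∈ M.closure (I : Set (Fin n))) ?_).mono (fun M hM => ⟨hM.1.1, hM.1.2, hM.2⟩) ?_
          · rintro M ⟨hM, he, he'⟩
            simp only [Finset.coe_empty] at he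
            obtain ⟨hE, hI, h1, h2, h3⟩ := h M hM
            refine ⟨hE, hI, fun f hf => ?_, fun f hf => ?_, fun f hf => ?_⟩
            · rcases eq_or_ne f e with rfl | hfe
              · exact he'
              · exact h1 f (by simp [hfe, hf])
            · rcases eq_or_ne f e with rfl | hfe
              · simpa [he] using fun h => h3 f h (Finset.mem_insert_self _ _)
              · exact h2 f (by simp [hfe, hf])
            · exact fun hfT => h3 f hf (Finset.mem_insert_of_mem hfT)
          · rintro M x c - ⟨h1, h2, h3⟩
            refine ⟨h1, h2, ?_⟩
            rw [Finset.card_insert_of_notMem heT]; omega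
        · refine (ih (insert e I) L (fun M => pre' M ∧
            e ∉ M.closure ((∅ : Finset (Fin n)) : Set (Fin n)) ∧ e ∉ M.closure (I : Set (Fin n)))
            ?_).mono (fun M hM => ⟨hM.1.1, hM.1.2, hM.2⟩) ?_
          · rintro M ⟨hM, he, he'⟩
            simp only [Finset.coe_empty] at he
            obtain ⟨hE, hI, h1, h2, h3⟩ := h M hM
            refine ⟨hE, ?_, fun f hf => ?_, fun f hf => ?_, fun f hf => ?_⟩
            · rw [Finset.coe_insert, hI.insert_indep_iff]
              exact .inl (by simp [hE, he'])
            · rcases eq_or_ne f e with rfl | hfe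
              · exact mem_closure_of_mem_set hE (by simp)
              · exact M.closure_subset_closure (by simp) (h1 f (by simp [hfe, hf]))
            · rcases eq_or_ne f e with rfl | hfe
              · simpa [he] using fun h => h3 f h (Finset.mem_insert_self _ _)
              · exact h2 f (by simp [hfe, hf])
            · exact fun hfT => h3 f hf (Finset.mem_insert_of_mem hfT)
          · rintro M x c - ⟨h1, h2, h3⟩
            refine ⟨h1, h2, ?_⟩
            rw [Finset.card_insert_of_notMem heT]; omega
  simpa using greedy Finset.univ ∅ ∅ pre (fun M hM => ⟨hE M hM, by simp, by simp, by simp, by simp⟩)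

/-! ### Rank, and the reduction to rank at least two. -/

theorem matroidRank_eq_card {M : Matroid (Fin n)} {B : Finset (Fin n)}
    (hB : M.IsBase (B : Set (Fin n))) : matroidRank M = B.card := by
  rw [matroidRank, ← hB.encard_eq_eRank, Set.encard_coe_eq_coe_finsetCard, ENat.toNat_natCast]

theorem coe_matroidRank (M : Matroid (Fin n)) : (matroidRank M : ℕ∞) = M.eRank := by
  refine ENat.natCast_toNat ?_
  obtain ⟨B, hB⟩ := M.exists_isBase
  rw [← hB.encard_eq_eRank]
  exact (Set.toFinite B).encard_lt_top.ne

theorem indep_card_le_matroidRank {M : Matroid (Fin n)} {I : Finset (Fin n)}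
    (hI : M.Indep (I : Set (Fin n))) : I.card ≤ matroidRank M := by
  have := hI.encard_le_eRank
  rw [← coe_matroidRank, Set.encard_coe_eq_coe_finsetCard] at this
  exact_mod_cast this

theorem card_le_card_of_subset_closure {M : Matroid (Fin n)} {I J : Finset (Fin n)}
    (hI : M.Indep (I : Set (Fin n))) (h : (I : Set (Fin n)) ⊆ M.closure (J : Set (Fin n))) :
    I.card ≤ J.card := by
  have h1 := (M.eRk_mono h).trans_eq (M.eRk_closure_eq J) |>.trans (M.eRk_le_encard J)
  rw [hI.eRk_eq_encard, Set.encard_coe_eq_coe_finsetCard, Set.encard_coe_eq_coe_finsetCard] at h1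
  exact_mod_cast h1

/-- A matroid of rank at most one is determined by its loops and its rank. -/
theorem eq_of_matroidRank_le_one {M N : Matroid (Fin n)} (hM : M.E = Set.univ)
    (hN : N.E = Set.univ) {B : Finset (Fin n)} (hBM : M.IsBase (B : Set (Fin n)))
    (hBN : N.IsBase (B : Set (Fin n))) (hB : B.card ≤ 1)
    (hL : ∀ e, e ∈ M.closure ∅ ↔ e ∈ N.closure ∅) : M = N := by
  classical
  have key : ∀ {M : Matroid (Fin n)} (hM : M.E = Set.univ) (hBM : M.IsBase (B : Set (Fin n)))
      (I : Finset (Fin n)), M.Indep (I : Set (Fin n)) ↔ I.card ≤ 1 ∧ ∀ e ∈ I, e ∉ M.closure ∅ := by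
    intro M hM hBM I
    constructor
    · refine fun hI => ⟨(indep_card_le_matroidRank hI).trans (matroidRank_eq_card hBM ▸ hB), ?_⟩
      intro e he hl
      exact hI.notMem_closure_sdiff_of_mem (by simpa using he)
        (M.closure_subset_closure (Set.empty_subset _) hl)
    · rintro ⟨h1, h2⟩
      rcases Nat.le_one_iff_eq_zero_or_eq_one.1 h1 with h1 | h1
      · simp [Finset.card_eq_zero.1 h1]
      · obtain ⟨x, rfl⟩ := Finset.card_eq_one.1 h1
        have := M.empty_indep.insert_indep_iff (e := x)
        simpa [hM, h2] using this
  refine Matroid.ext_indep (hM.trans hN.symm) fun I _ => ?_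
  have h1 := key hM hBM I.toFinset
  have h2 := key hN hBN I.toFinset
  simp only [Set.coe_toFinset] at h1 h2
  simp only [h1, h2, hL]

/-- On matroids of rank at most one, `2 * n` queries suffice for every task. -/
theorem Solvable.of_matroidRank_of_imp {R : Matroid (Fin n) → β → Prop}
    {Q : Matroid (Fin n) → ℕ → Prop} (hE : ∀ M, pre M → M.E = Set.univ)
    (h : Solvable pre (fun M b c => R M b ∧ (2 ≤ matroidRank M → Q M c))) :
    Solvable pre (fun M b c => R M b ∧ ((matroidRank M ≤ 1 ∧ c ≤ 2 * n) ∨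
      (2 ≤ matroidRank M ∧ ∃ c', Q M c' ∧ c ≤ 2 * n + c'))) := by
  refine .bind (solvable_base_loops hE) fun ⟨B, L⟩ => ?_
  by_cases hB : B.card ≤ 1
  · by_cases hne : ∃ N, pre N ∧ N.IsBase (B : Set (Fin n)) ∧ ∀ e, e ∈ L ↔ e ∈ N.closure ∅
    · obtain ⟨N, hN, hBN, hLN⟩ := hne
      obtain ⟨A, hA⟩ := h
      -- Base and loops already determine the matroid, so `A` is simulated on the known oracle of
      -- `N` without further queries.
      refine .pure (A.run (indepOracle N)) ?_
      rintro M ⟨hM, -⟩ c ⟨hBM, hLM, hc⟩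
      obtain rfl : M = N := eq_of_matroidRank_le_one (hE M hM) (hE N hN) hBM hBN hB
        fun e => (hLM e).symm.trans (hLN e)
      exact ⟨(hA M hM).1, .inl ⟨matroidRank_eq_card hBM ▸ hB, hc⟩⟩
    · refine h.mono (fun M hM => hM.1) ?_
      rintro M b c ⟨hM, c', h1, h2, -⟩ -
      exact (hne ⟨M, hM, h1, h2⟩).elim
  · refine h.mono (fun M hM => hM.1) ?_
    rintro M b c - ⟨h1, h2⟩ c' ⟨hBM, hLM, hc⟩
    have hr : 2 ≤ matroidRank M := by
      rw [matroidRank_eq_card hBM]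
      simp only at hB ⊢
      omega
    exact ⟨h1, .inr ⟨hr, c, h2 hr, by omega⟩⟩

/-- Splitting off rank at most one is necessary because `log r` vanishes there, whereas from rank
two on it absorbs the additive constants in the cost. -/
theorem Solvable.of_matroidRank {R : Matroid (Fin n) → β → Prop} {cost : Matroid (Fin n) → ℕ}
    (hE : ∀ M, pre M → M.E = Set.univ)
    (h : Solvable pre (fun M b c => R M b ∧ c ≤ cost M)) :
    Solvable pre (fun M b c => R M b ∧
      ((matroidRank M ≤ 1 ∧ c ≤ 2 * n) ∨ (2 ≤ matroidRank M ∧ c ≤ 2 * n + cost M))) := by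
  refine (Solvable.of_matroidRank_of_imp (Q := fun M c => c ≤ cost M) hE (h.mono (fun M hM => hM)
    fun M b c _ h => ⟨h.1, fun _ => h.2⟩)).mono (fun M hM => hM) ?_
  rintro M b c - ⟨h1, h2⟩
  refine ⟨h1, h2.imp_right ?_⟩
  rintro ⟨h3, c', h4, h5⟩
  exact ⟨h3, by omega⟩

end Solvable

/-! ### Duality bounds and tight families. -/

section Counting

variable {n k : ℕ}

theorem sum_numCovered (I : Fin k → Finset (Fin n)) (S : Finset (Fin n)) :
    ∑ e ∈ S, numCovered I e = ∑ i, (S ∩ I i).card := by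
  simp only [numCovered, Finset.card_eq_sum_ones, Finset.sum_filter]
  rw [Finset.sum_comm]
  refine Finset.sum_congr rfl fun i _ => ?_
  rw [← Finset.filter_mem_eq_inter, Finset.sum_filter]

theorem packingSize_eq_sum (I : Fin k → Finset (Fin n)) :
    packingSize I = ∑ e, numCovered I e := by
  rw [sum_numCovered, packingSize]
  simp

theorem numCovered_mono {I J : Fin k → Finset (Fin n)} (h : ∀ i, I i ⊆ J i) (e : Fin n) :
    numCovered I e ≤ numCovered J e :=
  Finset.card_le_card fun i hi => by
    simp only [Finset.mem_filter, Finset.mem_univ, true_and] at hi ⊢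
    exact h i hi

theorem numCovered_le (I : Fin k → Finset (Fin n)) (e : Fin n) : numCovered I e ≤ k :=
  (Finset.card_le_univ _).trans_eq (Fintype.card_fin k)

theorem packingSize_le_mul (I : Fin k → Finset (Fin n)) : packingSize I ≤ k * n := by
  refine (Finset.sum_le_card_nsmul _ _ n fun i _ => ?_).trans_eq (by simp)
  exact (Finset.card_le_univ _).trans_eq (Fintype.card_fin n)

/-- The upper bound on the objective given by a set `S` and sets that span `S`. -/
theorem unionValue_le {M : Matroid (Fin n)} (u : Fin n → ℕ) {J T : Fin k → Finset (Fin n)}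
    (hJ : ∀ i, M.Indep (J i : Set (Fin n))) (S : Finset (Fin n))
    (hS : ∀ i, ∀ e ∈ S, e ∈ M.closure (T i : Set (Fin n))) :
    unionValue u J ≤ ∑ e ∈ Sᶜ, u e + ∑ i, (T i).card := by
  rw [unionValue, ← Finset.sum_compl_add_sum S]
  refine add_le_add (Finset.sum_le_sum fun e _ => min_le_left _ _) ?_
  refine (Finset.sum_le_sum fun e _ => min_le_right _ _).trans ?_
  rw [sum_numCovered]
  refine Finset.sum_le_sum fun i _ => card_le_card_of_subset_closure
    ((hJ i).subset (by simp)) fun e he => hS i e ?_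
  simp only [Finset.coe_inter, Set.mem_inter_iff, Finset.mem_coe] at he
  exact he.1

theorem unionOpt_le_of_forall {M : Matroid (Fin n)} {u : Fin n → ℕ} {m : ℕ}
    (h : ∀ B : Fin k → Finset (Fin n), (∀ i, M.IsBase (B i : Set (Fin n))) → unionValue u B ≤ m) :
    unionOpt M u k ≤ m := by
  classical
  exact Finset.sup_le fun B hB => h B (by simpa using hB)

theorem unionValue_le_unionOpt {M : Matroid (Fin n)} (u : Fin n → ℕ) {B : Fin k → Finset (Fin n)}
    (hB : ∀ i, M.IsBase (B i : Set (Fin n))) : unionValue u B ≤ unionOpt M u k := by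
  classical
  exact Finset.le_sup (f := unionValue u) (by simpa using hB)

theorem unionOpt_le {M : Matroid (Fin n)} (u : Fin n → ℕ) {T : Fin k → Finset (Fin n)}
    (S : Finset (Fin n)) (hS : ∀ i, ∀ e ∈ S, e ∈ M.closure (T i : Set (Fin n))) :
    unionOpt M u k ≤ ∑ e ∈ Sᶜ, u e + ∑ i, (T i).card :=
  unionOpt_le_of_forall fun _ hB => unionValue_le u (fun i => (hB i).indep) S hS

theorem unionOpt_le_mul (M : Matroid (Fin n)) (u : Fin n → ℕ) (k : ℕ) :
    unionOpt M u k ≤ k * matroidRank M := by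
  refine unionOpt_le_of_forall fun B hB => ?_
  refine (Finset.sum_le_sum fun e _ => min_le_right _ _).trans ?_
  rw [← packingSize_eq_sum]
  exact (Finset.sum_le_card_nsmul _ _ _ fun i _ =>
    (matroidRank_eq_card (hB i)).ge).trans_eq (by simp)

theorem unionValue_eq_packingSize {u : Fin n → ℕ} {I : Fin k → Finset (Fin n)}
    (h : ∀ e, numCovered I e ≤ u e) : unionValue u I = packingSize I := by
  rw [packingSize_eq_sum]
  exact Finset.sum_congr rfl fun e _ => min_eq_right (h e)

/-- Extending every set to a base only increases the multiplicities, hence also the capped ones. -/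
theorem packingSize_le_unionOpt {M : Matroid (Fin n)} {u : Fin n → ℕ}
    {I : Fin k → Finset (Fin n)} (hI : IsPacking M u I) : packingSize I ≤ unionOpt M u k := by
  have h : ∀ i, ∃ B : Finset (Fin n), M.IsBase (B : Set (Fin n)) ∧ I i ⊆ B := fun i => by
    obtain ⟨B, hB, hIB⟩ := (hI.1 i).exists_isBase_superset
    exact ⟨(Set.toFinite B).toFinset, by simpa using hB, fun x hx => by
      simpa using hIB hx⟩
  choose B hB hIB using h
  rw [← unionValue_eq_packingSize hI.2]
  refine le_trans ?_ (unionValue_le_unionOpt u hB)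
  exact Finset.sum_le_sum fun e _ => min_le_min le_rfl (numCovered_mono hIB e)

/-- Use the same base through `e` for every index. This bounds `k` in terms of `n` and the optimum
when the capacities are not too small. -/
theorem min_le_unionOpt {M : Matroid (Fin n)} (hE : M.E = Set.univ) (u : Fin n → ℕ) (k : ℕ)
    {e : Fin n} (he : e ∉ M.closure ∅) : min (u e) k ≤ unionOpt M u k := by
  have hi : M.Indep {e} := by
    simpa [hE, he] using M.empty_indep.insert_indep_iff (e := e)
  obtain ⟨B, hB, hIB⟩ := hi.exists_isBase_superset
  have hB' : M.IsBase ((Set.toFinite B).toFinset : Set (Fin n)) := by simpa using hB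
  refine le_trans ?_ (unionValue_le_unionOpt u
    (B := fun _ : Fin k => (Set.toFinite B).toFinset) fun _ => hB')
  refine le_trans (min_le_min le_rfl ?_) (Finset.single_le_sum
    (f := fun e => min (u e) (numCovered (fun _ : Fin k => (Set.toFinite B).toFinset) e))
    (fun _ _ => Nat.zero_le _) (Finset.mem_univ e))
  simp [numCovered, show e ∈ B by simpa using hIB]

theorem IsDecreasing.subset_closure {M : Matroid (Fin n)} (hE : M.E = Set.univ)
    {I : Fin k → Finset (Fin n)} (h : IsDecreasing M I) {i j : Fin k} (hij : i ≤ j) :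
    (I j : Set (Fin n)) ⊆ M.closure (I i : Set (Fin n)) := by
  obtain ⟨d, hd⟩ : ∃ d, j.val = i.val + d := ⟨j.val - i.val, by rw [Fin.le_def] at hij; omega⟩
  induction d generalizing j with
  | zero =>
    obtain rfl : j = i := Fin.ext (by omega)
    exact fun x hx => mem_closure_of_mem_set hE hx
  | succ d ih =>
    have hlt : i.val + d < k := by omega
    refine (h ⟨i.val + d, hlt⟩ j (by simp; omega)).trans ?_
    exact M.closure_subset_closure_of_subset_closure
      (ih (j := ⟨i.val + d, hlt⟩) (by rw [Fin.le_def]; simp) rfl)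

theorem IsDecreasing.closure_subset {M : Matroid (Fin n)} (hE : M.E = Set.univ)
    {I : Fin k → Finset (Fin n)} (h : IsDecreasing M I) {i j : Fin k} (hij : i ≤ j) :
    M.closure (I j : Set (Fin n)) ⊆ M.closure (I i : Set (Fin n)) :=
  M.closure_subset_closure_of_subset_closure (h.subset_closure hE hij)

/-- The sets `T i ⊆ I i` all span the same flat. -/
structure IsTight (M : Matroid (Fin n)) (I T : Fin k → Finset (Fin n)) : Prop where
  subset : ∀ i, T i ⊆ I i
  span : ∀ i j, (T i : Set (Fin n)) ⊆ M.closure (T j : Set (Fin n))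

theorem IsTight.closure_eq {M : Matroid (Fin n)} {I T : Fin k → Finset (Fin n)}
    (h : IsTight M I T) (i j : Fin k) :
    M.closure (T i : Set (Fin n)) = M.closure (T j : Set (Fin n)) :=
  (M.closure_subset_closure_of_subset_closure (h.span i j)).antisymm
    (M.closure_subset_closure_of_subset_closure (h.span j i))

/-- If every uncovered element is spanned by a tight family, the packing is a maximum packing. -/
theorem IsTight.isMaximumPacking {M : Matroid (Fin n)} {u : Fin n → ℕ}
    {I T : Fin (k + 1) → Finset (Fin n)} (hI : IsPacking M u I) (h : IsTight M I T)
    (hu : ∀ e, numCovered I e < u e → e ∈ M.closure (T (Fin.last k) : Set (Fin n))) :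
    IsMaximumPacking M u I := by
  classical
  refine ⟨hI, fun J hJ => ?_⟩
  let S : Finset (Fin n) :=
    Finset.univ.filter fun e => e ∈ M.closure (T (Fin.last k) : Set (Fin n))
  have hS : ∀ i, ∀ e ∈ S, e ∈ M.closure (T i : Set (Fin n)) := fun i e he => by
    rw [h.closure_eq i (Fin.last k)]; simpa [S] using he
  rw [← unionValue_eq_packingSize hJ.2]
  refine (unionValue_le u hJ.1 S hS).trans ?_
  rw [packingSize_eq_sum, ← Finset.sum_compl_add_sum S]
  refine add_le_add (Finset.sum_le_sum fun e he => ?_) ?_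
  · by_contra hlt
    exact (Finset.mem_compl.1 he) (by simpa [S] using hu e (not_le.1 hlt))
  · rw [sum_numCovered]
    refine Finset.sum_le_sum fun i _ => Finset.card_le_card fun x hx => ?_
    refine Finset.mem_inter.2 ⟨?_, h.subset i hx⟩
    simp only [S, Finset.mem_filter, Finset.mem_univ, true_and]
    exact h.span i _ hx

/-- If every uncovered element is spanned by a tight family, there is no augmenting path. -/
theorem IsTight.not_isSTPath {M : Matroid (Fin n)} (hE : M.E = Set.univ) {u : Fin n → ℕ}
    {I T : Fin (k + 1) → Finset (Fin n)} (h : IsTight M I T)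
    (hu : ∀ e, numCovered I e < u e → e ∈ M.closure (T (Fin.last k) : Set (Fin n)))
    (p : List (Fin n × Fin (k + 1))) : ¬ IsSTPath M u I p := by
  rintro ⟨-, hp⟩
  let F := M.closure (T (Fin.last k) : Set (Fin n))
  have hF : ∀ i, M.closure (T i : Set (Fin n)) = F := fun i => h.closure_eq i _
  -- The vertices whose element lies in the common flat `F` form a cut: no arc leaves it, and every
  -- arc from the source enters it.
  let P : AuxVertex n (k + 1) → Prop := fun v => match v with
    | .source => True
    | .sink => False
    | .node e _ => e ∈ F
  have step : ∀ v w, ExchangeArc M u I v w → P v → P w := by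
    intro v w hvw hv
    cases hvw with
    | start e i he hi => exact hu e he
    | exchange e d i he hd hind =>
      -- Otherwise `T i` is contained in `I i - d` and spans `e`, against the independence of `I i -
      -- d + e`.
      have hdT : d ∈ T i := by
        by_contra hdT
        have hsub : (T i : Set (Fin n)) ⊆ (I i : Set (Fin n)) \ {d} := fun x hx =>
          ⟨h.subset i hx, fun hxd => hdT (by rw [Set.mem_singleton_iff] at hxd; exact hxd ▸ hx)⟩
        have he' : e ∈ M.closure ((I i : Set (Fin n)) \ {d}) :=
          M.closure_subset_closure hsub ((hF i).symm ▸ hv)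
        have := hind.notMem_closure_sdiff_of_mem (Set.mem_insert _ _)
        rw [Set.insert_sdiff_self_of_notMem (fun h => he (by simpa using h.1))] at this
        exact this he'
      have := mem_closure_of_mem_set hE (show d ∈ (T i : Set (Fin n)) from hdT)
      rwa [hF i] at this
    | shuffle d i j hi hj hd => exact hv
    | finish e i he =>
      refine he (M.closure_subset_closure (X := (T i : Set (Fin n))) (by
        exact_mod_cast h.subset i) ?_)
      rw [hF i]; exact hv
  have all : ∀ (l : List (AuxVertex n (k + 1))) (v : AuxVertex n (k + 1)), P v →
      List.IsChain (ExchangeArc M u I) (v :: l) → ∀ w ∈ l, P w := by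
    intro l
    induction l with
    | nil => simp
    | cons a l ih =>
      intro v hv hl w hw
      rw [List.isChain_cons_cons] at hl
      have ha := step _ _ hl.1 hv
      rcases List.mem_cons.1 hw with rfl | hw
      · exact ha
      · exact ih a ha hl.2 w hw
  exact all _ .source trivial hp .sink (by simp)

end Counting

/-! ### Augmenting along non-interfering exchanges. -/

section Augment

variable {n k : ℕ}

theorem numCovered_update (J : Fin k → Finset (Fin n)) (i : Fin k) (S : Finset (Fin n))
    (e : Fin n) : numCovered (Function.update J i S) e + (if e ∈ J i then 1 else 0) =
      numCovered J e + (if e ∈ S then 1 else 0) := by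
  simp only [numCovered, Finset.card_filter]
  rw [← Finset.add_sum_erase _ _ (Finset.mem_univ i),
    ← Finset.add_sum_erase _ (fun a => if e ∈ J a then 1 else 0) (Finset.mem_univ i)]
  have : ∑ x ∈ Finset.univ.erase i, (if e ∈ Function.update J i S x then 1 else 0) =
      ∑ x ∈ Finset.univ.erase i, (if e ∈ J x then 1 else 0) :=
    Finset.sum_congr rfl fun x hx => by
      rw [Function.update_of_ne (Finset.ne_of_mem_erase hx)]
  rw [this, Function.update_self]
  ring

theorem packingSize_update (J : Fin k → Finset (Fin n)) (i : Fin k) (S : Finset (Fin n)) :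
    packingSize (Function.update J i S) + (J i).card = packingSize J + S.card := by
  simp only [packingSize]
  rw [← Finset.add_sum_erase _ _ (Finset.mem_univ i),
    ← Finset.add_sum_erase _ (fun a => (J a).card) (Finset.mem_univ i)]
  have : ∑ x ∈ Finset.univ.erase i, (Function.update J i S x).card =
      ∑ x ∈ Finset.univ.erase i, (J x).card :=
    Finset.sum_congr rfl fun x hx => by
      rw [Function.update_of_ne (Finset.ne_of_mem_erase hx)]
  rw [this, Function.update_self]
  ring

theorem mem_augmentAlong {I : Fin k → Finset (Fin n)} {p : List (Fin n × Fin k)} {i : Fin k}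
    {e : Fin n} : e ∈ augmentAlong I p i ↔ (e ∈ I i ∧ (e, i) ∉ p ∨ (e, i) ∈ p ∧ e ∉ I i) := by
  simp [augmentAlong, Finset.mem_symmDiff]

theorem augmentAlong_insert {I : Fin k → Finset (Fin n)} {p : List (Fin n × Fin k)} {i : Fin k}
    {e : Fin n} (he : e ∉ I i) : augmentAlong I (p ++ [(e, i)]) =
      Function.update (augmentAlong I p) i (insert e (augmentAlong I p i)) := by
  funext j
  ext x
  rcases eq_or_ne j i with rfl | hj
  · rcases eq_or_ne x e with rfl | hx
    · simp [mem_augmentAlong, he]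
    · simp [mem_augmentAlong, hx]
  · simp [mem_augmentAlong, hj]

theorem augmentAlong_erase {I : Fin k → Finset (Fin n)} {p : List (Fin n × Fin k)} {i : Fin k}
    {e : Fin n} (he : e ∈ I i) : augmentAlong I (p ++ [(e, i)]) =
      Function.update (augmentAlong I p) i ((augmentAlong I p i).erase e) := by
  funext j
  ext x
  rcases eq_or_ne j i with rfl | hj
  · rcases eq_or_ne x e with rfl | hx
    · simp [mem_augmentAlong, he]
    · simp [mem_augmentAlong, hx]
  · simp [mem_augmentAlong, hj]

/-- `p` is a sequence of exchanges, outside the family `T`, that starts with an uncovered element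
and makes the element `x` available; later exchanges do not interfere with earlier ones. -/
inductive ExchangeTrace (M : Matroid (Fin n)) (u : Fin n → ℕ) (I T : Fin k → Finset (Fin n)) :
    List (Fin n × Fin k) → Fin n → Prop where
  | root (x : Fin n) (hx : numCovered I x < u x) : ExchangeTrace M u I T [] x
  | step {p : List (Fin n × Fin k)} {x : Fin n} (i : Fin k) (z : Fin n)
      (h : ExchangeTrace M u I T p x) (hxi : x ∉ I i) (hzi : z ∈ I i) (hzT : z ∉ T i)
      (hz : u z ≤ numCovered I z) (hx : x ∈ M.closure (I i : Set (Fin n)))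
      (hxz : x ∉ M.closure ((I i : Set (Fin n)) \ {z})) (hnew : ∀ y ∈ p, y.1 ≠ z)
      (hsat : ∀ y ∈ p, y.2 = i → y.1 ∉ I i → y.1 ∈ M.closure ((I i : Set (Fin n)) \ {z})) :
      ExchangeTrace M u I T (p ++ [(x, i), (z, i)]) z

namespace ExchangeTrace

variable {M : Matroid (Fin n)} {u : Fin n → ℕ} {I T : Fin k → Finset (Fin n)}
  {p : List (Fin n × Fin k)} {x : Fin n}

/-- By `hnew` a removed element has not occurred before, so it can recur only when it is inserted
elsewhere right after its removal. In particular the next insertion vertex is new. -/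
theorem nodup (h : ExchangeTrace M u I T p x) : p.Nodup ∧ ∀ i, (x, i) ∈ p → x ∈ I i := by
  induction h with
  | root x hx => simp
  | @step p x i z h hxi hzi hzT hz hx hxz hnew hsat ih =>
    have h1 : (x, i) ∉ p := fun h => hxi (ih.2 i h)
    have h2 : ∀ j, (z, j) ∉ p := fun j h => hnew _ h rfl
    have h3 : x ≠ z := fun h => hxi (h ▸ hzi)
    refine ⟨?_, fun j hj => ?_⟩
    · rw [List.nodup_append]
      refine ⟨ih.1, by simp [h3], fun a ha b hb => ?_⟩
      rintro rfl
      simp only [List.mem_cons, List.not_mem_nil, or_false] at hb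
      rcases hb with rfl | rfl
      exacts [h1 ha, h2 _ ha]
    · simp only [List.mem_append, h2, List.mem_cons, Prod.mk.injEq, h3.symm, false_and, true_and,
        List.not_mem_nil, or_false, false_or] at hj
      exact hj ▸ hzi

theorem isChain (hI : ∀ i, M.Indep (I i : Set (Fin n))) (h : ExchangeTrace M u I T p x) {j : Fin k}
    (hj : x ∉ I j) : List.IsChain (ExchangeArc M u I)
      (AuxVertex.source :: (p ++ [(x, j)]).map (fun x => AuxVertex.node x.1 x.2)) := by
  induction h generalizing j with
  | root x hx => simpa using ExchangeArc.start x j hx hj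
  | @step p x i z h hxi hzi hzT hz hx hxz hnew hsat ih =>
    have h1 := ih hxi
    rw [show p ++ [(x, i), (z, i)] ++ [(z, j)] = (p ++ [(x, i)]) ++ [(z, i), (z, j)] by simp,
      List.map_append, ← List.cons_append, List.isChain_append]
    refine ⟨h1, ?_, ?_⟩
    · simpa using ExchangeArc.shuffle z i j hzi hj hz
    · intro a ha b hb
      rw [List.map_append, ← List.cons_append] at ha
      simp only [List.map_cons, List.map_nil, List.getLast?_concat, Option.mem_def,
        Option.some.injEq, List.head?_cons] at ha hb
      subst ha hb
      refine .exchange x z i hxi hzi ?_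
      rw [((hI i).subset Set.sdiff_subset).insert_indep_iff_of_notMem (by simp [hxi])]
      exact ⟨M.closure_subset_ground _ hx, hxz⟩

/-- The exchanges can be carried out one at a time. By `hsat` the current `i`-th set without `z`
lies in the span of `I i` without `z`, which does not contain `x`; so swapping `z` for `x` preserves
independence and closure. The multiplicities telescope: the root has gained a copy, and the
available element is one copy short. -/
theorem augment (hE : M.E = Set.univ) (hI : ∀ i, M.Indep (I i : Set (Fin n)))
    (h : ExchangeTrace M u I T p x) :
    (∀ i, M.Indep (augmentAlong I p i : Set (Fin n)) ∧
      M.closure (augmentAlong I p i : Set (Fin n)) = M.closure (I i : Set (Fin n)) ∧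
      ((∀ i, T i ⊆ I i) → T i ⊆ augmentAlong I p i)) ∧
    ∃ y, numCovered I y < u y ∧ ∀ e, numCovered (augmentAlong I p) e + (if e = x then 1 else 0) =
      numCovered I e + (if e = y then 1 else 0) := by
  induction h with
  | root x hx =>
    have : augmentAlong I [] = I := by funext i; ext e; simp [mem_augmentAlong]
    rw [this]
    exact ⟨fun i => ⟨hI i, rfl, fun h => h i⟩, x, hx, fun e => rfl⟩
  | @step p x i z h hxi hzi hzT hz hx hxz hnew hsat ih =>
    obtain ⟨ih1, y, hy, ih2⟩ := ih
    have hzx : z ≠ x := fun h => hxi (h ▸ hzi)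
    have hxJ : x ∉ augmentAlong I p i := by
      rw [mem_augmentAlong]
      rintro (h' | h')
      exacts [hxi h'.1, hxi (h.nodup.2 i h'.1)]
    have hzJ : z ∈ augmentAlong I p i := by
      rw [mem_augmentAlong]
      exact .inl ⟨hzi, fun h => hnew _ h rfl⟩
    rw [show p ++ [(x, i), (z, i)] = (p ++ [(x, i)]) ++ [(z, i)] by simp, augmentAlong_erase hzi,
      augmentAlong_insert hxi, Function.update_idem, Function.update_self]
    generalize hJ : augmentAlong I p = J at *
    have hsub : (J i : Set (Fin n)) \ {z} ⊆ M.closure ((I i : Set (Fin n)) \ {z}) := by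
      rintro e ⟨he, hez⟩
      rw [← hJ, Finset.mem_coe, mem_augmentAlong] at he
      rcases he with he | he
      · exact mem_closure_of_mem_set hE ⟨he.1, hez⟩
      · exact hsat _ he.1 rfl he.2
    have hxJz : x ∉ M.closure ((J i : Set (Fin n)) \ {z}) := fun h =>
      hxz (M.closure_subset_closure_of_subset_closure hsub h)
    have hset : (((insert x (J i)).erase z : Finset (Fin n)) : Set (Fin n)) =
        insert x ((J i : Set (Fin n)) \ {z}) := by
      ext e
      simp only [Finset.coe_erase, Finset.coe_insert, Set.mem_sdiff, Set.mem_insert_iff,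
        Set.mem_singleton_iff]
      constructor
      · tauto
      · rintro (rfl | h)
        exacts [⟨.inl rfl, hzx.symm⟩, ⟨.inr h.1, h.2⟩]
    have hJz : insert z ((J i : Set (Fin n)) \ {z}) = J i := by simp [hzJ]
    refine ⟨fun j => ?_, y, hy, fun e => ?_⟩
    · rcases eq_or_ne j i with rfl | hj
      · rw [Function.update_self, hset]
        refine ⟨?_, ?_, fun hT e he => ?_⟩
        · rw [((ih1 j).1.subset Set.sdiff_subset).insert_indep_iff]
          exact .inl ⟨by simp [hE], hxJz⟩
        · rw [← (ih1 j).2.1]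
          -- `x` is in the span of the `j`-th set but not of that set without `z`, so `x` and `z`
          -- may replace each other in the closure.
          rw [M.closure_insert_congr (f := z) ⟨by rw [hJz, (ih1 j).2.1]; exact hx, hxJz⟩, hJz]
        · have := (ih1 j).2.2 hT he
          rw [Finset.mem_erase, Finset.mem_insert]
          exact ⟨fun h => hzT (h ▸ he), .inr this⟩
      · rw [Function.update_of_ne hj]
        exact ih1 j
    · have h1 := numCovered_update J i ((insert x (J i)).erase z) e
      have h2 := ih2 e
      rcases eq_or_ne e x with rfl | hex
      · simp [hxJ, hzx.symm] at h1 h2 ⊢; omega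
      · rcases eq_or_ne e z with rfl | hez
        · simp [hzJ, hex] at h1 h2 ⊢; omega
        · simp [hex, hez] at h1 h2 ⊢; omega

end ExchangeTrace

/-- Augmenting `I` along the path `p` gives a good packing that is larger by one, contains `T` and
uses no element less often. -/
structure IsAugmentation (M : Matroid (Fin n)) (u : Fin n → ℕ) (I T : Fin k → Finset (Fin n))
    (p : List (Fin n × Fin k)) : Prop where
  isSTPath : IsSTPath M u I p
  isGoodPacking : IsGoodPacking M u (augmentAlong I p)
  packingSize_eq : packingSize (augmentAlong I p) = packingSize I + 1
  subset : ∀ i, T i ⊆ augmentAlong I p i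
  numCovered_le : ∀ e, numCovered I e ≤ numCovered (augmentAlong I p) e

/-- The exchanges do not change any span, so only the final insertion of `x` into `I j` matters.
Taking the first `j` whose set does not span `x` keeps the family decreasing, and in total only the
uncovered root gains a copy. -/
theorem ExchangeTrace.isAugmentation {M : Matroid (Fin n)} (hE : M.E = Set.univ) {u : Fin n → ℕ}
    {I T : Fin k → Finset (Fin n)} {p : List (Fin n × Fin k)} {x : Fin n}
    (hI : IsGoodPacking M u I) (hT : ∀ i, T i ⊆ I i) (h : ExchangeTrace M u I T p x) (j : Fin k)
    (hj : x ∉ M.closure (I j : Set (Fin n)))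
    (hj' : ∀ i : Fin k, i.val + 1 = j.val → x ∈ M.closure (I i : Set (Fin n))) :
    IsAugmentation M u I T (p ++ [(x, j)]) := by
  obtain ⟨⟨hind, hcap⟩, hmax, hdec⟩ := hI
  have hxj : x ∉ I j := fun hx => hj (mem_closure_of_mem_set hE hx)
  obtain ⟨h1, y, hy, h2⟩ := h.augment hE hind
  have hcov : ∀ e, numCovered (augmentAlong I (p ++ [(x, j)])) e =
      numCovered I e + if e = y then 1 else 0 := by
    intro e
    rw [augmentAlong_insert hxj, ← h2 e]
    have hxJ : x ∉ augmentAlong I p j := by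
      rw [mem_augmentAlong]
      rintro (h' | h')
      exacts [hxj h'.1, hxj (h.nodup.2 j h'.1)]
    have h3 := numCovered_update (augmentAlong I p) j (insert x (augmentAlong I p j)) e
    rcases eq_or_ne e x with rfl | hex
    · simp [hxJ] at h3 ⊢; omega
    · simp [hex] at h3 ⊢; omega
  have hcl : ∀ i, M.Indep (augmentAlong I (p ++ [(x, j)]) i : Set (Fin n)) ∧
      M.closure (I i : Set (Fin n)) ⊆ M.closure (augmentAlong I (p ++ [(x, j)]) i : Set (Fin n)) ∧
      T i ⊆ augmentAlong I (p ++ [(x, j)]) i ∧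
      ∀ e ∈ augmentAlong I (p ++ [(x, j)]) i, e ∈ M.closure (I i : Set (Fin n)) ∨ i = j ∧ e = x := by
    intro i
    obtain ⟨h3, h4, h5⟩ := h1 i
    rw [augmentAlong_insert hxj]
    rcases eq_or_ne i j with rfl | hi
    · rw [Function.update_self, Finset.coe_insert, ← h4]
      refine ⟨?_, M.closure_subset_closure (Set.subset_insert _ _),
        (h5 hT).trans (Finset.subset_insert _ _), fun e he => ?_⟩
      · rw [h3.insert_indep_iff]
        exact .inl ⟨by simp [hE], by rwa [h4]⟩
      · rcases Finset.mem_insert.1 he with rfl | he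
        · exact .inr ⟨rfl, rfl⟩
        · exact .inl (mem_closure_of_mem_set hE he)
    · rw [Function.update_of_ne hi]
      exact ⟨h3, h4.ge, h5 hT, fun e he => .inl (h4 ▸ mem_closure_of_mem_set hE he)⟩
  refine ⟨⟨?_, ?_⟩, ⟨⟨fun i => (hcl i).1, fun e => ?_⟩, fun e he i => (hcl i).2.1 (hmax e ?_ i), ?_⟩,
    ?_, fun i => (hcl i).2.2.1, fun e => ?_⟩
  · rw [List.nodup_append]
    refine ⟨h.nodup.1, by simp, fun a ha b hb => ?_⟩
    rintro rfl
    rw [List.mem_singleton] at hb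
    subst hb
    exact hxj (h.nodup.2 j ha)
  · rw [← List.cons_append, List.isChain_append]
    refine ⟨h.isChain hind hxj, by simp, fun a ha b hb => ?_⟩
    rw [List.map_append, ← List.cons_append] at ha
    simp only [List.map_cons, List.map_nil, List.getLast?_concat, Option.mem_def,
      Option.some.injEq, List.head?_cons] at ha hb
    subst ha hb
    exact .finish x j hj
  · rw [hcov e]
    split_ifs with h
    · subst h; omega
    · exact hcap e
  · rw [hcov e] at he; omega
  · intro i i' hii' e he
    rcases (hcl i').2.2.2 e he with he | ⟨rfl, rfl⟩
    · exact (hcl i).2.1 (M.closure_subset_closure_of_subset_closure (hdec i i' hii') he)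
    · exact (hcl i).2.1 (hj' i hii')
  · rw [packingSize_eq_sum, packingSize_eq_sum, Finset.sum_congr rfl fun e _ => hcov e,
      Finset.sum_add_distrib]
    simp
  · rw [hcov e]; omega

end Augment

/-! ### The search for an augmenting path. -/

section Search

variable {n k : ℕ} {pre : Matroid (Fin n) → Prop}

/-- Find an element of a known set with a testable property, or report that there is none. -/
theorem solvable_find (p : Matroid (Fin n) → Fin n → Prop) (Y : Finset (Fin n))
    (hp : ∀ y ∈ Y, Testable pre (fun M => p M y)) :
    Solvable pre (fun M (z : Option (Fin n)) c => (∀ y, z = some y → y ∈ Y ∧ p M y) ∧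
      (z = none → ∀ y ∈ Y, ¬ p M y) ∧ c ≤ Y.card) := by
  classical
  induction Y using Finset.induction_on generalizing pre with
  | empty => exact .pure none fun M _ => by simp
  | insert y Y hy ih =>
    refine .test (hp y (Finset.mem_insert_self _ _)) ?_ ?_
    · refine .pure (some y) fun M hM => ⟨?_, by simp, by simp [hy]⟩
      rintro _ ⟨⟩
      exact ⟨Finset.mem_insert_self _ _, hM.2⟩
    · refine (ih (pre := fun M => pre M ∧ ¬ p M y) fun z hz =>
        (hp z (Finset.mem_insert_of_mem hz)).mono fun M hM => hM.1).mono (fun M hM => hM) ?_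
      rintro M z c hM ⟨h1, h2, h3⟩
      refine ⟨fun y hy => ⟨Finset.mem_insert_of_mem (h1 y hy).1, (h1 y hy).2⟩, fun hz => ?_, ?_⟩
      · simpa [hM.2] using h2 hz
      · rw [Finset.card_insert_of_notMem hy]; omega

/-- Find all elements of the fundamental circuit of `x` in `I` that are not in `D`. -/
theorem solvable_circuit (I D : Finset (Fin n)) (x : Fin n) (hDI : D ⊆ I)
    (h : ∀ M, pre M → M.E = Set.univ ∧ M.Indep (I : Set (Fin n)) ∧
      x ∈ M.closure (I : Set (Fin n))) :
    Solvable pre (fun M (X : Finset (Fin n)) c => X ⊆ I \ D ∧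
      x ∈ M.closure ((D ∪ X : Finset (Fin n)) : Set (Fin n)) ∧
      (∀ d ∈ X, x ∉ M.closure ((I : Set (Fin n)) \ {d})) ∧
      c ≤ 1 + X.card * (1 + Nat.clog 2 I.card)) := by
  classical
  obtain ⟨m, hm⟩ : ∃ m, m = (I \ D).card := ⟨_, rfl⟩
  induction m generalizing pre D with
  | zero =>
    have hID : D = I := hDI.antisymm
      (Finset.sdiff_eq_empty_iff_subset.1 (Finset.card_eq_zero.1 hm.symm))
    refine .pure ∅ fun M hM => ⟨by simp, ?_, by simp, by simp⟩
    simpa [hID] using (h M hM).2.2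
  | succ m ih =>
    refine .test (testable_mem_closure (D := D) x fun M hM =>
      ⟨(h M hM).1, (h M hM).2.1.subset (by exact_mod_cast hDI)⟩) ?_ ?_
    · exact .pure ∅ fun M hM => ⟨by simp, by simpa using hM.2, by simp, by simp⟩
    -- Elements of `D` come first in the order. As `D` does not span `x`, the pivot is a circuit
    -- element outside `D`.
    refine .bind (solvable_pivot I (fun d => if d ∈ D then 1 else 0) x fun M hM =>
      ⟨(h M hM.1).1, (h M hM.1).2.1, (h M hM.1).2.2, fun hx =>
        hM.2 (M.closure_subset_closure (Set.empty_subset _) hx)⟩) fun d => ?_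
    by_cases hd : d ∈ I \ D
    swap
    · refine .pure ∅ ?_
      rintro M ⟨⟨hM, hx⟩, c, hdI, ⟨S, hSI, hdS, hS, hS', hxS, hxS'⟩, hc⟩
      simp only [Finset.mem_sdiff, hdI, true_and, not_not] at hd
      refine (hx (M.closure_subset_closure ?_ hxS')).elim
      rw [Set.insert_subset_iff]
      refine ⟨hd, fun s hs => ?_⟩
      have := hS' s hs
      by_contra hsD
      simp [hd, show s ∉ D from hsD] at this
    · obtain ⟨hdI, hdD⟩ := Finset.mem_sdiff.1 hd
      refine .bind (ih (insert d D) (Finset.insert_subset hdI hDI) (fun M hM => h M hM.1.1)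
        ?_) fun X => .pure (insert d X) ?_
      · rw [Finset.sdiff_insert, Finset.card_erase_of_mem hd]; omega
      rintro M ⟨⟨⟨hM, hx⟩, -⟩, -⟩ c' ⟨h1, h2, h3, h4⟩ c
        ⟨-, ⟨S, hSI, hdS, hS, hS', hxS, hxS'⟩, hc⟩
      have hdX : d ∉ X := fun hdX => (Finset.mem_sdiff.1 (h1 hdX)).2 (Finset.mem_insert_self _ _)
      refine ⟨Finset.insert_subset hd fun y hy => ?_, ?_, fun y hy => ?_, ?_⟩
      · have := h1 hy
        simp only [Finset.mem_sdiff, Finset.mem_insert, not_or] at this ⊢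
        exact ⟨this.1, this.2.2⟩
      · rwa [Finset.union_insert, ← Finset.insert_union]
      · rcases Finset.mem_insert.1 hy with rfl | hy
        · intro hcon
          have hI := (h M hM).2.1
          have hins : insert y (S : Set (Fin n)) ⊆ I := by
            rw [Set.insert_subset_iff]; exact ⟨hdI, by exact_mod_cast hSI⟩
          -- Within an independent set closures commute with intersections, so if `I - y` also
          -- spanned `x`, then already `S` would.
          have hmem : x ∈ M.closure (((I : Set (Fin n)) \ {y}) ∩ insert y (S : Set (Fin n))) := by
            rw [Matroid.Indep.closure_inter_eq_inter_closure
              (hI.subset (Set.union_subset Set.sdiff_subset hins))]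
            exact ⟨hcon, hxS'⟩
          refine hxS (M.closure_subset_closure ?_ hmem)
          rintro s ⟨⟨-, hs⟩, hs'⟩
          exact hs'.resolve_left hs
        · exact h3 y hy
      · rw [Finset.card_insert_of_notMem hdX]
        linarith

end Search

section Search

variable {n k : ℕ} {pre : Matroid (Fin n) → Prop}

/-- The state of the search for an augmenting path of `I`: the sets `D i` of visited elements of
`I i`, the set `R` of elements that can be made available, by the exchanges `tr`, and the set `O`
of pairs `(x, i)` for which `D i` still has to span `x`. -/
structure SearchInv (M : Matroid (Fin n)) (u : Fin n → ℕ) (I T D : Fin (k + 1) → Finset (Fin n))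
    (R : Finset (Fin n)) (tr : Fin n → List (Fin n × Fin (k + 1)))
    (O : Finset (Fin n × Fin (k + 1))) : Prop where
  ground : M.E = Set.univ
  good : IsGoodPacking M u I
  tight : IsTight M I T
  subset : ∀ i, D i ⊆ I i
  superset : ∀ i, T i ⊆ D i
  trace : ∀ x ∈ R, ExchangeTrace M u I T (tr x) x
  trace_mem : ∀ x ∈ R, ∀ y ∈ tr x, y.1 ∈ R
  trace_span : ∀ x ∈ R, ∀ y ∈ tr x, y.1 ∉ I y.2 → y.1 ∈ M.closure (D y.2 : Set (Fin n))
  mem_last : ∀ x ∈ R, x ∈ M.closure (I (Fin.last k) : Set (Fin n))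
  span_last : ∀ x ∈ R, (x, Fin.last k) ∈ O ∨ x ∈ M.closure (D (Fin.last k) : Set (Fin n))
  span_prev : ∀ i j : Fin (k + 1), i.val + 1 = j.val → ∀ d ∈ D j,
    (d, i) ∈ O ∨ d ∈ M.closure (D i : Set (Fin n))
  mem_of_mem : ∀ x ∈ O, x.1 ∈ R
  visited : ∀ i, ∀ d ∈ D i, d ∈ R ∨ d ∈ T i

/-- Without open obligations the visited sets are decreasing, and the last one spans everything
reached as well as `T`. Every visited element belongs to one of these, so all visited sets span the
same flat. -/
theorem SearchInv.isTight {M : Matroid (Fin n)} {u : Fin n → ℕ}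
    {I T D : Fin (k + 1) → Finset (Fin n)} {R : Finset (Fin n)}
    {tr : Fin n → List (Fin n × Fin (k + 1))} (h : SearchInv M u I T D R tr ∅) :
    IsTight M I D ∧ ∀ x ∈ R, x ∈ M.closure (D (Fin.last k) : Set (Fin n)) := by
  have h1 : ∀ x ∈ R, x ∈ M.closure (D (Fin.last k) : Set (Fin n)) := fun x hx => by
    simpa using h.span_last x hx
  have hdec : IsDecreasing M D := fun i j hij d hd => by simpa using h.span_prev i j hij d hd
  refine ⟨⟨h.subset, fun i j d hd => ?_⟩, h1⟩
  refine hdec.closure_subset h.ground (Fin.le_last j) ?_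
  rcases h.visited i d hd with hd | hd
  · exact h1 d hd
  · exact M.closure_subset_closure (by exact_mod_cast h.superset _) (h.tight.span i (Fin.last k) hd)

/-- The first empty set of a family, or else the last set. -/
theorem exists_cutoff (I : Fin (k + 1) → Finset (Fin n)) :
    ∃ m : Fin (k + 1), (I m = ∅ ∨ m = Fin.last k) ∧ m.val ≤ packingSize I ∧
      (I m ≠ ∅ → m.val + 1 ≤ packingSize I) := by
  classical
  have key : ∀ m : Fin (k + 1), (∀ i < m, I i ≠ ∅) →
      m.val ≤ ∑ i ∈ Finset.univ.filter (· < m), (I i).card := fun m hm => by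
    have := Finset.card_nsmul_le_sum (Finset.univ.filter (· < m)) (fun i => (I i).card) 1
      fun i hi => Finset.card_pos.2 (Finset.nonempty_iff_ne_empty.2 (hm i (by simpa using hi)))
    have hc : (Finset.univ.filter (· < m)).card = m.val := by
      rw [show Finset.univ.filter (· < m) = Finset.Iio m by ext; simp, Fin.card_Iio]
    simpa [hc] using this
  have le : ∀ m : Fin (k + 1), ∑ i ∈ Finset.univ.filter (· < m), (I i).card + (I m).card ≤
      packingSize I := fun m => by
    rw [add_comm, ← Finset.sum_insert (s := Finset.univ.filter (· < m)) (f := fun i => (I i).card)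
      (by simp)]
    exact Finset.sum_le_sum_of_subset (Finset.subset_univ _)
  have main : ∀ m : Fin (k + 1), (∀ i < m, I i ≠ ∅) → m.val ≤ packingSize I ∧
      (I m ≠ ∅ → m.val + 1 ≤ packingSize I) := fun m hm => by
    have h1 := key m hm
    have h2 := le m
    refine ⟨by omega, fun h => ?_⟩
    have := Finset.card_pos.2 (Finset.nonempty_iff_ne_empty.2 h)
    omega
  by_cases hex : ∃ i, I i = ∅
  · obtain ⟨m, hm⟩ := (Set.toFinite {i | I i = ∅}).exists_minimal hex
    refine ⟨m, .inl hm.1, main m fun i hi h => ?_⟩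
    exact absurd (hm.2 h hi.le) (not_le.2 hi)
  · push Not at hex
    exact ⟨Fin.last k, .inr rfl, main _ fun i _ => Finset.nonempty_iff_ne_empty.1 (hex i)⟩

/-- The place where an available element enters a packing that does not span it. -/
theorem solvable_entry (u : Fin n → ℕ) (I : Fin (k + 1) → Finset (Fin n)) (z : Fin n)
    (h : ∀ M, pre M → M.E = Set.univ ∧ IsGoodPacking M u I ∧
      z ∉ M.closure (I (Fin.last k) : Set (Fin n)) ∧ z ∉ M.closure ∅) :
    Solvable pre (fun M j c => z ∉ M.closure (I j : Set (Fin n)) ∧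
      (∀ i : Fin (k + 1), i.val + 1 = j.val → z ∈ M.closure (I i : Set (Fin n))) ∧
      c ≤ packingSize I) := by
  obtain ⟨m, hm, hm1, hm2⟩ := exists_cutoff I
  refine (solvable_first_unspanned I z m fun M hM => ?_).mono (fun M hM => hM) ?_
  · obtain ⟨h1, h2, h3, h4⟩ := h M hM
    refine ⟨h1, fun i _ => h2.1.1 i, ?_⟩
    rcases hm with hm | rfl
    · simpa [hm] using h4
    · exact h3
  · rintro M j c - ⟨h1, h2, h3, h4⟩
    refine ⟨h2, h3, h4.trans ?_⟩
    rw [Nat.clog_le_iff_le_pow (by norm_num)]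
    exact (Nat.succ_le_succ hm1).trans Nat.lt_two_pow_self

/-- The cost of visiting one element in the search for augmenting paths. -/
noncomputable def visitCost (M : Matroid (Fin n)) : ℕ := 4 + Nat.clog 2 (matroidRank M)

/-- Elements inserted earlier into the `i`-th set are spanned by `D i`, which avoids the new `z`.
This gives the non-interference condition `hsat`. -/
theorem SearchInv.visit {M : Matroid (Fin n)} {u : Fin n → ℕ}
    {I T D : Fin (k + 1) → Finset (Fin n)} {R : Finset (Fin n)}
    {tr : Fin n → List (Fin n × Fin (k + 1))} {O : Finset (Fin n × Fin (k + 1))}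
    (h : SearchInv M u I T D R tr O) {x : Fin n} {i : Fin (k + 1)} (hx : x ∈ R)
    {X : Finset (Fin n)} (hX : X ⊆ I i \ D i)
    (hspan : x ∈ M.closure ((D i ∪ X : Finset (Fin n)) : Set (Fin n)))
    (hcirc : ∀ d ∈ X, x ∉ M.closure ((I i : Set (Fin n)) \ {d}))
    {z : Fin n} (hz : z ∈ X) (hzR : z ∉ R) (hzu : u z ≤ numCovered I z) :
    ExchangeTrace M u I T (tr x ++ [(x, i), (z, i)]) z := by
  have hzI := Finset.mem_sdiff.1 (hX hz)
  have hDz : (D i : Set (Fin n)) ⊆ (I i : Set (Fin n)) \ {z} := fun d hd =>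
    ⟨h.subset i hd, fun hdz => hzI.2 (by rw [Set.mem_singleton_iff] at hdz; exact hdz ▸ hd)⟩
  have hxz : x ≠ z := fun hxz => hzR (hxz ▸ hx)
  have hxI : x ∉ I i := fun hxI => hcirc z hz (mem_closure_of_mem_set h.ground ⟨hxI, hxz⟩)
  refine .step i z (h.trace x hx) hxI hzI.1 (fun hT => hzI.2 (h.superset i hT)) hzu ?_
    (hcirc z hz) (fun y hy hyz => hzR (hyz ▸ h.trace_mem x hx y hy)) ?_
  · exact h.good.2.2.closure_subset h.ground (Fin.le_last i) (h.mem_last x hx)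
  · rintro ⟨y, j⟩ hy rfl hyI
    exact M.closure_subset_closure hDz (h.trace_span x hx _ hy hyI)

-- Adding `X` to `D i` settles the obligation `(x, i)` and creates two per new element, for the last
-- set and for the preceding one. For `i = 0` the truncated index is `0` again; that obligation is
-- superfluous but harmless. A new element that is uncovered becomes a root with empty trace.
open Classical in
theorem SearchInv.next {M : Matroid (Fin n)} {u : Fin n → ℕ}
    {I T D : Fin (k + 1) → Finset (Fin n)} {R : Finset (Fin n)}
    {tr : Fin n → List (Fin n × Fin (k + 1))} {O : Finset (Fin n × Fin (k + 1))}
    (h : SearchInv M u I T D R tr O) {x : Fin n} {i : Fin (k + 1)} (hx : x ∈ R)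
    {X : Finset (Fin n)} (hX : X ⊆ I i \ D i)
    (hspan : x ∈ M.closure ((D i ∪ X : Finset (Fin n)) : Set (Fin n)))
    (hcirc : ∀ d ∈ X, x ∉ M.closure ((I i : Set (Fin n)) \ {d}))
    (hsink : ∀ z ∈ X \ R, z ∈ M.closure (I (Fin.last k) : Set (Fin n))) :
    SearchInv M u I T (Function.update D i (D i ∪ X)) (R ∪ X)
      (fun z => if z ∈ R then tr z else if u z ≤ numCovered I z then tr x ++ [(x, i), (z, i)]
        else [])
      (O.erase (x, i) ∪ (X.image (fun z => (z, Fin.last k)) ∪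
        X.image (fun z => (z, ⟨i.val - 1, by omega⟩)))) := by
  have hup : ∀ j, D j ⊆ Function.update D i (D i ∪ X) j := fun j => by
    rcases eq_or_ne j i with rfl | hj
    · simp
    · simp [hj]
  have hcl : ∀ j y, y ∈ M.closure (D j : Set (Fin n)) →
      y ∈ M.closure (Function.update D i (D i ∪ X) j : Set (Fin n)) := fun j y hy =>
    M.closure_subset_closure (by exact_mod_cast hup j) hy
  have hx' : x ∈ M.closure (Function.update D i (D i ∪ X) i : Set (Fin n)) := by
    rwa [Function.update_self]
  have hO : ∀ y j, (y, j) ∈ O → (y, j) ∈ O.erase (x, i) ∪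
      (X.image (fun z => (z, Fin.last k)) ∪ X.image (fun z => (z, ⟨i.val - 1, by omega⟩))) ∨
      y ∈ M.closure (Function.update D i (D i ∪ X) j : Set (Fin n)) := fun y j hy => by
    by_cases hyj : (y, j) = (x, i)
    · obtain ⟨rfl, rfl⟩ := Prod.mk.inj hyj
      exact .inr hx'
    · exact .inl (Finset.mem_union_left _ (Finset.mem_erase.2 ⟨hyj, hy⟩))
  refine ⟨h.ground, h.good, h.tight, fun j => ?_, fun j => (h.superset j).trans (hup j), ?_, ?_, ?_,
    ?_, ?_, ?_, ?_, ?_⟩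
  · rcases eq_or_ne j i with rfl | hj
    · rw [Function.update_self]
      exact Finset.union_subset (h.subset _) (hX.trans Finset.sdiff_subset)
    · rw [Function.update_of_ne hj]; exact h.subset j
  · intro z hz
    by_cases hzR : z ∈ R
    · simpa [hzR] using h.trace z hzR
    · have hzX := (Finset.mem_union.1 hz).resolve_left hzR
      by_cases hzu : u z ≤ numCovered I z
      · simpa [hzR, hzu] using h.visit hx hX hspan hcirc hzX hzR hzu
      · simpa [hzR, hzu] using ExchangeTrace.root z (not_le.1 hzu)
  · intro z hz y hy
    by_cases hzR : z ∈ R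
    · simp only [hzR, if_true] at hy
      exact Finset.mem_union_left _ (h.trace_mem z hzR y hy)
    · by_cases hzu : u z ≤ numCovered I z
      · simp only [hzR, hzu, if_true, if_false, List.mem_append, List.mem_cons, List.not_mem_nil,
          or_false] at hy
        rcases hy with hy | rfl | rfl
        · exact Finset.mem_union_left _ (h.trace_mem x hx y hy)
        · exact Finset.mem_union_left _ hx
        · exact hz
      · simp [hzR, hzu] at hy
  · intro z hz y hy hyI
    by_cases hzR : z ∈ R
    · simp only [hzR, if_true] at hy
      exact hcl _ _ (h.trace_span z hzR y hy hyI)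
    · by_cases hzu : u z ≤ numCovered I z
      · simp only [hzR, hzu, if_true, if_false, List.mem_append, List.mem_cons, List.not_mem_nil,
          or_false] at hy
        rcases hy with hy | rfl | rfl
        · exact hcl _ _ (h.trace_span x hx y hy hyI)
        · exact hx'
        · have hzX := (Finset.mem_union.1 hz).resolve_left hzR
          exact (hyI (Finset.mem_sdiff.1 (hX hzX)).1).elim
      · simp [hzR, hzu] at hy
  · intro z hz
    by_cases hzR : z ∈ R
    · exact h.mem_last z hzR
    · exact hsink z (Finset.mem_sdiff.2 ⟨(Finset.mem_union.1 hz).resolve_left hzR, hzR⟩)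
  · intro z hz
    rcases Finset.mem_union.1 hz with hz | hz
    · rcases h.span_last z hz with h' | h'
      · exact hO _ _ h'
      · exact .inr (hcl _ _ h')
    · exact .inl (Finset.mem_union_right _ (Finset.mem_union_left _
        (Finset.mem_image_of_mem _ hz)))
  · intro j j' hjj' d hd
    have hold : d ∈ D j' → (d, j) ∈ O.erase (x, i) ∪
      (X.image (fun z => (z, Fin.last k)) ∪ X.image (fun z => (z, ⟨i.val - 1, by omega⟩))) ∨
      d ∈ M.closure (Function.update D i (D i ∪ X) j : Set (Fin n)) := fun hd => by
      rcases h.span_prev j j' hjj' d hd with h' | h'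
      · exact hO _ _ h'
      · exact .inr (hcl _ _ h')
    rcases eq_or_ne j' i with rfl | hj
    · rw [Function.update_self] at hd
      rcases Finset.mem_union.1 hd with hd | hd
      · exact hold hd
      · refine .inl (Finset.mem_union_right _ (Finset.mem_union_right _
          (Finset.mem_image.2 ⟨d, hd, ?_⟩)))
        simp only [Prod.mk.injEq, true_and, Fin.ext_iff]
        omega
    · rw [Function.update_of_ne hj] at hd
      exact hold hd
  · intro y hy
    simp only [Finset.mem_union, Finset.mem_image, Finset.mem_erase] at hy ⊢
    rcases hy with hy | ⟨z, hz, rfl⟩ | ⟨z, hz, rfl⟩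
    · exact .inl (h.mem_of_mem y hy.2)
    · exact .inr hz
    · exact .inr hz
  · intro j d hd
    rcases eq_or_ne j i with rfl | hj
    · rw [Function.update_self] at hd
      rcases Finset.mem_union.1 hd with hd | hd
      · exact (h.visited j d hd).imp (Finset.mem_union_left _) id
      · exact .inl (Finset.mem_union_right _ hd)
    · rw [Function.update_of_ne hj] at hd
      exact (h.visited j d hd).imp (Finset.mem_union_left _) id

/-- The search for an augmenting path: it yields an augmentation or a larger tight family. -/
theorem solvable_search (u : Fin n → ℕ) (I T : Fin (k + 1) → Finset (Fin n)) (fuel : ℕ)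
    (D : Fin (k + 1) → Finset (Fin n)) (R : Finset (Fin n))
    (tr : Fin n → List (Fin n × Fin (k + 1))) (O : Finset (Fin n × Fin (k + 1)))
    (h : ∀ M, pre M → SearchInv M u I T D R tr O)
    (hfuel : 3 * packingSize I + O.card ≤ fuel + 3 * packingSize D) :
    Solvable pre (fun M (res : List (Fin n × Fin (k + 1)) ⊕ (Fin (k + 1) → Finset (Fin n))) c =>
      (∀ p, res = .inl p → IsAugmentation M u I T p ∧
        c + visitCost M * packingSize D ≤ O.card + (visitCost M + 1) * packingSize I) ∧
      (∀ D', res = .inr D' → IsTight M I D' ∧ (∀ i, D i ⊆ D' i) ∧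
        (∀ x ∈ R, x ∈ M.closure (D' (Fin.last k) : Set (Fin n))) ∧
        c + visitCost M * packingSize D ≤ O.card + visitCost M * packingSize D')) := by
  classical
  -- The measure is the number of obligations plus three times the number of unvisited elements: a
  -- round closes one obligation, and each new element opens at most two.
  induction fuel generalizing pre D R tr O with
  | zero =>
    refine .pure (.inr D) fun M hM => ⟨by simp, ?_⟩
    rintro _ ⟨⟩
    have hDI : packingSize D ≤ packingSize I :=
      Finset.sum_le_sum fun i _ => Finset.card_le_card ((h M hM).subset i)
    obtain rfl : O = ∅ := Finset.card_eq_zero.1 (by omega)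
    exact ⟨(h M hM).isTight.1, fun _ => subset_rfl, (h M hM).isTight.2, by simp⟩
  | succ fuel ih =>
    rcases O.eq_empty_or_nonempty with rfl | ⟨⟨x, i⟩, hxi⟩
    · refine .pure (.inr D) fun M hM => ⟨by simp, ?_⟩
      rintro _ ⟨⟩
      exact ⟨(h M hM).isTight.1, fun _ => subset_rfl, (h M hM).isTight.2, by simp⟩
    by_cases hDI : D i ⊆ I i
    swap
    · exact .pure (.inr D) fun M hM => (hDI ((h M hM).subset i)).elim
    refine .bind (solvable_circuit (pre := pre) (I i) (D i) x hDI fun M hM => ⟨(h M hM).ground,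
      (h M hM).good.1.1 i, (h M hM).good.2.2.closure_subset (h M hM).ground (Fin.le_last i)
        ((h M hM).mem_last x ((h M hM).mem_of_mem _ hxi))⟩) fun X => ?_
    by_cases hX : X ⊆ I i \ D i
    swap
    · exact .pure (.inr D) fun M ⟨_, c, hX', _⟩ => (hX hX').elim
    have hdisj : Disjoint (D i) X :=
      Finset.disjoint_left.2 fun d hd hdX => (Finset.mem_sdiff.1 (hX hdX)).2 hd
    have hsize : packingSize (Function.update D i (D i ∪ X)) = packingSize D + X.card := by
      have := packingSize_update D i (D i ∪ X)
      rw [Finset.card_union_of_disjoint hdisj] at this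
      omega
    have hXI : packingSize D + X.card ≤ packingSize I ∨ ∀ M, ¬ pre M := by
      by_cases hne : ∃ M, pre M
      · obtain ⟨M, hM⟩ := hne
        refine .inl ?_
        rw [← hsize]
        refine Finset.sum_le_sum fun j _ => Finset.card_le_card ?_
        rcases eq_or_ne j i with rfl | hj
        · rw [Function.update_self]
          exact Finset.union_subset hDI (hX.trans Finset.sdiff_subset)
        · rw [Function.update_of_ne hj]
          exact (h M hM).subset j
      · exact .inr fun M hM => hne ⟨M, hM⟩
    rcases hXI with hXI | hno
    swap
    · exact .pure (.inr D) fun M hM => (hno M hM.1).elim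
    -- The extra three per element pay for the test against the last set and for two new
    -- obligations; each obligation later costs one unconditional query.
    have hclog : ∀ M, pre M → 1 + X.card * (1 + Nat.clog 2 (I i).card) + 3 * X.card ≤
        1 + visitCost M * X.card := fun M hM => by
      have h1 := Nat.clog_mono_right 2 (indep_card_le_matroidRank ((h M hM).good.1.1 i))
      have h2 := Nat.mul_le_mul_left X.card h1
      rw [visitCost]
      nlinarith
    have hOpos : 0 < O.card := Finset.card_pos.2 ⟨_, hxi⟩
    refine .bind (solvable_find (fun M z => z ∉ M.closure (I (Fin.last k) : Set (Fin n))) (X \ R)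
      fun z _ => (testable_mem_closure z fun M hM =>
        ⟨(h M hM.1).ground, (h M hM.1).good.1.1 _⟩).not) fun z => ?_
    rcases z with - | z
    · refine (ih (Function.update D i (D i ∪ X)) (R ∪ X)
        (fun z => if z ∈ R then tr z else if u z ≤ numCovered I z then tr x ++ [(x, i), (z, i)]
          else [])
        (O.erase (x, i) ∪ (X.image (fun z => (z, Fin.last k)) ∪
          X.image (fun z => (z, ⟨i.val - 1, by omega⟩)))) ?_ ?_).mono (fun M hM => hM) ?_
      · rintro M ⟨⟨hM, c, -, h2, h3, -⟩, c', -, h4, -⟩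
        exact (h M hM).next ((h M hM).mem_of_mem _ hxi) hX h2 h3
          fun z hz => by simpa using h4 rfl z hz
      all_goals
        have hcard : (O.erase (x, i) ∪ (X.image (fun z => (z, Fin.last k)) ∪
            X.image (fun z => (z, (⟨i.val - 1, by omega⟩ : Fin (k + 1)))))).card ≤
            O.card - 1 + (X.card + X.card) := by
          refine (Finset.card_union_le _ _).trans (add_le_add (Finset.card_erase_of_mem hxi).le ?_)
          exact (Finset.card_union_le _ _).trans
            (add_le_add Finset.card_image_le Finset.card_image_le)
      · rw [hsize]; omega
      · rintro M res c ⟨⟨hM, -⟩, -⟩ ⟨h1, h2⟩ c1 ⟨-, -, h3⟩ c2 ⟨-, -, -, h4⟩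
        have h5 := hclog M hM
        have h6 : (X \ R).card ≤ X.card := Finset.card_le_card Finset.sdiff_subset
        rw [hsize, mul_add] at h1 h2
        refine ⟨fun p hp => ⟨(h1 p hp).1, ?_⟩, fun D' hD' => ⟨(h2 D' hD').1, fun j => ?_,
          fun y hy => (h2 D' hD').2.2.1 y (Finset.mem_union_left _ hy), ?_⟩⟩
        · have := (h1 p hp).2
          omega
        · refine subset_trans ?_ ((h2 D' hD').2.1 j)
          rcases eq_or_ne j i with rfl | hj
          · simp
          · simp [hj]
        · have := (h2 D' hD').2.2.2
          omega
    · by_cases hz : z ∈ X \ R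
      swap
      · exact .pure (.inr D) fun M ⟨_, c', h1, _⟩ => (hz (h1 z rfl).1).elim
      obtain ⟨hzX, hzR⟩ := Finset.mem_sdiff.1 hz
      -- The search for the entry index costs at most the size of `I`, because only indices up to
      -- the first empty set matter. This avoids a `log k` term and accounts for the additional
      -- `packingSize I` in the bound.
      refine .bind (solvable_entry u I z ?_) fun j =>
        .pure (.inl (tr x ++ [(x, i), (z, i)] ++ [(z, j)])) ?_
      · rintro M ⟨⟨hM, -⟩, c, h1, -⟩
        refine ⟨(h M hM).ground, (h M hM).good, (h1 z rfl).2, fun hl => ?_⟩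
        exact (h1 z rfl).2 (M.closure_subset_closure (Set.empty_subset _) hl)
      · rintro M ⟨⟨⟨hM, -⟩, -⟩, -⟩ c ⟨h1, h2, h3⟩ c1 ⟨h4, -, h5⟩ c2 ⟨-, h6, h7, h8⟩
        refine ⟨?_, by simp⟩
        rintro _ ⟨⟩
        -- By maximality an uncovered element would be spanned by the last set.
        have hzu : u z ≤ numCovered I z := by
          by_contra hcon
          exact (h4 z rfl).2 ((h M hM).good.2.1 z (not_le.1 hcon) _)
        refine ⟨((h M hM).visit ((h M hM).mem_of_mem _ hxi) hX h6 h7 hzX hzR hzu).isAugmentation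
          (h M hM).ground (h M hM).good (h M hM).tight.subset j h1 h2, ?_⟩
        have h9 := hclog M hM
        have h10 : (X \ R).card ≤ X.card := Finset.card_le_card Finset.sdiff_subset
        have h11 := Nat.mul_le_mul_left (visitCost M) hXI
        rw [mul_add] at h11
        rw [add_mul, one_mul]
        omega

end Search

/-! ### Repeated searches with amortized cost. -/

section Extend

variable {n k : ℕ} {pre : Matroid (Fin n) → Prop}

/-- A good packing with a tight family, and the set `W` of elements that may be uncovered outside
the flat of the tight family. -/
structure ExtendInv (M : Matroid (Fin n)) (u : Fin n → ℕ) (I T : Fin (k + 1) → Finset (Fin n))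
    (W : Finset (Fin n)) : Prop where
  ground : M.E = Set.univ
  good : IsGoodPacking M u I
  tight : IsTight M I T
  uncovered : ∀ e, numCovered I e < u e →
    e ∈ W ∨ e ∈ M.closure (T (Fin.last k) : Set (Fin n))

theorem ExtendInv.empty {M : Matroid (Fin n)} {u : Fin n → ℕ} {I : Fin (k + 1) → Finset (Fin n)}
    (hE : M.E = Set.univ) (hI : IsGoodPacking M u I) :
    ExtendInv M u I (fun _ => ∅) Finset.univ :=
  ⟨hE, hI, ⟨by simp, by simp⟩, by simp⟩

/-- The search may start from the tight family of earlier failures, whose sets span each other.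
Hence the only open obligation is the new root. -/
theorem ExtendInv.searchInv {M : Matroid (Fin n)} {u : Fin n → ℕ}
    {I T : Fin (k + 1) → Finset (Fin n)} {W : Finset (Fin n)} (h : ExtendInv M u I T W) {e : Fin n}
    (he : numCovered I e < u e) :
    SearchInv M u I T T {e} (fun _ => []) {(e, Fin.last k)} where
  ground := h.ground
  good := h.good
  tight := h.tight
  subset := h.tight.subset
  superset := fun _ => subset_rfl
  trace := by simpa using ExchangeTrace.root e he
  trace_mem := by simp
  trace_span := by simp
  mem_last := by simpa using h.good.2.1 e he _
  span_last := by simp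
  span_prev := fun i j _ d hd => .inr (h.tight.span j i hd)
  mem_of_mem := by simp
  visited := fun i d hd => .inr hd

/-- Search for augmenting paths from all elements of `W`. -/
theorem solvable_augment (u : Fin n → ℕ) (I : Fin (k + 1) → Finset (Fin n)) (m : ℕ)
    (T : Fin (k + 1) → Finset (Fin n)) (W : Finset (Fin n)) (hm : W.card = m)
    (h : ∀ M, pre M → ExtendInv M u I T W) :
    Solvable pre (fun M (res : Option (List (Fin n × Fin (k + 1))) ×
        (Fin (k + 1) → Finset (Fin n)) × Finset (Fin n)) c =>
      (∀ p, res.1 = some p → IsAugmentation M u I res.2.1 p ∧ ExtendInv M u I res.2.1 res.2.2 ∧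
        c + visitCost M * packingSize T + 2 * res.2.2.card ≤
          2 * W.card + visitCost M * packingSize res.2.1 +
            ((visitCost M + 1) * packingSize I + 2)) ∧
      (res.1 = none → (¬ ∃ p, IsSTPath M u I p) ∧ IsMaximumPacking M u I ∧
        c + visitCost M * packingSize T ≤ 2 * W.card + visitCost M * packingSize I)) := by
  classical
  induction m generalizing pre T W with
  | zero =>
    refine .pure (none, T, W) fun M hM => ⟨by simp, fun _ => ?_⟩
    obtain rfl := Finset.card_eq_zero.1 hm
    have hu : ∀ e, numCovered I e < u e → e ∈ M.closure (T (Fin.last k) : Set (Fin n)) :=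
      fun e he => by simpa using (h M hM).uncovered e he
    refine ⟨fun ⟨p, hp⟩ => (h M hM).tight.not_isSTPath (h M hM).ground hu p hp,
      (h M hM).tight.isMaximumPacking (h M hM).good.1 hu, ?_⟩
    have : packingSize T ≤ packingSize I :=
      Finset.sum_le_sum fun i _ => Finset.card_le_card ((h M hM).tight.subset i)
    have := Nat.mul_le_mul_left (visitCost M) this
    simpa using this
  | succ m ih =>
    obtain ⟨e, he⟩ : W.Nonempty := Finset.card_pos.1 (by omega)
    have hcard : (W.erase e).card = m := by rw [Finset.card_erase_of_mem he]; omega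
    by_cases hcov : u e ≤ numCovered I e
    · refine (ih T (W.erase e) hcard fun M hM => ⟨(h M hM).ground, (h M hM).good, (h M hM).tight,
        fun f hf => ((h M hM).uncovered f hf).imp_left fun hfW => Finset.mem_erase.2
          ⟨fun hfe => absurd hcov (not_le.2 (hfe ▸ hf)), hfW⟩⟩).mono (fun M hM => hM) ?_
      rintro M res c hM ⟨h1, h2⟩
      refine ⟨fun p hp => ⟨(h1 p hp).1, (h1 p hp).2.1, ?_⟩, fun hr => ⟨(h2 hr).1, (h2 hr).2.1, ?_⟩⟩
      · have := (h1 p hp).2.2; omega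
      · have := (h2 hr).2.2; omega
    refine .test (testable_mem_closure (D := T (Fin.last k)) e fun M hM => ⟨(h M hM).ground,
      ((h M hM).good.1.1 _).subset (by exact_mod_cast (h M hM).tight.subset _)⟩) ?_ ?_
    · refine (ih (pre := fun M => pre M ∧ e ∈ M.closure (T (Fin.last k) : Set (Fin n))) T
        (W.erase e) hcard fun M hM => ⟨(h M hM.1).ground, (h M hM.1).good, (h M hM.1).tight,
        fun f hf => ?_⟩).mono (fun M hM => hM) ?_
      · by_cases hfe : f = e
        · exact .inr (hfe ▸ hM.2)
        · exact ((h M hM.1).uncovered f hf).imp_left fun hfW => Finset.mem_erase.2 ⟨hfe, hfW⟩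
      · rintro M res c hM ⟨h1, h2⟩
        refine ⟨fun p hp => ⟨(h1 p hp).1, (h1 p hp).2.1, ?_⟩,
          fun hr => ⟨(h2 hr).1, (h2 hr).2.1, ?_⟩⟩
        · have := (h1 p hp).2.2; omega
        · have := (h2 hr).2.2; omega
    · refine .bind (solvable_search u I T _ T {e} (fun _ => []) {(e, Fin.last k)}
        (fun M hM => (h M hM.1).searchInv (not_le.1 hcov)) (Nat.le_add_right _ _)) fun res => ?_
      rcases res with p | D'
      · refine .pure (some p, T, W) ?_
        rintro M ⟨⟨hM, -⟩, -⟩ c ⟨h1, -⟩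
        refine ⟨?_, by simp⟩
        rintro _ ⟨⟩
        refine ⟨(h1 p rfl).1, h M hM, ?_⟩
        have := (h1 p rfl).2
        simp only [Finset.card_singleton] at this ⊢
        omega
      · refine (ih D' (W.erase e) hcard ?_).mono (fun M hM => hM) ?_
        · rintro M ⟨⟨hM, -⟩, c, -, h2⟩
          obtain ⟨h3, h4, h5, -⟩ := h2 D' rfl
          refine ⟨(h M hM).ground, (h M hM).good, h3, fun f hf => ?_⟩
          by_cases hfe : f = e
          · exact .inr (h5 f (by simp [hfe]))
          · exact ((h M hM).uncovered f hf).imp (fun hfW => Finset.mem_erase.2 ⟨hfe, hfW⟩)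
              fun hfT => M.closure_subset_closure (by exact_mod_cast h4 _) hfT
        · rintro M res c ⟨⟨hM, -⟩, -⟩ ⟨h1, h2⟩ c' ⟨-, h4⟩
          have h5 := (h4 D' rfl).2.2.2
          rw [Finset.card_singleton] at h5
          refine ⟨fun p hp => ⟨(h1 p hp).1, (h1 p hp).2.1, ?_⟩,
            fun hr => ⟨(h2 hr).1, (h2 hr).2.1, ?_⟩⟩
          · have := (h1 p hp).2.2; omega
          · have := (h2 hr).2.2; omega

/-- Augment a good packing until it is a maximum packing. -/
theorem solvable_extend (u : Fin n → ℕ) (fuel : ℕ) (I T : Fin (k + 1) → Finset (Fin n))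
    (W : Finset (Fin n)) (hfuel : (k + 1) * n ≤ fuel + packingSize I)
    (h : ∀ M, pre M → ExtendInv M u I T W) :
    Solvable pre (fun M (J : Fin (k + 1) → Finset (Fin n)) c => IsMaximumPacking M u J ∧
      (∀ e, numCovered I e ≤ numCovered J e) ∧ c + visitCost M * packingSize T +
        packingSize I * ((visitCost M + 1) * unionOpt M u (k + 1) + 2) ≤
      2 * W.card + visitCost M * unionOpt M u (k + 1) +
        packingSize J * ((visitCost M + 1) * unionOpt M u (k + 1) + 2)) := by
  induction fuel generalizing pre I T W with
  | zero =>
    refine .bind (solvable_augment u I _ T W rfl h) fun ⟨res, T', W'⟩ => .pure I ?_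
    rintro M ⟨hM, -⟩ c ⟨h1, h2⟩
    rcases res with - | p
    · obtain ⟨-, h3, h4⟩ := h2 rfl
      have := Nat.mul_le_mul_left (visitCost M) (packingSize_le_unionOpt (h M hM).good.1)
      exact ⟨h3, fun _ => le_rfl, by omega⟩
    · have h3 := (h1 p rfl).1.packingSize_eq
      have := packingSize_le_mul (augmentAlong I p)
      omega
  | succ fuel ih =>
    refine .bind (solvable_augment u I _ T W rfl h) fun ⟨res, T', W'⟩ => ?_
    rcases res with - | p
    · refine .pure I ?_
      rintro M ⟨hM, -⟩ c ⟨-, h2⟩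
      obtain ⟨-, h3, h4⟩ := h2 rfl
      have := Nat.mul_le_mul_left (visitCost M) (packingSize_le_unionOpt (h M hM).good.1)
      exact ⟨h3, fun _ => le_rfl, by omega⟩
    · by_cases hsize : packingSize (augmentAlong I p) = packingSize I + 1
      swap
      · exact .pure I fun M ⟨_, c, h1, _⟩ => (hsize (h1 p rfl).1.packingSize_eq).elim
      refine (ih (augmentAlong I p) T' W' (by omega) ?_).mono (fun M hM => hM) ?_
      · rintro M ⟨hM, c, h1, -⟩
        obtain ⟨h2, h3, -⟩ := h1 p rfl
        refine ⟨h3.ground, h2.isGoodPacking, ⟨h2.subset, h3.tight.span⟩, fun e he => ?_⟩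
        exact h3.uncovered e ((h2.numCovered_le e).trans_lt he)
      · rintro M J c ⟨hM, -⟩ ⟨h1, h2, h3⟩ c' ⟨h4, -⟩
        obtain ⟨h5, h6, h7⟩ := h4 p rfl
        refine ⟨h1, fun e => (h5.numCovered_le e).trans (h2 e), ?_⟩
        have h8 := Nat.mul_le_mul_left (visitCost M + 1) (packingSize_le_unionOpt h6.good.1)
        rw [hsize, add_mul (packingSize I)] at h3
        simp only at h7
        omega

end Extend

/-! ### From binary logarithms of integers to natural logarithms. -/

section Bounds

theorem one_le_two_mul_log {x : ℕ} (hx : 2 ≤ x) : 1 ≤ 2 * Real.log x := by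
  have h1 := Real.log_two_gt_d9
  have h2 : Real.log 2 ≤ Real.log x := Real.log_le_log (by norm_num) (by exact_mod_cast hx)
  linarith

/-- Since `log 2 > 1/2`, the rounded-down logarithm and the rounding error are each at most `2 * log
x`. -/
theorem clog_two_le {x : ℕ} (hx : 2 ≤ x) : (Nat.clog 2 x : ℝ) ≤ 4 * Real.log x := by
  have h1 := Real.log_two_gt_d9
  have h2 : 2 ^ (Nat.clog 2 x).pred < x := Nat.pow_pred_clog_lt_self (by norm_num) (by omega)
  have h3 : ((Nat.clog 2 x).pred : ℝ) * Real.log 2 ≤ Real.log x := by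
    rw [← Real.log_pow]
    exact Real.log_le_log (by positivity) (by exact_mod_cast h2.le)
  have h4 : (Nat.clog 2 x : ℝ) ≤ (Nat.clog 2 x).pred + 1 := by
    exact_mod_cast Nat.le_succ_of_pred_le le_rfl
  have h5 := one_le_two_mul_log hx
  have h6 : (0 : ℝ) ≤ (Nat.clog 2 x).pred := Nat.cast_nonneg _
  nlinarith

variable {n : ℕ} {β : Type} {pre : Matroid (Fin n) → Prop}

theorem visitCost_le {M : Matroid (Fin n)} (h : 2 ≤ matroidRank M) :
    (visitCost M : ℝ) ≤ 12 * Real.log (matroidRank M) := by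
  rw [visitCost]
  push_cast
  linarith [one_le_two_mul_log h, clog_two_le h]

theorem log_matroidRank_nonneg (M : Matroid (Fin n)) : 0 ≤ Real.log (matroidRank M) :=
  Real.log_natCast_nonneg _

theorem Solvable.map {γ : Type} {post : Matroid (Fin n) → β → ℕ → Prop}
    {post' : Matroid (Fin n) → γ → ℕ → Prop} (f : β → γ) (h : Solvable pre post)
    (hf : ∀ M b c, pre M → post M b c → post' M (f b) c) : Solvable pre post' := by
  refine .bind h fun b => .pure (f b) ?_
  rintro M ⟨hM, -⟩ c hc
  exact hf M b c hM hc

end Bounds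

/-! ### The augmentation and extension algorithms. -/

section Parts

theorem isMaximumPacking_zero {n : ℕ} {M : Matroid (Fin n)} {u : Fin n → ℕ}
    (I : Fin 0 → Finset (Fin n)) : IsMaximumPacking M u I :=
  ⟨⟨fun i => i.elim0, fun e => by simp [numCovered]⟩, fun J _ => by simp [packingSize]⟩

/-- One search for an augmenting path. -/
theorem exists_augment_alg (n k : ℕ) (u : Fin n → ℕ) (I : Fin k → Finset (Fin n)) :
    ∃ A : OracleAlg n (Option (List (Fin n × Fin k))),
      ∀ M : Matroid (Fin n), M.E = Set.univ → IsGoodPacking M u I →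
        (∀ p, A.run (indepOracle M) = some p →
          IsSTPath M u I p ∧ IsGoodPacking M u (augmentAlong I p) ∧
          packingSize (augmentAlong I p) = packingSize I + 1) ∧
        (A.run (indepOracle M) = none →
          (¬ ∃ p, IsSTPath M u I p) ∧ IsMaximumPacking M u I) ∧
        (A.queries (indepOracle M) : ℝ) ≤
          40 * (n + unionOpt M u k * Real.log (matroidRank M)) := by
  rcases k with - | k
  · refine ⟨.result none, fun M hE hI => ⟨by simp [OracleAlg.run], fun _ => ⟨?_,
      isMaximumPacking_zero I⟩, ?_⟩⟩
    · rintro ⟨p, -, hp⟩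
      rcases p with - | ⟨⟨x, i⟩, p⟩
      · simp only [List.map_nil, List.nil_append, List.isChain_cons_cons] at hp
        exact nomatch hp.1
      · exact i.elim0
    · have := log_matroidRank_nonneg M
      simp only [OracleAlg.queries, Nat.cast_zero]
      positivity
  have h := solvable_augment (pre := fun M => M.E = Set.univ ∧ IsGoodPacking M u I) u I _
    (fun _ => ∅) Finset.univ rfl fun M hM => ExtendInv.empty hM.1 hM.2
  have h' : Solvable (fun M => M.E = Set.univ ∧ IsGoodPacking M u I)
      (fun M (res : Option (List (Fin n × Fin (k + 1)))) c =>
        ((∀ p, res = some p → IsSTPath M u I p ∧ IsGoodPacking M u (augmentAlong I p) ∧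
          packingSize (augmentAlong I p) = packingSize I + 1) ∧
        (res = none → (¬ ∃ p, IsSTPath M u I p) ∧ IsMaximumPacking M u I)) ∧
        c ≤ 2 * n + (2 * visitCost M + 3) * unionOpt M u (k + 1)) := by
    refine h.map Prod.fst ?_
    rintro M ⟨res, T, W⟩ c ⟨-, hI⟩ ⟨h1, h2⟩
    refine ⟨⟨fun p hp => ⟨(h1 p hp).1.isSTPath, (h1 p hp).1.isGoodPacking,
      (h1 p hp).1.packingSize_eq⟩, fun hr => ⟨(h2 hr).1, (h2 hr).2.1⟩⟩, ?_⟩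
    rcases res with - | p
    · have h3 := (h2 rfl).2.2
      have h4 := packingSize_le_unionOpt hI.1
      simp only [Finset.card_univ, Fintype.card_fin] at h3
      nlinarith
    · obtain ⟨h3, h4, h5⟩ := h1 p rfl
      have h6 := packingSize_le_unionOpt h3.isGoodPacking.1
      rw [h3.packingSize_eq] at h6
      have h7 : packingSize T ≤ packingSize I :=
        Finset.sum_le_sum fun i _ => Finset.card_le_card (h4.tight.subset i)
      simp only [Finset.card_univ, Fintype.card_fin] at h5
      nlinarith
  obtain ⟨A, hA⟩ := h'.of_matroidRank fun M hM => hM.1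
  refine ⟨A, fun M hE hI => ?_⟩
  obtain ⟨⟨h1, h2⟩, h3⟩ := hA M ⟨hE, hI⟩
  refine ⟨h1, h2, ?_⟩
  have hlog := log_matroidRank_nonneg M
  rcases h3 with ⟨-, h3⟩ | ⟨h4, h3⟩
  · have h3' : (A.queries (indepOracle M) : ℝ) ≤ 2 * n := by exact_mod_cast h3
    have : (0 : ℝ) ≤ unionOpt M u (k + 1) * Real.log (matroidRank M) := by positivity
    have : (0 : ℝ) ≤ n := Nat.cast_nonneg _
    linarith
  · have h3' : (A.queries (indepOracle M) : ℝ) ≤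
        2 * n + (2 * n + (2 * visitCost M + 3) * unionOpt M u (k + 1)) := by exact_mod_cast h3
    have h5 : (2 * visitCost M + 3 : ℝ) ≤ 30 * Real.log (matroidRank M) := by
      linarith [visitCost_le h4, one_le_two_mul_log h4]
    have h6 := mul_le_mul_of_nonneg_right h5 (Nat.cast_nonneg (α := ℝ) (unionOpt M u (k + 1)))
    have : (0 : ℝ) ≤ unionOpt M u (k + 1) * Real.log (matroidRank M) := by positivity
    have : (0 : ℝ) ≤ n := Nat.cast_nonneg _
    linarith

/-- Extension of a good packing to a maximum packing. -/
theorem exists_extend_alg (n k : ℕ) (u : Fin n → ℕ) (I : Fin k → Finset (Fin n)) :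
    ∃ A : OracleAlg n (Fin k → Finset (Fin n)),
      ∀ M : Matroid (Fin n), M.E = Set.univ → IsGoodPacking M u I →
        IsMaximumPacking M u (A.run (indepOracle M)) ∧
        (∀ e, numCovered I e ≤ numCovered (A.run (indepOracle M)) e) ∧
        (A.queries (indepOracle M) : ℝ) ≤ 20 * (n + ((unionOpt M u k : ℝ) - packingSize I + 1) *
          (unionOpt M u k * Real.log (matroidRank M))) := by
  have hq : ∀ M, IsGoodPacking M u I → (0 : ℝ) ≤ (unionOpt M u k : ℝ) - packingSize I :=
    fun M hI => sub_nonneg.2 (by exact_mod_cast packingSize_le_unionOpt hI.1)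
  have hY : ∀ M : Matroid (Fin n), (0 : ℝ) ≤ unionOpt M u k * Real.log (matroidRank M) :=
    fun M => mul_nonneg (Nat.cast_nonneg _) (log_matroidRank_nonneg M)
  rcases k with - | k
  · refine ⟨.result I, fun M hE hI => ⟨isMaximumPacking_zero I, fun _ => le_rfl, ?_⟩⟩
    have h1 := hq M hI
    have h2 := hY M
    simp only [OracleAlg.queries, Nat.cast_zero]
    positivity
  have h := solvable_extend (pre := fun M => M.E = Set.univ ∧ IsGoodPacking M u I) u ((k + 1) * n) I
    (fun _ => ∅) Finset.univ (Nat.le_add_right _ _) fun M hM => ExtendInv.empty hM.1 hM.2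
  have h' : Solvable (fun M => M.E = Set.univ ∧ IsGoodPacking M u I)
      (fun M (J : Fin (k + 1) → Finset (Fin n)) c => (IsMaximumPacking M u J ∧
        ∀ e, numCovered I e ≤ numCovered J e) ∧ c ≤ 2 * n + visitCost M * unionOpt M u (k + 1) +
          (unionOpt M u (k + 1) - packingSize I) *
            ((visitCost M + 1) * unionOpt M u (k + 1) + 2)) := by
    refine h.mono (fun M hM => hM) ?_
    rintro M J c ⟨-, hI⟩ ⟨h1, h2, h3⟩
    refine ⟨⟨h1, h2⟩, ?_⟩
    have h4 := packingSize_le_unionOpt hI.1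
    have h5 := Nat.mul_le_mul_right ((visitCost M + 1) * unionOpt M u (k + 1) + 2)
      (packingSize_le_unionOpt h1.1)
    obtain ⟨q, hq⟩ := Nat.exists_eq_add_of_le h4
    rw [show unionOpt M u (k + 1) - packingSize I = q by omega]
    have h6 : unionOpt M u (k + 1) * ((visitCost M + 1) * unionOpt M u (k + 1) + 2) =
        packingSize I * ((visitCost M + 1) * unionOpt M u (k + 1) + 2) +
        q * ((visitCost M + 1) * unionOpt M u (k + 1) + 2) := by rw [← add_mul, ← hq]
    simp only [Finset.card_univ, Fintype.card_fin] at h3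
    omega
  obtain ⟨A, hA⟩ := h'.of_matroidRank fun M hM => hM.1
  refine ⟨A, fun M hE hI => ?_⟩
  obtain ⟨⟨h1, h2⟩, h3⟩ := hA M ⟨hE, hI⟩
  refine ⟨h1, h2, ?_⟩
  have hlog := log_matroidRank_nonneg M
  have h0 := hY M
  have h01 := hq M hI
  have hn : (0 : ℝ) ≤ n := Nat.cast_nonneg _
  have h02 := mul_nonneg h01 h0
  rcases h3 with ⟨-, h3⟩ | ⟨h4, h3⟩
  · have h3' : (A.queries (indepOracle M) : ℝ) ≤ 2 * n := by exact_mod_cast h3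
    linarith
  · have h4' := packingSize_le_unionOpt hI.1
    have h3' : (A.queries (indepOracle M) : ℝ) ≤
        2 * n + (2 * n + visitCost M * unionOpt M u (k + 1) +
          ((unionOpt M u (k + 1) : ℝ) - packingSize I) *
            ((visitCost M + 1) * unionOpt M u (k + 1) + 2)) := by
      rw [← Nat.cast_sub h4']
      exact_mod_cast h3
    have h5 := visitCost_le h4
    have h5' := one_le_two_mul_log h4
    have hO : (0 : ℝ) ≤ unionOpt M u (k + 1) := Nat.cast_nonneg _
    have h6 := mul_le_mul_of_nonneg_right h5 hO
    -- The additive `2` per augmentation is absorbed only if the optimum is positive; otherwise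
    -- there is nothing to augment.
    rcases Nat.eq_zero_or_pos (unionOpt M u (k + 1)) with h7 | h7
    · have h8 : packingSize I = 0 := by omega
      simp only [h7, h8, Nat.cast_zero] at h3' ⊢
      linarith
    · have h8 : (1 : ℝ) ≤ unionOpt M u (k + 1) := by exact_mod_cast h7
      have h9 : (visitCost M + 1 : ℝ) * unionOpt M u (k + 1) + 2 ≤
          20 * (unionOpt M u (k + 1) * Real.log (matroidRank M)) := by nlinarith
      have h10 := mul_le_mul_of_nonneg_left h9 h01
      linarith

end Parts

/-! ### Push-relabel: invariants, relabels and pushes. -/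

section PushRelabel

variable {n k : ℕ} {pre : Matroid (Fin n) → Prop}

/-- The elements of the `i`-th base with key at least `t`. -/
def keyUpper (base : Fin k → Finset (Fin n)) (key : Fin k → Fin n → ℕ) (t : ℕ) (i : Fin k) :
    Finset (Fin n) :=
  (base i).filter (fun e => t ≤ key i e)

theorem mem_keyUpper {base : Fin k → Finset (Fin n)} {key : Fin k → Fin n → ℕ} {t : ℕ} {i : Fin k}
    {e : Fin n} : e ∈ keyUpper base key t i ↔ e ∈ base i ∧ t ≤ key i e := by
  simp [keyUpper]

theorem keyUpper_anti (base : Fin k → Finset (Fin n)) (key : Fin k → Fin n → ℕ) {s t : ℕ}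
    (h : s ≤ t) (i : Fin k) : keyUpper base key t i ⊆ keyUpper base key s i := fun e he => by
  rw [mem_keyUpper] at he ⊢
  exact ⟨he.1, h.trans he.2⟩

/-- The total insertion level; a key `n + j` stands for the insertion level `j`, and a key below
`n` for the insertion level zero. -/
def totalLevel (base : Fin k → Finset (Fin n)) (key : Fin k → Fin n → ℕ) : ℕ :=
  ∑ i, ∑ e ∈ base i, (key i e - n)

/-- The invariants of the push-relabel algorithm, where `W` contains all uncovered elements of
level less than `h`. -/
structure PushInv (M : Matroid (Fin n)) (u : Fin n → ℕ) (h : ℕ) (base : Fin k → Finset (Fin n))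
    (key : Fin k → Fin n → ℕ) (lev : Fin n → ℕ) (W : Finset (Fin n)) : Prop where
  ground : M.E = Set.univ
  isBase : ∀ i, M.IsBase (base i : Set (Fin n))
  key_le : ∀ i, ∀ e ∈ base i, key i e ≤ n + lev e
  overpacked : ∀ e, u e < numCovered base e → lev e = 0
  span : ∀ i j e, 1 ≤ j → j < lev e →
    e ∈ M.closure (keyUpper base key (n + j) i : Set (Fin n))
  lev_le : ∀ e, lev e ≤ h
  uncovered : ∀ e, numCovered base e < u e → h ≤ lev e ∨ e ∈ W
  decreasing : ∀ t, IsDecreasing M (keyUpper base key t)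
  key_cases : ∀ i, ∀ e ∈ base i, key i e = e.val ∨ n < key i e
  origin : ∀ i i', ∀ f ∈ base i', key i' f = f.val →
    f ∈ M.closure (keyUpper base key f.val i : Set (Fin n))

variable {M : Matroid (Fin n)} {u : Fin n → ℕ} {h : ℕ} {base : Fin k → Finset (Fin n)}
  {key : Fin k → Fin n → ℕ} {lev : Fin n → ℕ} {W : Finset (Fin n)}

theorem PushInv.erase (H : PushInv M u h base key lev W) {e : Fin n}
    (he : u e ≤ numCovered base e ∨ h ≤ lev e) : PushInv M u h base key lev (W.erase e) :=
  { H with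
    uncovered := fun f hf => by
      by_cases hfe : f = e
      · subst hfe
        exact .inl (he.resolve_left (not_le.2 hf))
      · exact (H.uncovered f hf).imp_right fun hW => Finset.mem_erase.2 ⟨hfe, hW⟩ }

/-- The invariants speak only about spans below the level, so a level may jump to its new value at
once instead of rising by single steps. -/
theorem PushInv.relabel (H : PushInv M u h base key lev W) {e : Fin n} {j : ℕ}
    (he : numCovered base e < u e) (hj : lev e ≤ j) (hjh : j ≤ h)
    (hspan : ∀ i j', 1 ≤ j' → j' < j →
      e ∈ M.closure (keyUpper base key (n + j') i : Set (Fin n))) :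
    PushInv M u h base key (Function.update lev e j) W := by
  have hle : ∀ f, lev f ≤ Function.update lev e j f := fun f => by
    rcases eq_or_ne f e with rfl | hf
    · simpa using hj
    · simp [hf]
  exact { H with
    key_le := fun i f hf => (H.key_le i f hf).trans (Nat.add_le_add_left (hle f) n)
    overpacked := fun f hf => by
      have hfe : f ≠ e := by rintro rfl; omega
      rw [Function.update_of_ne hfe]
      exact H.overpacked f hf
    span := fun i j' f h1 h2 => by
      rcases eq_or_ne f e with rfl | hf
      · rw [Function.update_self] at h2
        exact hspan i j' h1 h2
      · rw [Function.update_of_ne hf] at h2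
        exact H.span i j' f h1 h2
    lev_le := fun f => by
      rcases eq_or_ne f e with rfl | hf
      · simpa using hjh
      · simpa [hf] using H.lev_le f
    uncovered := fun f hf => (H.uncovered f hf).imp_left fun h' => h'.trans (hle f) }

/-- Push the element `e` at its level `j` into the `i`-th base, in exchange for `d`. -/
theorem PushInv.push (H : PushInv M u h base key lev W) {e d : Fin n} {i : Fin k} {j : ℕ}
    (heW : e ∈ W) (he : numCovered base e < u e) (hj : 1 ≤ j) (hlev : lev e = j)
    (hi : e ∉ M.closure (keyUpper base key (n + j) i : Set (Fin n)))
    (hi' : ∀ i' : Fin k, i'.val + 1 = i.val →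
      e ∈ M.closure (keyUpper base key (n + j) i' : Set (Fin n)))
    (hd : d ∈ base i) {S : Finset (Fin n)} (hS : S ⊆ base i) (hdS : d ∉ S)
    (hkey : ∀ x ∈ S, key i d ≤ key i x) (heS : e ∉ M.closure (S : Set (Fin n)))
    (hedS : e ∈ M.closure (insert d (S : Set (Fin n)))) :
    PushInv M u h (Function.update base i (insert e ((base i).erase d)))
      (Function.update key i (Function.update (key i) e (n + j))) lev (insert d W) ∧
    totalLevel base key + 1 ≤ totalLevel (Function.update base i (insert e ((base i).erase d)))
      (Function.update key i (Function.update (key i) e (n + j))) := by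
  have hE := H.ground
  generalize hb : Function.update base i (insert e ((base i).erase d)) = base'
  generalize hk : Function.update key i (Function.update (key i) e (n + j)) = key'
  have hbi : base' i = insert e ((base i).erase d) := by rw [← hb, Function.update_self]
  have hki : key' i = Function.update (key i) e (n + j) := by rw [← hk, Function.update_self]
  have hbo : ∀ a, a ≠ i → base' a = base a := fun a ha => by rw [← hb, Function.update_of_ne ha]
  have hko : ∀ a, a ≠ i → key' a = key a := fun a ha => by rw [← hk, Function.update_of_ne ha]
  have hVo : ∀ a, a ≠ i → ∀ t, keyUpper base' key' t a = keyUpper base key t a := fun a ha t => by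
    rw [keyUpper, keyUpper, hbo a ha, hko a ha]
  have hVi : ∀ t x, x ∈ keyUpper base' key' t i ↔
      (x = e ∧ t ≤ n + j) ∨ (x ≠ e ∧ x ≠ d ∧ x ∈ keyUpper base key t i) := fun t x => by
    rw [mem_keyUpper, mem_keyUpper, hbi, hki]
    rcases eq_or_ne x e with rfl | hx
    · simp
    · simp [hx]; tauto
  have hSd : insert d (S : Set (Fin n)) ⊆ keyUpper base key (key i d) i := fun x hx => by
    rw [Finset.mem_coe, mem_keyUpper]
    rcases hx with rfl | hx
    exacts [⟨hd, le_rfl⟩, ⟨hS hx, hkey x hx⟩]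
  -- Otherwise all of `S + d` would have key at least `n + j` and span `e`.
  have hdj : key i d < n + j := by
    by_contra hcon
    refine hi (M.closure_subset_closure ?_ hedS)
    exact hSd.trans (by exact_mod_cast keyUpper_anti base key (not_lt.1 hcon) i)
  -- The base is independent, so a copy of `e` in it must be the pivot itself; the push then
  -- reinserts `e` at a higher level.
  have hed : e ∈ base i → e = d := fun heb => by
    have hsub : insert d (S : Set (Fin n)) ⊆ (base i : Set (Fin n)) :=
      Set.insert_subset hd (by exact_mod_cast hS)
    have := (H.isBase i).indep.closure_inter_eq_self_of_subset hsub
    have hmem : e ∈ insert d (S : Set (Fin n)) := this ▸ ⟨hedS, heb⟩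
    exact hmem.resolve_right fun h => heS (mem_closure_of_mem_set hE h)
  have hdcl : d ∈ M.closure (insert e (S : Set (Fin n))) := M.mem_closure_insert heS hedS
  -- Spans grow at every threshold: the lost `d` is spanned by `S + e`, whose keys are at least that
  -- of `d`.
  have hup : ∀ a t, ∀ x ∈ M.closure (keyUpper base key t a : Set (Fin n)),
      x ∈ M.closure (keyUpper base' key' t a : Set (Fin n)) := by
    intro a t
    refine M.closure_subset_closure_of_subset_closure fun x hx => ?_
    rw [Finset.mem_coe] at hx
    rcases eq_or_ne a i with rfl | ha
    swap
    · rw [hVo a ha]; exact mem_closure_of_mem_set hE hx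
    have hx' := mem_keyUpper.1 hx
    by_cases hxe : x = e
    · subst hxe
      refine mem_closure_of_mem_set hE ((hVi t x).2 (.inl ⟨rfl, ?_⟩))
      have := hed hx'.1
      subst this
      omega
    by_cases hxd : x = d
    · subst hxd
      refine M.closure_subset_closure ?_ hdcl
      have het : e ∈ keyUpper base' key' t a := (hVi t e).2 (.inl ⟨rfl, by omega⟩)
      rw [Set.insert_subset_iff]
      refine ⟨het, fun s hs => ?_⟩
      by_cases hse : s = e
      · exact hse ▸ het
      · refine (hVi t s).2 (.inr ⟨hse, fun h => hdS (h ▸ hs), mem_keyUpper.2 ⟨hS hs, ?_⟩⟩)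
        exact hx'.2.trans (hkey s hs)
    · exact mem_closure_of_mem_set hE ((hVi t x).2 (.inr ⟨hxe, hxd, hx⟩))
  have hdown : ∀ a t, ∀ x ∈ keyUpper base' key' t a,
      x ∈ M.closure (keyUpper base key t a : Set (Fin n)) ∨ a = i ∧ x = e ∧ t ≤ n + j := by
    intro a t x hx
    rcases eq_or_ne a i with rfl | ha
    · rcases (hVi t x).1 hx with ⟨rfl, ht⟩ | ⟨-, -, hx⟩
      · exact .inr ⟨rfl, rfl, ht⟩
      · exact .inl (mem_closure_of_mem_set hE hx)
    · rw [hVo a ha] at hx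
      exact .inl (mem_closure_of_mem_set hE hx)
  have hcov : ∀ x, numCovered base' x + (if x ∈ base i then 1 else 0) =
      numCovered base x + (if x = e ∨ x ≠ d ∧ x ∈ base i then 1 else 0) := fun x => by
    have := numCovered_update base i (insert e ((base i).erase d)) x
    rw [hb] at this
    simpa using this
  constructor
  · refine ⟨hE, fun a => ?_, fun a x hx => ?_, fun x hx => ?_, fun a j' x h1 h2 => ?_, H.lev_le,
      fun x hx => ?_, fun t a b hab x hx => ?_, fun a x hx => ?_, fun a b f hf hkf => ?_⟩
    · rcases eq_or_ne a i with rfl | ha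
      · rw [hbi]
        by_cases hde : e = d
        · subst hde
          rw [Finset.insert_erase hd]
          exact H.isBase a
        · have h1 : d ∈ M.closure (insert e (base a : Set (Fin n)) \ {d}) := by
            refine M.closure_subset_closure ?_ hdcl
            rintro x (rfl | hx)
            · exact ⟨Set.mem_insert _ _, hde⟩
            · exact ⟨Set.mem_insert_of_mem _ (hS hx), fun h => hdS (h ▸ hx)⟩
          have := (H.isBase a).isBase_insert_sdiff_of_mem_closure h1 (Set.mem_insert_of_mem _ hd)
          convert this using 1
          ext x
          simp only [Finset.coe_insert, Finset.coe_erase, Set.mem_insert_iff, Set.mem_sdiff,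
            Set.mem_singleton_iff]
          constructor
          · rintro (rfl | h)
            exacts [⟨.inl rfl, hde⟩, ⟨.inr h.1, h.2⟩]
          · tauto
      · rw [hbo a ha]; exact H.isBase a
    · rcases eq_or_ne a i with rfl | ha
      · rw [hki]
        rcases eq_or_ne x e with rfl | hxe
        · simp [hlev]
        · rw [Function.update_of_ne hxe]
          rw [hbi, Finset.mem_insert, Finset.mem_erase] at hx
          exact H.key_le a x (hx.resolve_left hxe).2
      · rw [hbo a ha] at hx
        rw [hko a ha]
        exact H.key_le a x hx
    · have h1 := hcov x
      rcases eq_or_ne x e with rfl | hxe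
      · simp only [true_or, if_true] at h1
        omega
      · refine H.overpacked x ?_
        simp only [hxe, false_or] at h1
        by_cases h2 : x ∈ base i
        · simp only [h2, if_true, and_true] at h1
          split_ifs at h1 <;> omega
        · simp only [h2, if_false, and_false] at h1
          omega
    · exact hup a _ x (H.span a j' x h1 h2)
    · have h1 := hcov x
      rcases eq_or_ne x e with rfl | hxe
      · exact .inr (Finset.mem_insert_of_mem heW)
      · by_cases hxd : x = d
        · exact .inr (by simp [hxd])
        · refine (H.uncovered x ?_).imp_right (Finset.mem_insert_of_mem ·)
          simp only [hxe, hxd, false_or, ne_eq, not_false_eq_true, true_and] at h1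
          omega
    · rcases hdown b t x hx with h1 | ⟨rfl, rfl, ht⟩
      · exact hup a t x ((H.decreasing t).closure_subset hE
          (Fin.le_def.2 (by omega)) h1)
      · exact hup a t x (M.closure_subset_closure
          (by exact_mod_cast keyUpper_anti base key ht a) (hi' a hab))
    · rcases eq_or_ne a i with rfl | ha
      · rw [hki]
        rcases eq_or_ne x e with rfl | hxe
        · exact .inr (by simp; omega)
        · rw [Function.update_of_ne hxe]
          rw [hbi, Finset.mem_insert, Finset.mem_erase] at hx
          exact H.key_cases a x (hx.resolve_left hxe).2
      · rw [hbo a ha] at hx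
        rw [hko a ha]
        exact H.key_cases a x hx
    · refine hup a _ f ?_
      rcases eq_or_ne b i with rfl | ha
      · rw [hki] at hkf
        rcases eq_or_ne f e with rfl | hxe
        · rw [Function.update_self] at hkf
          omega
        · rw [Function.update_of_ne hxe] at hkf
          rw [hbi, Finset.mem_insert, Finset.mem_erase] at hf
          exact H.origin a b f (hf.resolve_left hxe).2 hkf
      · rw [hbo b ha] at hf
        rw [hko b ha] at hkf
        exact H.origin a b f hf hkf
  · rw [totalLevel, totalLevel, ← Finset.add_sum_erase _ _ (Finset.mem_univ i),
      ← Finset.add_sum_erase _ (fun a => ∑ e ∈ base' a, (key' a e - n)) (Finset.mem_univ i)]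
    have h1 : ∑ a ∈ Finset.univ.erase i, ∑ e ∈ base' a, (key' a e - n) =
        ∑ a ∈ Finset.univ.erase i, ∑ e ∈ base a, (key a e - n) :=
      Finset.sum_congr rfl fun a ha => by
        rw [hbo a (Finset.ne_of_mem_erase ha), hko a (Finset.ne_of_mem_erase ha)]
    have h2 : e ∉ (base i).erase d := fun h =>
      (Finset.mem_erase.1 h).1 (hed (Finset.mem_erase.1 h).2)
    have h3 : ∑ x ∈ (base i).erase d, (key' i x - n) = ∑ x ∈ (base i).erase d, (key i x - n) :=
      Finset.sum_congr rfl fun x hx => by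
        rw [hki, Function.update_of_ne]
        rintro rfl
        exact h2 hx
    rw [h1, hbi, Finset.sum_insert h2, h3, hki, Function.update_self,
      ← Finset.add_sum_erase _ _ hd]
    omega

/-- This crude bound does not involve the matroid, so the fuel of the main loop can be fixed in
advance. -/
theorem PushInv.totalLevel_le (H : PushInv M u h base key lev W) :
    totalLevel base key ≤ h * (k * n) := by
  rw [totalLevel]
  refine (Finset.sum_le_card_nsmul _ _ (n * h) fun i _ => ?_).trans_eq (by simp; ring)
  refine (Finset.sum_le_card_nsmul _ _ h fun e he => ?_).trans ?_
  · have := H.key_le i e he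
    have := H.lev_le e
    omega
  · rw [smul_eq_mul]
    exact Nat.mul_le_mul_right _ ((Finset.card_le_univ _).trans_eq (Fintype.card_fin n))

end PushRelabel

/-! ### Push-relabel: the main loop. -/

section PushRelabel

variable {n k : ℕ} {pre : Matroid (Fin n) → Prop}

/-- The cost of one push. -/
noncomputable def pushCost (k : ℕ) (M : Matroid (Fin n)) : ℕ :=
  2 + Nat.clog 2 k + 2 * Nat.clog 2 (matroidRank M)

/-- The main loop of the push-relabel algorithm. -/
theorem solvable_pushRelabel (u : Fin n → ℕ) (h : ℕ) (hh : 2 ≤ h) (fuel : ℕ)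
    (base : Fin (k + 1) → Finset (Fin n)) (key : Fin (k + 1) → Fin n → ℕ) (lev : Fin n → ℕ)
    (W : Finset (Fin n)) (H : ∀ M, pre M → PushInv M u h base key lev W)
    (hfuel : 2 * (h * ((k + 1) * n)) + W.card ≤ fuel + 2 * totalLevel base key) :
    Solvable pre (fun M (s : (Fin (k + 1) → Finset (Fin n)) × (Fin (k + 1) → Fin n → ℕ) ×
        (Fin n → ℕ)) c => PushInv M u h s.1 s.2.1 s.2.2 ∅ ∧
      c + pushCost (k + 1) M * totalLevel base key ≤
        W.card + pushCost (k + 1) M * totalLevel s.1 s.2.1) := by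
  classical
  -- The measure is twice the remaining total level plus the size of `W`: a push raises the total
  -- level and adds at most one element to `W`, and every other round shrinks `W`.
  induction fuel generalizing pre base key lev W with
  | zero =>
    refine .pure (base, key, lev) fun M hM => ?_
    have h1 := (H M hM).totalLevel_le
    obtain rfl : W = ∅ := Finset.card_eq_zero.1 (by omega)
    exact ⟨H M hM, by simp⟩
  | succ fuel ih =>
    rcases W.eq_empty_or_nonempty with rfl | ⟨e, heW⟩
    · exact .pure (base, key, lev) fun M hM => ⟨H M hM, by simp⟩
    have hpos : 0 < W.card := Finset.card_pos.2 ⟨e, heW⟩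
    have herase : (W.erase e).card + 1 = W.card := Finset.card_erase_add_one heW
    by_cases hdrop : u e ≤ numCovered base e ∨ h ≤ lev e
    · refine (ih base key lev (W.erase e) (fun M hM => (H M hM).erase hdrop) (by omega)).mono
        (fun M hM => hM) ?_
      rintro M s c - ⟨h1, h2⟩
      exact ⟨h1, by omega⟩
    push Not at hdrop
    obtain ⟨hunc, hlevh⟩ := hdrop
    have hind : ∀ M, pre M → ∀ t i, M.Indep (keyUpper base key t i : Set (Fin n)) :=
      fun M hM t i => ((H M hM).isBase i).indep.subset
        (by exact_mod_cast Finset.filter_subset _ _)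
    -- If even the last base spans `e` at threshold `h - 1`, then all bases do so at every smaller
    -- threshold, and `e` may rise to the top level.
    refine .test (testable_mem_closure (D := keyUpper base key (n + (h - 1)) (Fin.last k)) e
      fun M hM => ⟨(H M hM).ground, hind M hM _ _⟩) ?_ ?_
    · refine (ih base key (Function.update lev e h) (W.erase e) ?_ (by omega)).mono
        (fun M hM => hM) ?_
      · rintro M ⟨hM, he⟩
        refine ((H M hM).relabel hunc hlevh.le le_rfl fun i j' h1 h2 => ?_).erase (by simp)
        refine ((H M hM).decreasing _).closure_subset (H M hM).ground (Fin.le_last i) ?_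
        exact M.closure_subset_closure (by exact_mod_cast keyUpper_anti base key (by omega) _) he
      · rintro M s c - ⟨h1, h2⟩
        exact ⟨h1, by omega⟩
    have hloop : ∀ M, (pre M ∧ e ∉ M.closure
        (keyUpper base key (n + (h - 1)) (Fin.last k) : Set (Fin n))) → e ∉ M.closure ∅ :=
      fun M hM hl => hM.2 (M.closure_subset_closure (Set.empty_subset _) hl)
    have hbase : ∀ M, pre M → ∀ i, e ∈ M.closure (base i : Set (Fin n)) := fun M hM i => by
      rw [((H M hM).isBase i).closure_eq, (H M hM).ground]; trivial
    refine .bind (solvable_pivot (base (Fin.last k)) (key (Fin.last k)) e fun M hM =>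
      ⟨(H M hM.1).ground, ((H M hM.1).isBase _).indep, hbase M hM.1 _, hloop M hM⟩) fun d' => ?_
    -- This is the first positive level at which the last base fails to span `e`; a pivot of
    -- insertion level zero, whose key may be below `n`, gives `1` by truncated subtraction.
    obtain ⟨j, hj⟩ : ∃ j, j = key (Fin.last k) d' - n + 1 := ⟨_, rfl⟩
    have hrel : ∀ M, ((pre M ∧ e ∉ M.closure
        (keyUpper base key (n + (h - 1)) (Fin.last k) : Set (Fin n))) ∧ ∃ c, d' ∈ base (Fin.last k) ∧
        (∃ S : Finset (Fin n), S ⊆ base (Fin.last k) ∧ d' ∉ S ∧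
          (∀ x ∈ base (Fin.last k), key (Fin.last k) d' < key (Fin.last k) x → x ∈ S) ∧
          (∀ x ∈ S, key (Fin.last k) d' ≤ key (Fin.last k) x) ∧
          e ∉ M.closure (S : Set (Fin n)) ∧ e ∈ M.closure (insert d' (S : Set (Fin n)))) ∧
        c ≤ Nat.clog 2 (base (Fin.last k)).card) →
        e ∉ M.closure (keyUpper base key (n + j) (Fin.last k) : Set (Fin n)) ∧
        PushInv M u h base key (Function.update lev e j) W := by
      rintro M ⟨⟨hM, he⟩, c, hd', ⟨S, hSB, hdS, hS, hS', heS, heS'⟩, hc⟩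
      have hsub : ∀ t ≤ key (Fin.last k) d', insert d' (S : Set (Fin n)) ⊆
          keyUpper base key t (Fin.last k) := fun t ht => by
        rintro x (rfl | hx)
        · exact mem_keyUpper.2 ⟨hd', ht⟩
        · exact mem_keyUpper.2 ⟨hSB hx, ht.trans (hS' x hx)⟩
      have h1 : e ∉ M.closure (keyUpper base key (n + j) (Fin.last k) : Set (Fin n)) := fun hcon =>
        heS (M.closure_subset_closure (fun x hx => by
          have := mem_keyUpper.1 hx
          exact hS x this.1 (by omega)) hcon)
      refine ⟨h1, (H M hM).relabel hunc ?_ ?_ fun i j' hj1 hj2 => ?_⟩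
      · by_contra hcon
        exact h1 ((H M hM).span _ j e (by omega) (not_le.1 hcon))
      · have : key (Fin.last k) d' < n + (h - 1) := by
          by_contra hcon
          exact he (M.closure_subset_closure (hsub _ (not_lt.1 hcon)) heS')
        omega
      · refine ((H M hM).decreasing _).closure_subset (H M hM).ground (Fin.le_last i) ?_
        exact M.closure_subset_closure (hsub _ (by omega)) heS'
    refine .bind (solvable_first_unspanned (keyUpper base key (n + j)) e (Fin.last k) fun M hM =>
      ⟨(H M hM.1.1).ground, fun i _ => hind M hM.1.1 _ i, (hrel M hM).1⟩) fun i => ?_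
    refine .bind (solvable_pivot (base i) (key i) e fun M hM => ⟨(H M hM.1.1.1).ground,
      ((H M hM.1.1.1).isBase _).indep, hbase M hM.1.1.1 _, hloop M hM.1.1⟩) fun d => ?_
    have hpush : ∀ M, (((pre M ∧ e ∉ M.closure
        (keyUpper base key (n + (h - 1)) (Fin.last k) : Set (Fin n))) ∧ ∃ c, d' ∈ base (Fin.last k) ∧
        (∃ S : Finset (Fin n), S ⊆ base (Fin.last k) ∧ d' ∉ S ∧
          (∀ x ∈ base (Fin.last k), key (Fin.last k) d' < key (Fin.last k) x → x ∈ S) ∧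
          (∀ x ∈ S, key (Fin.last k) d' ≤ key (Fin.last k) x) ∧
          e ∉ M.closure (S : Set (Fin n)) ∧ e ∈ M.closure (insert d' (S : Set (Fin n)))) ∧
        c ≤ Nat.clog 2 (base (Fin.last k)).card) ∧
        ∃ c, i ≤ Fin.last k ∧ e ∉ M.closure (keyUpper base key (n + j) i : Set (Fin n)) ∧
          (∀ i' : Fin (k + 1), i'.val + 1 = i.val →
            e ∈ M.closure (keyUpper base key (n + j) i' : Set (Fin n))) ∧
          c ≤ Nat.clog 2 ((Fin.last k).val + 1)) →
        (∃ c, d ∈ base i ∧ (∃ S : Finset (Fin n), S ⊆ base i ∧ d ∉ S ∧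
          (∀ x ∈ base i, key i d < key i x → x ∈ S) ∧ (∀ x ∈ S, key i d ≤ key i x) ∧
          e ∉ M.closure (S : Set (Fin n)) ∧ e ∈ M.closure (insert d (S : Set (Fin n)))) ∧
        c ≤ Nat.clog 2 (base i).card) →
        PushInv M u h (Function.update base i (insert e ((base i).erase d)))
          (Function.update key i (Function.update (key i) e (n + j))) (Function.update lev e j)
          (insert d W) ∧
        totalLevel base key + 1 ≤ totalLevel
          (Function.update base i (insert e ((base i).erase d)))
          (Function.update key i (Function.update (key i) e (n + j))) := by
      rintro M ⟨h1, c, -, h2, h3, -⟩ ⟨c', hd, ⟨S, hSB, hdS, -, hS', heS, heS'⟩, -⟩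
      exact (hrel M h1).2.push heW hunc (by omega) (by simp) h2 h3 hd hSB hdS hS' heS heS'
    -- The increase holds for every matroid consistent with the answers. Splitting on it makes it
    -- available for the fuel bound, where no matroid is at hand.
    by_cases hΦ : totalLevel base key + 1 ≤ totalLevel
        (Function.update base i (insert e ((base i).erase d)))
        (Function.update key i (Function.update (key i) e (n + j)))
    swap
    · exact .pure (base, key, lev) fun M hM => (hΦ (hpush M hM.1 hM.2).2).elim
    have hins : (insert d W).card ≤ W.card + 1 := Finset.card_insert_le _ _
    refine (ih _ _ _ (insert d W) (fun M hM => (hpush M hM.1 hM.2).1) (by omega)).mono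
      (fun M hM => hM) ?_
    rintro M s c ⟨⟨⟨⟨hM, -⟩, -⟩, -⟩, -⟩ ⟨h1, h2⟩ c3 ⟨-, -, h3⟩ c2 ⟨-, -, -, h4⟩ c1 ⟨-, -, h5⟩
    refine ⟨h1, ?_⟩
    rw [← matroidRank_eq_card ((H M hM).isBase _)] at h3 h5
    have h6 := Nat.mul_le_mul_left (pushCost (k + 1) M) hΦ
    rw [mul_add, mul_one] at h6
    have h7 : pushCost (k + 1) M = 2 + Nat.clog 2 (k + 1) + 2 * Nat.clog 2 (matroidRank M) := rfl
    simp only [Fin.val_last] at h4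
    omega

end PushRelabel

/-! ### Push-relabel: amount of work and near-optimality. -/

section PushRelabel

variable {n k : ℕ} {pre : Matroid (Fin n) → Prop} {M : Matroid (Fin n)} {u : Fin n → ℕ} {h : ℕ}
  {base : Fin k → Finset (Fin n)} {key : Fin k → Fin n → ℕ} {lev : Fin n → ℕ} {W : Finset (Fin n)}

/-- All bases start equal, so all mutual spans are trivial, even at the fine thresholds that order
the initial copies by index. -/
theorem PushInv.init (hE : M.E = Set.univ) {B : Finset (Fin n)} (hB : M.IsBase (B : Set (Fin n)))
    (u : Fin n → ℕ) (h : ℕ) :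
    PushInv M u h (fun _ : Fin k => B) (fun _ e => e.val) (fun _ => 0) Finset.univ ∧
      totalLevel (fun _ : Fin k => B) (fun _ e => e.val) = 0 := by
  refine ⟨⟨hE, fun _ => hB, fun i e _ => by simp, fun _ _ => rfl, by simp, by simp, by simp,
    fun t i j _ e he => mem_closure_of_mem_set hE he, fun _ _ _ => .inl rfl, fun i i' f hf _ =>
      mem_closure_of_mem_set hE (by simpa [keyUpper] using hf)⟩, ?_⟩
  exact Finset.sum_eq_zero fun i _ => Finset.sum_eq_zero fun e _ => by simp

/-- An overpacked element has level zero, hence no copy of it has a positive insertion level. -/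
theorem PushInv.numCovered_keyUpper_le (H : PushInv M u h base key lev W) (e : Fin n) :
    numCovered (keyUpper base key (n + 1)) e ≤ min (u e) (numCovered base e) := by
  have h1 : numCovered (keyUpper base key (n + 1)) e ≤ numCovered base e :=
    numCovered_mono (fun i => Finset.filter_subset _ _) e
  refine le_min ?_ h1
  by_contra hcon
  have h2 := H.overpacked e ((not_le.1 hcon).trans_le h1)
  obtain ⟨i, hi⟩ := Finset.card_pos.1 (lt_of_le_of_lt (Nat.zero_le _) (not_le.1 hcon))
  simp only [Finset.mem_filter, mem_keyUpper, Finset.mem_univ, true_and] at hi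
  have := H.key_le i e hi.1
  omega

/-- The copies of positive insertion level form a packing, and each contributes at most `h`. This
bounds the number of pushes. -/
theorem PushInv.totalLevel_le_unionOpt (H : PushInv M u h base key lev W) :
    totalLevel base key ≤ h * unionOpt M u k := by
  have h1 : IsPacking M u (keyUpper base key (n + 1)) :=
    ⟨fun i => (H.isBase i).indep.subset (by exact_mod_cast Finset.filter_subset _ _),
      fun e => (H.numCovered_keyUpper_le e).trans (min_le_left _ _)⟩
  refine le_trans ?_ (Nat.mul_le_mul_left h (packingSize_le_unionOpt h1))
  rw [totalLevel, packingSize, Finset.mul_sum]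
  refine Finset.sum_le_sum fun i _ => ?_
  rw [keyUpper, Finset.card_filter, Finset.mul_sum]
  refine Finset.sum_le_sum fun e he => ?_
  have h2 := H.key_le i e he
  have h3 := H.lev_le e
  split_ifs
  · omega
  · omega

/-- Threshold zero, which `PushInv.span` leaves out, needs no bookkeeping because whole bases span
everything. -/
theorem PushInv.valid (H : PushInv M u h base key lev ∅) :
    PushRelabelConfig.Valid M u h ⟨base, lev, fun i e => key i e - n⟩ := by
  have hup : ∀ j, 1 ≤ j → ∀ i, PushRelabelConfig.upper ⟨base, lev, fun i e => key i e - n⟩ i j =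
      keyUpper base key (n + j) i := fun j hj i => by
    ext e
    simp only [PushRelabelConfig.upper, Finset.mem_filter, mem_keyUpper]
    refine and_congr_right fun _ => ?_
    omega
  have hup0 : ∀ i, PushRelabelConfig.upper ⟨base, lev, fun i e => key i e - n⟩ i 0 =
      keyUpper base key 0 i := fun i => by
    ext e
    simp [PushRelabelConfig.upper, mem_keyUpper]
  refine ⟨H.isBase, fun i e he => ?_, H.overpacked, fun i j e hj => ?_,
    fun e he => by simpa using H.uncovered e he, fun j => ?_⟩
  · have := H.key_le i e he
    simp only
    omega
  · rcases Nat.eq_zero_or_pos j with rfl | hj0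
    · rw [hup0, show keyUpper base key 0 i = base i by ext; simp [mem_keyUpper],
        (H.isBase i).closure_eq, H.ground]
      trivial
    · rw [hup j hj0]
      exact H.span i j e hj0 hj
  · rcases Nat.eq_zero_or_pos j with rfl | hj0
    · simpa only [hup0] using H.decreasing 0
    · simpa only [hup j hj0] using H.decreasing (n + j)

/-- The push-relabel invariants with a large height imply near-optimality. -/
theorem PushRelabelConfig.Valid.unionOpt_le {P : PushRelabelConfig n k} (H : P.Valid M u (h + 1)) :
    h * unionOpt M u k ≤ (h + 1) * unionValue u P.base := by
  -- `N j` is the loss of the duality bound at level `j`: the copies inserted at level at least `j`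
  -- whose element is not above level `j`.
  let N : ℕ → ℕ := fun j =>
    ∑ i, ((P.base i).filter (fun e => P.insLevel i e = j ∧ P.level e = j)).card
  have h1 : ∀ j ∈ Finset.Icc 1 h, unionOpt M u k ≤ unionValue u P.base + N j := by
    intro j hj
    rw [Finset.mem_Icc] at hj
    let S : Finset (Fin n) := Finset.univ.filter fun e => j < P.level e
    refine (_root_.unionOpt_le (M := M) u (T := fun i => P.upper i j) S fun i e he =>
      H.span i j e (by simpa [S] using he)).trans ?_
    rw [unionValue, ← Finset.sum_compl_add_sum S, add_assoc]
    refine add_le_add (Finset.sum_le_sum fun e he => le_min le_rfl ?_) ?_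
    · by_contra hcon
      have h2 := H.uncovered e (not_le.1 hcon)
      simp only [S, Finset.mem_compl, Finset.mem_filter, Finset.mem_univ, true_and] at he
      omega
    · have h2 : ∑ e ∈ S, min (u e) (numCovered P.base e) = ∑ e ∈ S, numCovered P.base e :=
        Finset.sum_congr rfl fun e he => min_eq_right (by
          by_contra hcon
          have h2 := H.overpacked e (not_le.1 hcon)
          simp only [S, Finset.mem_filter, Finset.mem_univ, true_and] at he
          omega)
      rw [h2, sum_numCovered, ← Finset.sum_add_distrib]
      refine Finset.sum_le_sum fun i _ => (Finset.card_le_card fun e he => ?_).trans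
        (Finset.card_union_le _ _)
      simp only [PushRelabelConfig.upper, Finset.mem_filter] at he
      simp only [S, Finset.mem_union, Finset.mem_inter, Finset.mem_filter, Finset.mem_univ,
        true_and, he.1, and_true]
      have := H.insLevel_le i e he.1
      omega
  -- Each copy is lost at no more than one level, and elements of positive level are not overpacked,
  -- so all their copies count in the value.
  have h2 : ∑ j ∈ Finset.Icc 1 h, N j ≤ unionValue u P.base := by
    rw [Finset.sum_comm]
    have h3 : ∀ i, ∑ j ∈ Finset.Icc 1 h,
        ((P.base i).filter (fun e => P.insLevel i e = j ∧ P.level e = j)).card ≤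
        (Finset.univ.filter (fun e => 1 ≤ P.level e) ∩ P.base i).card := fun i => by
      rw [← Finset.card_biUnion]
      · refine Finset.card_le_card fun e he => ?_
        simp only [Finset.mem_biUnion, Finset.mem_filter, Finset.mem_Icc, Finset.mem_inter,
          Finset.mem_univ, true_and] at he ⊢
        obtain ⟨j, hj, hb, -, hl⟩ := he
        exact ⟨by omega, hb⟩
      · intro a _ b _ hab
        rw [Function.onFun, Finset.disjoint_left]
        intro e he he'
        simp only [Finset.mem_filter] at he he'
        omega
    refine (Finset.sum_le_sum fun i _ => h3 i).trans ?_
    rw [← sum_numCovered]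
    refine le_trans (Finset.sum_le_sum fun e he => ?_)
      (Finset.sum_le_sum_of_subset (Finset.subset_univ _))
    refine le_min ?_ le_rfl
    by_contra hcon
    have h2 := H.overpacked e (not_le.1 hcon)
    simp only [Finset.mem_filter, Finset.mem_univ, true_and] at he
    omega
  have h3 := Finset.sum_le_sum h1
  rw [Finset.sum_add_distrib] at h3
  simp only [Finset.sum_const, Nat.card_Icc, Nat.add_sub_cancel, smul_eq_mul] at h3
  rw [add_mul, one_mul]
  omega

/-! ### Trimming the bases to a packing. -/

/-- The packing `I` consists of the elements inserted at a positive level and of copies of the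
elements `e` with `t ≤ e`, whose multiplicity is right. -/
structure TrimInv (M : Matroid (Fin n)) (u : Fin n → ℕ) (base : Fin k → Finset (Fin n))
    (key : Fin k → Fin n → ℕ) (t : ℕ) (I : Fin k → Finset (Fin n)) : Prop where
  subset : ∀ i, keyUpper base key (n + 1) i ⊆ I i
  span : ∀ i, (I i : Set (Fin n)) ⊆ M.closure (keyUpper base key t i : Set (Fin n))
  indep : ∀ i, M.Indep (I i : Set (Fin n))
  decreasing : IsDecreasing M I
  cov : ∀ e : Fin n, numCovered I e =
    if t ≤ e.val then min (u e) (numCovered base e) else numCovered (keyUpper base key (n + 1)) e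

theorem PushInv.trimInv (H : PushInv M u h base key lev W) :
    TrimInv M u base key n (keyUpper base key (n + 1)) where
  subset := fun _ => subset_rfl
  span := fun i e he =>
    mem_closure_of_mem_set H.ground (keyUpper_anti base key (Nat.le_succ n) i he)
  indep := fun i => (H.isBase i).indep.subset (by exact_mod_cast Finset.filter_subset _ _)
  decreasing := H.decreasing _
  cov := fun e => by simp

/-- The number of copies of `e` that the trimming has to add. -/
def missing (u : Fin n → ℕ) (base : Fin k → Finset (Fin n)) (key : Fin k → Fin n → ℕ)
    (e : Fin n) : ℕ :=
  min (u e) (numCovered base e) - numCovered (keyUpper base key (n + 1)) e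

theorem TrimInv.skip (H : PushInv M u h base key lev W) {f : Fin n}
    {I : Fin k → Finset (Fin n)} (HI : TrimInv M u base key (f.val + 1) I)
    (hm : missing u base key f = 0) : TrimInv M u base key f.val I :=
  { HI with
    span := fun i => (HI.span i).trans (M.closure_subset_closure
      (by exact_mod_cast keyUpper_anti base key (Nat.le_succ f.val) i))
    cov := fun e => by
      rw [HI.cov e]
      rcases lt_trichotomy f.val e.val with h1 | h1 | h1
      · simp [h1.le, Nat.succ_le_of_lt h1]
      · obtain rfl : f = e := Fin.ext h1
        have := H.numCovered_keyUpper_le f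
        rw [missing] at hm
        simp
        omega
      · simp [not_le.2 h1, not_le.2 (h1.trans (Nat.lt_succ_self f.val))] }

/-- The indices of the bases that contain `e` from the start. -/
theorem PushInv.missing_le (H : PushInv M u h base key lev W) (e : Fin n) :
    missing u base key e ≤
      (Finset.univ.filter fun i => e ∈ base i ∧ key i e = e.val).card := by
  have h1 : numCovered base e ≤ numCovered (keyUpper base key (n + 1)) e +
      (Finset.univ.filter fun i => e ∈ base i ∧ key i e = e.val).card := by
    rw [numCovered, numCovered]
    refine (Finset.card_le_card fun i hi => ?_).trans (Finset.card_union_le _ _)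
    simp only [Finset.mem_filter, Finset.mem_univ, true_and, Finset.mem_union,
      mem_keyUpper] at hi ⊢
    rcases H.key_cases i e hi with h | h
    exacts [.inr ⟨hi, h⟩, .inl ⟨hi, h⟩]
  have h2 : min (u e) (numCovered base e) ≤ numCovered base e := min_le_right _ _
  rw [missing]
  omega

/-- The set `I i` is spanned by elements of `base i` with key above `f`, while the initial copy of
`f` there has key exactly `f`; independence of the base does the rest. -/
theorem TrimInv.notMem_closure (H : PushInv M u h base key lev W) {f : Fin n}
    {I : Fin k → Finset (Fin n)} (HI : TrimInv M u base key (f.val + 1) I) {i : Fin k}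
    (hi : f ∈ base i) (hk : key i f = f.val) :
    f ∉ M.closure (I i : Set (Fin n)) := by
  intro hcon
  have h1 := M.closure_subset_closure_of_subset_closure (HI.span i) hcon
  refine (H.isBase i).indep.notMem_closure_sdiff_of_mem (e := f) hi
    (M.closure_subset_closure (fun x hx => ?_) h1)
  have hx' := mem_keyUpper.1 hx
  refine ⟨hx'.1, fun hxt => ?_⟩
  rw [Set.mem_singleton_iff] at hxt
  have := hx'.2
  rw [hxt] at this
  omega

-- The missing copies go into consecutive sets from the first one that does not span `f`. The sets
-- still holding an initial copy do not span `f`, so they all come after that point, and there are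
-- enough of them for the block to fit. Consecutive placement keeps the family decreasing.
open Classical in
theorem TrimInv.insert (H : PushInv M u h base key lev W) {f : Fin n}
    {I : Fin k → Finset (Fin n)} (HI : TrimInv M u base key (f.val + 1) I) {a : Fin k}
    (hm : 0 < missing u base key f)
    (ha : f ∉ M.closure (I a : Set (Fin n)))
    (ha' : ∀ i : Fin k, i.val + 1 = a.val → f ∈ M.closure (I i : Set (Fin n))) :
    TrimInv M u base key f.val (fun i => if a ≤ i ∧ i.val < a.val + missing u base key f then
      Insert.insert f (I i) else I i) ∧
    packingSize I + 1 ≤ packingSize (fun i =>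
      if a ≤ i ∧ i.val < a.val + missing u base key f then
      Insert.insert f (I i) else I i) := by
  have hE := H.ground
  have hmle := H.missing_le f
  generalize hmm : missing u base key f = m at *
  obtain ⟨i₀, hi₀⟩ := Finset.card_pos.1 (hm.trans_le hmle)
  simp only [Finset.mem_filter, Finset.mem_univ, true_and] at hi₀
  have hnot : ∀ i, a ≤ i → f ∉ M.closure (I i : Set (Fin n)) := fun i hi h =>
    ha (HI.decreasing.closure_subset hE hi h)
  have hnot' : ∀ i, a ≤ i → f ∉ I i := fun i hi h =>
    hnot i hi (mem_closure_of_mem_set hE h)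
  have hge : (Finset.univ.filter fun i => f ∈ base i ∧ key i f = f.val) ⊆
      Finset.Ici a := fun i hi => by
    simp only [Finset.mem_filter, Finset.mem_univ, true_and] at hi
    rw [Finset.mem_Ici]
    by_contra hcon
    rw [not_le, Fin.lt_def] at hcon
    have h1 := ha' ⟨a.val - 1, by omega⟩ (by simp; omega)
    exact HI.notMem_closure H hi.1 hi.2
      (HI.decreasing.closure_subset hE (Fin.le_def.2 (by simp; omega)) h1)
  have ham : a.val + m ≤ k := by
    have := hmle.trans (Finset.card_le_card hge)
    rw [Fin.card_Ici] at this
    omega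
  have hcount : (Finset.univ.filter fun i : Fin k => a ≤ i ∧ i.val < a.val + m).card = m := by
    have : (Finset.univ.filter fun i : Fin k => a ≤ i ∧ i.val < a.val + m).map Fin.valEmbedding =
        Finset.Ico a.val (a.val + m) := by
      ext x
      simp only [Finset.mem_map, Finset.mem_filter, Finset.mem_univ, true_and,
        Fin.valEmbedding_apply, Finset.mem_Ico, Fin.le_def]
      constructor
      · rintro ⟨i, hi, rfl⟩; exact hi
      · intro hx; exact ⟨⟨x, by omega⟩, hx, rfl⟩
    rw [← Finset.card_map Fin.valEmbedding, this, Nat.card_Ico]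
    omega
  generalize hI' : (fun i => if a ≤ i ∧ i.val < a.val + m then
    Insert.insert f (I i) else I i) = I'
  have hI'e : ∀ i, I' i = if a ≤ i ∧ i.val < a.val + m then
    Insert.insert f (I i) else I i := fun i => by rw [← hI']
  have hsub : ∀ i, I i ⊆ I' i := fun i => by
    rw [hI'e]; split_ifs
    exacts [Finset.subset_insert _ _, subset_rfl]
  have hmem : ∀ i x, x ∈ I' i ↔ x ∈ I i ∨ x = f ∧ a ≤ i ∧ i.val < a.val + m := fun i x => by
    rw [hI'e]; split_ifs with h
    · simp [h, or_comm]
    · simp [h]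
  have hcov1 : ∀ e : Fin n, e ≠ f → numCovered I' e = numCovered I e := fun e he => by
    simp [numCovered, hmem, he]
  have hcov2 : numCovered I' f = numCovered I f + m := by
    rw [numCovered, numCovered, ← hcount, ← Finset.card_union_of_disjoint]
    · congr 1
      ext i
      simp [hmem]
    · rw [Finset.disjoint_left]
      intro i hi hi'
      simp only [Finset.mem_filter, Finset.mem_univ, true_and] at hi hi'
      exact hnot' i hi'.1 hi
  refine ⟨⟨fun i => (HI.subset i).trans (hsub i), fun i x hx => ?_, fun i => ?_,
    fun i i' hii' x hx => ?_, fun e => ?_⟩, ?_⟩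
  · rcases (hmem i x).1 hx with hx | ⟨rfl, -⟩
    · exact M.closure_subset_closure
        (by exact_mod_cast keyUpper_anti base key (Nat.le_succ f.val) i) (HI.span i hx)
    · exact H.origin i i₀ _ hi₀.1 hi₀.2
  · rw [hI'e]
    split_ifs with h
    · rw [Finset.coe_insert, (HI.indep i).insert_indep_iff]
      exact .inl ⟨by simp [hE], hnot i h.1⟩
    · exact HI.indep i
  · have hcl : M.closure (I i : Set (Fin n)) ⊆ M.closure (I' i : Set (Fin n)) :=
      M.closure_subset_closure (by exact_mod_cast hsub i)
    rcases (hmem i' x).1 hx with hx | ⟨rfl, hx1, hx2⟩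
    · exact hcl (HI.decreasing i i' hii' hx)
    · rcases eq_or_ne i' a with rfl | hne
      · exact hcl (ha' i hii')
      · refine mem_closure_of_mem_set hE ((hmem i _).2 (.inr ⟨rfl, ?_, by omega⟩))
        rw [Fin.le_def] at hx1 ⊢
        have : i'.val ≠ a.val := fun h => hne (Fin.ext h)
        omega
  · rcases eq_or_ne e f with rfl | he
    · rw [hcov2, HI.cov]
      have := H.numCovered_keyUpper_le e
      rw [missing] at hmm
      simp
      omega
    · rw [hcov1 e he, HI.cov]
      have : e.val ≠ f.val := fun h => he (Fin.ext h)
      simp only [show (f.val + 1 ≤ e.val ↔ f.val ≤ e.val) by omega]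
  · rw [packingSize_eq_sum, packingSize_eq_sum]
    refine Finset.sum_lt_sum (fun e _ => numCovered_mono hsub e) ⟨f, Finset.mem_univ _, ?_⟩
    omega

end PushRelabel

section PushRelabel

variable {n k : ℕ} {pre : Matroid (Fin n) → Prop}

/-- Trimming the bases to a packing. -/
theorem solvable_trim (u : Fin n → ℕ) (h : ℕ) (base : Fin (k + 1) → Finset (Fin n))
    (key : Fin (k + 1) → Fin n → ℕ) (lev : Fin n → ℕ) (t : ℕ) (ht : t ≤ n)
    (I : Fin (k + 1) → Finset (Fin n))
    (H : ∀ M, pre M → PushInv M u h base key lev ∅ ∧ TrimInv M u base key t I) :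
    Solvable pre (fun M (J : Fin (k + 1) → Finset (Fin n)) c => TrimInv M u base key 0 J ∧
      c + Nat.clog 2 (k + 1) * packingSize I ≤ Nat.clog 2 (k + 1) * packingSize J) := by
  classical
  induction t generalizing pre I with
  | zero => exact .pure I fun M hM => ⟨(H M hM).2, by simp⟩
  | succ t ih =>
    obtain ⟨f, hf⟩ : ∃ f : Fin n, f.val = t := ⟨⟨t, ht⟩, rfl⟩
    subst hf
    rcases Nat.eq_zero_or_pos (missing u base key f) with hm | hm
    · exact ih (by omega) I fun M hM => ⟨(H M hM).1, (H M hM).2.skip (H M hM).1 hm⟩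
    refine .bind (solvable_first_unspanned I f (Fin.last k) fun M hM =>
      ⟨(H M hM).1.ground, fun i _ => (H M hM).2.indep i, ?_⟩) fun a => ?_
    · obtain ⟨i, hi⟩ := Finset.card_pos.1 (hm.trans_le ((H M hM).1.missing_le f))
      simp only [Finset.mem_filter, Finset.mem_univ, true_and] at hi
      exact fun hcon => (H M hM).2.notMem_closure (H M hM).1 hi.1 hi.2
        ((H M hM).2.decreasing.closure_subset (H M hM).1.ground (Fin.le_last i) hcon)
    have hins : ∀ M, (pre M ∧ ∃ c, a ≤ Fin.last k ∧ f ∉ M.closure (I a : Set (Fin n)) ∧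
        (∀ i' : Fin (k + 1), i'.val + 1 = a.val → f ∈ M.closure (I i' : Set (Fin n))) ∧
        c ≤ Nat.clog 2 ((Fin.last k).val + 1)) → _ := fun M hM =>
      (H M hM.1).2.insert (H M hM.1).1 hm hM.2.choose_spec.2.1 hM.2.choose_spec.2.2.1
    refine (ih (by omega) _ fun M hM => ⟨(H M hM.1).1, (hins M hM).1⟩).mono (fun M hM => hM) ?_
    rintro M J c hM ⟨h1, h2⟩ c' ⟨-, -, -, h3⟩
    refine ⟨h1, ?_⟩
    have h4 := Nat.mul_le_mul_left (Nat.clog 2 (k + 1)) (hins M hM).2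
    rw [mul_add, mul_one] at h4
    simp only [Fin.val_last] at h3
    omega

/-- Elements uncovered by the trimmed packing are uncovered by the bases, so their level is at least
`h ≥ 2`. They are then spanned by the copies of positive insertion level, all of which are kept. -/
theorem TrimInv.isGoodPacking {M : Matroid (Fin n)} {u : Fin n → ℕ} {h : ℕ} (hh : 2 ≤ h)
    {base : Fin k → Finset (Fin n)} {key : Fin k → Fin n → ℕ} {lev : Fin n → ℕ}
    (H : PushInv M u h base key lev ∅) {I : Fin k → Finset (Fin n)}
    (HI : TrimInv M u base key 0 I) : IsGoodPacking M u I := by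
  have hcov : ∀ e, numCovered I e = min (u e) (numCovered base e) := fun e => by
    simpa using HI.cov e
  refine ⟨⟨HI.indep, fun e => (hcov e).trans_le (min_le_left _ _)⟩, fun e he i => ?_, HI.decreasing⟩
  rw [hcov] at he
  have h1 : h ≤ lev e := by simpa using H.uncovered e (by omega)
  exact M.closure_subset_closure (by exact_mod_cast HI.subset i)
    (H.span i 1 e le_rfl (by omega))

theorem TrimInv.isTrimming {M : Matroid (Fin n)} {u : Fin n → ℕ}
    {base : Fin k → Finset (Fin n)} {key : Fin k → Fin n → ℕ} {lev : Fin n → ℕ}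
    {I : Fin k → Finset (Fin n)} (HI : TrimInv M u base key 0 I) :
    PushRelabelConfig.IsTrimming u ⟨base, lev, fun i e => key i e - n⟩ I := by
  refine ⟨fun e => by simpa using HI.cov e, fun i e he => HI.subset i ?_⟩
  simp only [PushRelabelConfig.upper, Finset.mem_filter] at he
  exact mem_keyUpper.2 ⟨he.1, by omega⟩

/-! ### The approximation algorithm. -/

/-- The cost of the push-relabel algorithm up to height `h`. -/
noncomputable def pushRelabelCost (u : Fin n → ℕ) (k h : ℕ) (M : Matroid (Fin n)) : ℕ :=
  3 * n + pushCost k M * (h * unionOpt M u k) + Nat.clog 2 k * unionOpt M u k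

theorem solvable_approx (u : Fin n → ℕ) (h : ℕ) (hh : 2 ≤ h) :
    Solvable (fun M => M.E = Set.univ)
      (fun M (s : PushRelabelConfig n (k + 1) × (Fin (k + 1) → Finset (Fin n))) c =>
        (s.1.Valid M u h ∧ s.1.IsTrimming u s.2 ∧ IsGoodPacking M u s.2) ∧
        c ≤ pushRelabelCost u (k + 1) h M) := by
  refine .bind (solvable_base_loops fun M hM => hM) fun ⟨B, L⟩ => ?_
  refine .bind (solvable_pushRelabel (k := k) u h hh _ (fun _ => B) (fun _ e => e.val) (fun _ => 0)
    Finset.univ (fun M hM => (PushInv.init hM.1 hM.2.choose_spec.1 u h).1)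
    (Nat.le_add_right _ _)) fun ⟨base, key, lev⟩ => ?_
  refine (solvable_trim u h base key lev n le_rfl (keyUpper base key (n + 1)) ?_).map
    (fun J => (⟨base, lev, fun i e => key i e - n⟩, J)) ?_
  · rintro M ⟨⟨hM, -⟩, c, h1, -⟩
    exact ⟨h1, h1.trimInv⟩
  · rintro M J c ⟨⟨hM, -⟩, -⟩ ⟨h1, h2⟩ c2 ⟨h3, h4⟩ c1 ⟨h5, -, h6⟩
    have hgood := h1.isGoodPacking hh h3
    refine ⟨⟨h3.valid, h1.isTrimming, hgood⟩, ?_⟩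
    have h7 := Nat.mul_le_mul_left (Nat.clog 2 (k + 1)) (packingSize_le_unionOpt hgood.1)
    have h8 := Nat.mul_le_mul_left (pushCost (k + 1) M) h3.totalLevel_le_unionOpt
    simp only [Finset.card_univ, Fintype.card_fin, (PushInv.init hM h5 u h).2] at h4
    rw [pushRelabelCost]
    simp only at h8
    omega

theorem log_mul_bounds {k r : ℕ} (hk : 1 ≤ k) (hr : 2 ≤ r) :
    1 ≤ 2 * Real.log (k * r) ∧ (Nat.clog 2 k : ℝ) ≤ 4 * Real.log (k * r) ∧
      (Nat.clog 2 r : ℝ) ≤ 4 * Real.log (k * r) ∧ Real.log r ≤ Real.log (k * r) := by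
  have hk' : (1 : ℝ) ≤ k := by exact_mod_cast hk
  have hr' : (2 : ℝ) ≤ r := by exact_mod_cast hr
  have h1 : Real.log (k * r) = Real.log k + Real.log r :=
    Real.log_mul (by positivity) (by positivity)
  have h2 := Real.log_nonneg hk'
  have h3 := one_le_two_mul_log hr
  have h4 := clog_two_le hr
  refine ⟨by linarith, ?_, by linarith, by linarith⟩
  rcases hk.eq_or_lt with rfl | hk
  · simp only [Nat.clog_one_right, Nat.cast_zero]
    linarith
  · linarith [clog_two_le hk]

/-- Approximation by push-relabel. -/
theorem exists_approx_alg (n k : ℕ) (u : Fin n → ℕ) (ε : ℝ) (hε : 0 < ε) (hε1 : ε < 1) :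
    ∃ A : OracleAlg n (PushRelabelConfig n k × (Fin k → Finset (Fin n))),
      ∀ M : Matroid (Fin n), M.E = Set.univ →
        (∃ h : ℕ, 1 / ε + 2 < (h : ℝ) ∧ (A.run (indepOracle M)).1.Valid M u h) ∧
        (A.run (indepOracle M)).1.IsTrimming u (A.run (indepOracle M)).2 ∧
        IsGoodPacking M u (A.run (indepOracle M)).2 ∧
        (1 - ε) * (unionOpt M u k : ℝ) ≤ (packingSize (A.run (indepOracle M)).2 : ℝ) ∧
        (A.queries (indepOracle M) : ℝ) ≤
          80 * (n + unionOpt M u k * Real.log (k * matroidRank M) / ε) := by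
  -- The offset `3` makes up for the floor in the strict lower bound. As `1 / ε > 1`, the height is
  -- still at most `4 / ε`.
  obtain ⟨h, hh⟩ : ∃ h : ℕ, h = ⌊1 / ε⌋₊ + 3 := ⟨_, rfl⟩
  have hε' : 1 < 1 / ε := by rw [lt_div_iff₀ hε]; linarith
  have hh1 : 1 / ε + 2 < (h : ℝ) := by
    rw [hh]; push_cast; linarith [Nat.lt_floor_add_one (1 / ε)]
  have hh2 : (h : ℝ) ≤ 4 * (1 / ε) := by
    rw [hh]; push_cast; linarith [Nat.floor_le (by positivity : 0 ≤ 1 / ε)]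
  have approx : ∀ (M : Matroid (Fin n)) (s : PushRelabelConfig n k × (Fin k → Finset (Fin n))),
      s.1.Valid M u h → s.1.IsTrimming u s.2 →
      (1 - ε) * (unionOpt M u k : ℝ) ≤ (packingSize s.2 : ℝ) := by
    rintro M ⟨P, I⟩ hP hI
    have h1 : unionValue u P.base = packingSize I := by
      rw [packingSize_eq_sum, unionValue]
      exact Finset.sum_congr rfl fun e _ => (hI.1 e).symm
    obtain ⟨h', rfl⟩ : ∃ h', h = h' + 1 := ⟨h - 1, by omega⟩
    have h2 := hP.unionOpt_le
    rw [h1] at h2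
    have h3 : (h' : ℝ) * unionOpt M u k ≤ (h' + 1) * packingSize I := by exact_mod_cast h2
    -- Equivalently `(1 - ε) * (h' + 1) ≤ h'`, which turns `h2` into the approximation ratio.
    have h4 : 1 ≤ ε * (h' + 1) := by
      have : 1 / ε ≤ h' + 1 := by push_cast at hh1; linarith
      rw [div_le_iff₀ hε] at this
      linarith
    have h5 := mul_le_mul_of_nonneg_right h4 (Nat.cast_nonneg (α := ℝ) (unionOpt M u k))
    have h6 : (0 : ℝ) < h' + 1 := by positivity
    refine le_of_mul_le_mul_left ?_ h6
    simp only
    linarith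
  rcases k with - | k
  -- Without bases every element of positive capacity is uncovered, so all elements are given level
  -- `h`.
  · refine ⟨.result (⟨fun i => i.elim0, fun e => h, fun i => i.elim0⟩, fun i => i.elim0),
      fun M hE => ?_⟩
    have hV : PushRelabelConfig.Valid M u h
        (⟨fun i => i.elim0, fun e => h, fun i => i.elim0⟩ : PushRelabelConfig n 0) :=
      ⟨fun i => i.elim0, fun i => i.elim0, fun e he => by simp [numCovered] at he,
        fun i => i.elim0, fun e _ => le_rfl, fun j i => i.elim0⟩
    have hT : PushRelabelConfig.IsTrimming u
        (⟨fun i => i.elim0, fun e => h, fun i => i.elim0⟩ : PushRelabelConfig n 0)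
        (fun i => i.elim0) := ⟨fun e => by simp [numCovered], fun i => i.elim0⟩
    refine ⟨⟨h, hh1, hV⟩, hT, ⟨(isMaximumPacking_zero _).1, fun _ _ i => i.elim0, fun i => i.elim0⟩,
      approx M _ hV hT, ?_⟩
    simp [OracleAlg.queries]
  obtain ⟨A, hA⟩ := (solvable_approx (k := k) u h (by omega)).of_matroidRank fun M hM => hM
  refine ⟨A, fun M hE => ?_⟩
  obtain ⟨⟨h1, h2, h3⟩, h4⟩ := hA M hE
  refine ⟨⟨h, hh1, h1⟩, h2, h3, approx M _ h1 h2, ?_⟩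
  have hn : (0 : ℝ) ≤ n := Nat.cast_nonneg _
  have hO : (0 : ℝ) ≤ unionOpt M u (k + 1) := Nat.cast_nonneg _
  have hl : 0 ≤ Real.log ((k + 1 : ℕ) * matroidRank M) := by
    rw [← Nat.cast_mul]; exact Real.log_natCast_nonneg _
  rcases h4 with ⟨-, h4⟩ | ⟨hr, h4⟩
  · have h5 : (A.queries (indepOracle M) : ℝ) ≤ 2 * n := by exact_mod_cast h4
    have : 0 ≤ unionOpt M u (k + 1) * Real.log ((k + 1 : ℕ) * matroidRank M) / ε := by positivity
    linarith
  · rw [pushRelabelCost] at h4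
    obtain ⟨l1, l2, l3, -⟩ := log_mul_bounds (Nat.succ_le_succ (Nat.zero_le k)) hr
    have h5 : (A.queries (indepOracle M) : ℝ) ≤ 2 * n + (3 * n + pushCost (k + 1) M *
        (h * unionOpt M u (k + 1)) + Nat.clog 2 (k + 1) * unionOpt M u (k + 1)) := by
      exact_mod_cast h4
    have h6 : (pushCost (k + 1) M : ℝ) ≤ 16 * Real.log ((k + 1 : ℕ) * matroidRank M) := by
      rw [pushCost]
      push_cast at l1 l2 l3 ⊢
      linarith
    generalize hLdef : Real.log ((k + 1 : ℕ) * matroidRank M) = l at *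
    have h7 : (pushCost (k + 1) M : ℝ) * h ≤ 16 * l * (4 * (1 / ε)) :=
      mul_le_mul h6 hh2 (Nat.cast_nonneg _) (by positivity)
    have h8 := mul_le_mul_of_nonneg_right h7 hO
    have h9 : (Nat.clog 2 (k + 1) : ℝ) ≤ 4 * l * (1 / ε) := by
      have : 4 * l * 1 ≤ 4 * l * (1 / ε) := mul_le_mul_of_nonneg_left hε'.le (by positivity)
      linarith
    have h10 := mul_le_mul_of_nonneg_right h9 hO
    have h11 : unionOpt M u (k + 1) * l / ε = l * (1 / ε) * unionOpt M u (k + 1) := by ring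
    rw [h11]
    have h12 : 0 ≤ l * (1 / ε) * unionOpt M u (k + 1) := by positivity
    nlinarith

end PushRelabel

/-! ### The exact algorithm: huge `k`, and the balance of accuracy. -/

section Exact

variable {n k : ℕ}

/-- If the capacities of the non-loops, cut down to `k`, sum up to at most `k`, then all copies can
be put into different sets. -/
theorem exists_spread (u : Fin n → ℕ) (L : Finset (Fin n)) (h : ∑ e ∈ Lᶜ, min (u e) k ≤ k) :
    ∃ I : Fin k → Finset (Fin n), (∀ i, (I i).card ≤ 1) ∧ (∀ i, ∀ e ∈ I i, e ∉ L) ∧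
      ∀ e, e ∉ L → numCovered I e = min (u e) k := by
  classical
  have hcard : Fintype.card (Σ e : {e // e ∈ Lᶜ}, Fin (min (u e) k)) ≤ Fintype.card (Fin k) := by
    rw [Fintype.card_sigma, Fintype.card_fin]
    simp only [Fintype.card_fin]
    rw [← Finset.sum_coe_sort] at h
    exact h
  obtain ⟨f⟩ := Function.Embedding.nonempty_of_card_le hcard
  refine ⟨fun i => Finset.univ.filter fun e => ∃ (he : e ∈ Lᶜ) (c : Fin (min (u e) k)),
    f ⟨⟨e, he⟩, c⟩ = i, fun i => ?_, fun i e he => ?_, fun e he => ?_⟩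
  · rw [Finset.card_le_one]
    intro a ha b hb
    simp only [Finset.mem_filter, Finset.mem_univ, true_and] at ha hb
    obtain ⟨ha, c, hc⟩ := ha
    obtain ⟨hb, d, hd⟩ := hb
    have := f.injective (hc.trans hd.symm)
    exact congrArg (fun x => x.1.1) this
  · simp only [Finset.mem_filter, Finset.mem_univ, true_and] at he
    exact Finset.mem_compl.1 he.1
  · have he' : e ∈ Lᶜ := Finset.mem_compl.2 he
    have hinj : Function.Injective fun c : Fin (min (u e) k) => f ⟨⟨e, he'⟩, c⟩ := fun c d hcd => by
      simpa using f.injective hcd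
    rw [numCovered]
    have : (Finset.univ.filter fun i => e ∈ Finset.univ.filter fun e =>
        ∃ (he : e ∈ Lᶜ) (c : Fin (min (u e) k)), f ⟨⟨e, he⟩, c⟩ = i) =
        Finset.univ.image fun c : Fin (min (u e) k) => f ⟨⟨e, he'⟩, c⟩ := by
      ext i
      simp [he]
    rw [this, Finset.card_image_of_injective _ hinj, Finset.card_univ, Fintype.card_fin]

/-- Every non-loop reaches the largest multiplicity any packing can give it, and loops are in no
independent set. -/
theorem isMaximumPacking_of_spread {M : Matroid (Fin n)} (hE : M.E = Set.univ) {u : Fin n → ℕ}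
    {L : Finset (Fin n)} (hL : ∀ e, e ∈ L ↔ e ∈ M.closure ∅) {I : Fin k → Finset (Fin n)}
    (h1 : ∀ i, (I i).card ≤ 1) (h2 : ∀ i, ∀ e ∈ I i, e ∉ L)
    (h3 : ∀ e, e ∉ L → numCovered I e = min (u e) k) : IsMaximumPacking M u I := by
  have hzero : ∀ {J : Fin k → Finset (Fin n)}, (∀ i, ∀ e ∈ J i, e ∉ L) → ∀ e ∈ L,
      numCovered J e = 0 := fun hJ e he => by
    rw [numCovered, Finset.card_eq_zero, Finset.filter_eq_empty_iff]
    exact fun i _ hi => hJ i e hi he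
  refine ⟨⟨fun i => ?_, fun e => ?_⟩, fun J hJ => ?_⟩
  · rcases Nat.le_one_iff_eq_zero_or_eq_one.1 (h1 i) with h | h
    · simp [Finset.card_eq_zero.1 h]
    · obtain ⟨x, hx⟩ := Finset.card_eq_one.1 h
      have hx' := h2 i x (by simp [hx])
      rw [hL] at hx'
      simpa [hx, hE, hx'] using M.empty_indep.insert_indep_iff (e := x)
  · by_cases he : e ∈ L
    · simp [hzero h2 e he]
    · exact (h3 e he).trans_le (min_le_left _ _)
  · rw [packingSize_eq_sum, packingSize_eq_sum]
    refine Finset.sum_le_sum fun e _ => ?_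
    by_cases he : e ∈ L
    · refine (hzero (fun i e he heL => ?_) e he).trans_le (Nat.zero_le _)
      exact (hJ.1 i).notMem_closure_sdiff_of_mem he
        (M.closure_subset_closure (Set.empty_subset _) ((hL e).1 heL))
    · rw [h3 e he]
      exact le_min (hJ.2 e) (numCovered_le J e)

/-- The accuracy that balances the cost of the approximation and of the augmentations. -/
theorem balanced_accuracy {O s l ρ N : ℝ} (hO : 1 ≤ O) (hsO : s ≤ O) (hOs : O ≤ 2 * s)
    (hρ : 1 ≤ 2 * ρ) (hρl : ρ ≤ l) (hN : 0 ≤ N) (hl : l ≤ 3 * (N + O * ρ)) {ε : ℝ}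
    (hε : ε = min (1 / 2) (√(l / (N + s * ρ + 1)))) :
    l ≤ 2 * √((N + O * ρ) * l) ∧ l / ε ≤ 6 * √((N + O * ρ) * l) ∧
      (ε * O + 1) * (O * ρ) ≤ 4 * (O * √((N + O * ρ) * l)) := by
  have hl0 : 0 < l := by linarith
  have hρ0 : 0 < ρ := by linarith
  have hsρ : s * ρ ≤ O * ρ := mul_le_mul_of_nonneg_right hsO hρ0.le
  have hOρ : O * ρ ≤ 2 * (s * ρ) := by nlinarith
  have hρO : ρ ≤ O * ρ := by nlinarith
  obtain ⟨X, hX⟩ : ∃ X, X = N + O * ρ := ⟨_, rfl⟩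
  -- `Z` is `X` with the estimate `s` in place of `O`, plus one to keep it positive; the two agree
  -- up to constants.
  obtain ⟨Z, hZ⟩ : ∃ Z, Z = N + s * ρ + 1 := ⟨_, rfl⟩
  rw [← hX] at hl ⊢
  rw [← hZ] at hε
  have hX0 : 0 < X := by linarith
  have hZ0 : 0 < Z := by linarith
  have hZX : Z ≤ 3 * X := by linarith
  have hXZ : X ≤ 2 * Z := by linarith
  obtain ⟨Y, hY⟩ : ∃ Y, Y = √(X * l) := ⟨_, rfl⟩
  have hY0 : 0 ≤ Y := hY ▸ Real.sqrt_nonneg _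
  have hYY : Y ^ 2 = X * l := by rw [hY, Real.sq_sqrt (by positivity)]
  obtain ⟨δ, hδ⟩ : ∃ δ, δ = √(l / Z) := ⟨_, rfl⟩
  have hδ0 : 0 < δ := hδ ▸ Real.sqrt_pos.2 (by positivity)
  have hδδ : δ ^ 2 * Z = l := by
    rw [hδ, Real.sq_sqrt (by positivity)]; field_simp
  rw [← hY]
  rw [← hδ] at hε
  have h1 : l ≤ 2 * Y := by
    refine le_of_sq_le_sq ?_ (by positivity)
    nlinarith
  -- For the balancing accuracy `δ`, `l / δ = δ * Z` is the geometric mean of `l` and `Z`.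
  have h2 : l / δ ≤ 2 * Y := by
    have : l / δ = δ * Z := by rw [← hδδ]; field_simp
    rw [this]
    refine le_of_sq_le_sq ?_ (by positivity)
    have : (δ * Z) ^ 2 = l * Z := by rw [← hδδ]; ring
    nlinarith
  have h3 : δ * X ≤ 2 * Y := by
    refine le_of_sq_le_sq ?_ (by positivity)
    have h4 : δ ^ 2 * X ≤ 2 * l := by
      have := mul_le_mul_of_nonneg_left hXZ (sq_nonneg δ)
      linarith
    have h5 := mul_le_mul_of_nonneg_right h4 hX0.le
    nlinarith
  refine ⟨h1, ?_, ?_⟩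
  · rcases min_choice (1 / 2) δ with h | h
    · rw [hε, h]; linarith
    · rw [hε, h]; linarith
  · have hεδ : ε ≤ δ := hε ▸ min_le_right _ _
    have h4 : ε * (O * ρ) ≤ δ * X := by
      have h5 : O * ρ ≤ X := by linarith
      exact mul_le_mul hεδ h5 (by positivity) hδ0.le
    have h6 : ε * (O * ρ) + ρ ≤ 4 * Y := by linarith
    have h7 := mul_le_mul_of_nonneg_left h6 (by linarith : 0 ≤ O)
    linarith

end Exact

/-! ### The exact algorithm and its query bounds. -/

section Exact

variable {n k : ℕ}

theorem min_mul_log_nonneg (n k : ℕ) (M : Matroid (Fin n)) :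
    0 ≤ min (n : ℝ) (k * matroidRank M * Real.log (matroidRank M)) :=
  le_min (Nat.cast_nonneg _) (mul_nonneg (by positivity) (log_matroidRank_nonneg M))

theorem log_mul_nonneg (k : ℕ) (M : Matroid (Fin n)) : 0 ≤ Real.log (k * matroidRank M) := by
  rw [← Nat.cast_mul]; exact Real.log_natCast_nonneg _

/-- Once `k < n * O`, `log k` is at most `log n + log O`; the two values of the minimum are treated
separately. This makes a term `O * log (k r)` affordable in the final bound. -/
theorem log_le_of_lt_mul {M : Matroid (Fin n)} {O : ℕ} (hr : 2 ≤ matroidRank M) (hk : 1 ≤ k)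
    (hkO : k < n * O) : Real.log (k * matroidRank M) ≤
      3 * (min (n : ℝ) (k * matroidRank M * Real.log (matroidRank M)) +
        O * Real.log (matroidRank M)) := by
  have hk' : (1 : ℝ) ≤ k := by exact_mod_cast hk
  have hr' : (2 : ℝ) ≤ matroidRank M := by exact_mod_cast hr
  have hO : 1 ≤ O := Nat.one_le_iff_ne_zero.2 (by rintro rfl; omega)
  have hn : 1 ≤ n := Nat.one_le_iff_ne_zero.2 (by rintro rfl; omega)
  have hO' : (1 : ℝ) ≤ O := by exact_mod_cast hO
  have hn' : (1 : ℝ) ≤ n := by exact_mod_cast hn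
  have h1 := one_le_two_mul_log hr
  generalize hρ : Real.log (matroidRank M) = ρ at *
  rcases min_choice (n : ℝ) (k * matroidRank M * ρ) with h | h
  · rw [h, Real.log_mul (by positivity) (by positivity), hρ]
    have h2 : Real.log k ≤ Real.log n + Real.log O := by
      rw [← Real.log_mul (by positivity) (by positivity)]
      exact Real.log_le_log (by positivity) (by exact_mod_cast hkO.le)
    have h3 : Real.log n ≤ n := Real.log_le_self (by positivity)
    have h4 : Real.log O ≤ O := Real.log_le_self (by positivity)
    have h5 : ρ ≤ O * ρ := by nlinarith
    have h6 : (O : ℝ) ≤ 2 * (O * ρ) := by nlinarith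
    linarith
  · rw [h]
    have h2 : Real.log (k * matroidRank M) ≤ k * matroidRank M :=
      Real.log_le_self (by positivity)
    have h3 : (k : ℝ) * matroidRank M ≤ 2 * (k * matroidRank M * ρ) := by
      have : (0 : ℝ) ≤ k * matroidRank M := by positivity
      nlinarith
    have h4 : 0 ≤ (O : ℝ) * ρ := mul_nonneg (by positivity) (by linarith)
    have h5 : 0 ≤ (k : ℝ) * matroidRank M * ρ := mul_nonneg (by positivity) (by linarith)
    linarith

/-- The query bound of the exact algorithm. -/
noncomputable def exactBound (u : Fin n → ℕ) (k : ℕ) (M : Matroid (Fin n)) : ℝ :=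
  unionOpt M u k * √((min (n : ℝ) (k * matroidRank M * Real.log (matroidRank M)) +
    unionOpt M u k * Real.log (matroidRank M)) * Real.log (k * matroidRank M))

theorem exactBound_nonneg (u : Fin n → ℕ) (k : ℕ) (M : Matroid (Fin n)) : 0 ≤ exactBound u k M :=
  mul_nonneg (Nat.cast_nonneg _) (Real.sqrt_nonneg _)

theorem solvable_approx_of_lt_one {pre : Matroid (Fin n) → Prop} (hE : ∀ M, pre M → M.E = Set.univ)
    (k : ℕ) (u : Fin n → ℕ) {ε : ℝ} (hε : 0 < ε) (hε1 : ε < 1) :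
    Solvable pre (fun M (s : PushRelabelConfig n k × (Fin k → Finset (Fin n))) c =>
      IsGoodPacking M u s.2 ∧ (1 - ε) * (unionOpt M u k : ℝ) ≤ (packingSize s.2 : ℝ) ∧
      (c : ℝ) ≤ 80 * (n + unionOpt M u k * Real.log (k * matroidRank M) / ε)) := by
  obtain ⟨A, hA⟩ := exists_approx_alg n k u ε hε hε1
  exact ⟨A, fun M hM => (hA M (hE M hM)).2.2⟩

/-- A first approximation of accuracy `1/2` estimates the optimum within a factor two. The estimate
fixes the accuracy of a second run, and few augmentations remain after it. The bound on `k` is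
recorded for the uncapacitated case. -/
theorem solvable_exact (u : Fin n → ℕ) (hk : 1 ≤ k) :
    Solvable (fun M => M.E = Set.univ) (fun M (J : Fin k → Finset (Fin n)) c =>
      IsMaximumPacking M u J ∧ (2 ≤ matroidRank M → c ≤ 2 * n ∨
        (k < ∑ e, min (u e) k ∧ (c : ℝ) ≤ 1000 * (n + exactBound u k M)))) := by
  refine .bind (solvable_base_loops fun M hM => hM) fun ⟨B, L⟩ => ?_
  by_cases hcap : ∑ e ∈ Lᶜ, min (u e) k ≤ k
  · obtain ⟨I, h1, h2, h3⟩ := exists_spread u L hcap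
    refine .pure I ?_
    rintro M ⟨hE, -⟩ c ⟨-, hL, hc⟩
    exact ⟨isMaximumPacking_of_spread hE hL h1 h2 h3, fun _ => .inl hc⟩
  rw [not_le] at hcap
  refine .bind (solvable_approx_of_lt_one (fun M hM => hM.1) k u (ε := 1 / 2) (by norm_num) (by norm_num))
    fun ⟨P₁, I₁⟩ => ?_
  -- The cost is claimed only for rank at least two, so otherwise any correct continuation will do.
  by_cases hBk : 2 ≤ B.card
  swap
  · obtain ⟨A₃, hA₃⟩ := exists_extend_alg n k u I₁
    refine ⟨A₃, ?_⟩
    rintro M ⟨⟨hE, -⟩, c, hgood, -⟩ c' - c'' ⟨hB, -⟩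
    refine ⟨(hA₃ M hE hgood).1, fun hr => ?_⟩
    rw [matroidRank_eq_card hB] at hr
    exact (hBk hr).elim
  obtain ⟨ε, hε⟩ : ∃ ε : ℝ, ε = min (1 / 2) (√(Real.log (k * B.card) /
    (min (n : ℝ) (k * B.card * Real.log B.card) + packingSize I₁ * Real.log B.card + 1))) :=
      ⟨_, rfl⟩
  have hε0 : 0 < ε := by
    have h1 := (log_mul_bounds hk hBk).1
    have h2 : 0 ≤ Real.log B.card := Real.log_natCast_nonneg _
    have h3 : 0 ≤ min (n : ℝ) (k * B.card * Real.log B.card) := by positivity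
    have h4 : 0 < Real.log (k * B.card) := by linarith
    rw [hε]
    exact lt_min (by norm_num) (Real.sqrt_pos.2 (by positivity))
  have hε1 : ε < 1 := (hε.trans_le (min_le_left _ _)).trans_lt (by norm_num)
  refine .bind (solvable_approx_of_lt_one (fun M hM => hM.1.1) k u hε0 hε1) fun ⟨P₂, I₂⟩ => ?_
  obtain ⟨A₃, hA₃⟩ := exists_extend_alg n k u I₂
  refine ⟨A₃, ?_⟩
  rintro M ⟨⟨⟨hE, -⟩, -⟩, c, hgood, -⟩ c₂ ⟨-, h2, hc₂⟩ c₁ ⟨hgood₁, h1, hc₁⟩ c₀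
    ⟨hB, hL, hc₀⟩
  obtain ⟨h3, -, hc₃⟩ := hA₃ M hE hgood
  refine ⟨h3, fun hr => .inr ⟨hcap.trans_le (Finset.sum_le_sum_of_subset (Finset.subset_univ _)),
    ?_⟩⟩
  -- The copies of the non-loops do not fit into `k` different sets, and each non-loop accounts for
  -- at most the optimum.
  have hkO : k < n * unionOpt M u k := by
    refine hcap.trans_le ((Finset.sum_le_card_nsmul _ _ (unionOpt M u k) fun e he => ?_).trans ?_)
    · exact min_le_unionOpt hE u k fun h => (Finset.mem_compl.1 he) ((hL e).2 h)
    · rw [smul_eq_mul]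
      exact Nat.mul_le_mul_right _ ((Finset.card_le_univ _).trans_eq (Fintype.card_fin n))
  have hl := log_le_of_lt_mul hr hk hkO
  have hO : (1 : ℝ) ≤ unionOpt M u k := by
    have : 1 ≤ unionOpt M u k := Nat.one_le_iff_ne_zero.2 fun h => by simp [h] at hkO
    exact_mod_cast this
  rw [← matroidRank_eq_card hB] at hε
  have hs : (packingSize I₁ : ℝ) ≤ unionOpt M u k := by
    exact_mod_cast packingSize_le_unionOpt hgood₁.1
  obtain ⟨b1, b2, b3⟩ := balanced_accuracy hO hs (by simp only at h1; linarith)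
    (one_le_two_mul_log hr) (log_mul_bounds hk hr).2.2.2 (min_mul_log_nonneg n k M) hl hε
  push_cast
  have hc₀' : (c₀ : ℝ) ≤ 2 * n := by exact_mod_cast hc₀
  have hρ := log_matroidRank_nonneg M
  have hO0 : (0 : ℝ) ≤ unionOpt M u k := by linarith
  have d1 := mul_le_mul_of_nonneg_left b1 hO0
  have d2 := mul_le_mul_of_nonneg_left b2 hO0
  have d3 : ((unionOpt M u k : ℝ) - packingSize I₂ + 1) *
      (unionOpt M u k * Real.log (matroidRank M)) ≤
      (ε * unionOpt M u k + 1) * (unionOpt M u k * Real.log (matroidRank M)) := by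
    refine mul_le_mul_of_nonneg_right ?_ (mul_nonneg hO0 hρ)
    simp only at h2
    linarith
  rw [mul_div_assoc] at hc₁ hc₂
  have d4 : Real.log (k * matroidRank M) / (1 / 2) = 2 * Real.log (k * matroidRank M) := by ring
  rw [d4] at hc₁
  have hn : (0 : ℝ) ≤ n := Nat.cast_nonneg _
  have d5 := exactBound_nonneg u k M
  rw [exactBound] at d5 ⊢
  linarith

/-- With unit capacities the optimum and the rank are at most `n`. Together with `k < n` this bounds
both logarithms by multiples of `log (n + 1)`. -/
theorem exactBound_le_of_lt {M : Matroid (Fin n)} {u : Fin n → ℕ} (hu : ∀ e, u e = 1)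
    (hk1 : 1 ≤ k) (hk : k < n) (hr : 2 ≤ matroidRank M) :
    exactBound u k M ≤ 3 * ((n : ℝ) ^ (3 / 2 : ℝ) * Real.log (n + 1)) := by
  have hn : 1 ≤ n := by omega
  have hn' : (1 : ℝ) ≤ n := by exact_mod_cast hn
  have hrn : matroidRank M ≤ n := by
    obtain ⟨B, hB⟩ := M.exists_isBase
    have hB' : M.IsBase ((Set.toFinite B).toFinset : Set (Fin n)) := by simpa using hB
    rw [matroidRank_eq_card hB']
    exact (Finset.card_le_univ _).trans_eq (Fintype.card_fin n)
  have hOn : (unionOpt M u k : ℝ) ≤ n := by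
    have : unionOpt M u k ≤ n := unionOpt_le_of_forall fun B _ => by
      refine (Finset.sum_le_card_nsmul _ _ 1 fun e _ => ?_).trans_eq (by simp)
      exact (min_le_left _ _).trans_eq (hu e)
    exact_mod_cast this
  have hr' : (2 : ℝ) ≤ matroidRank M := by exact_mod_cast hr
  have hk' : (1 : ℝ) ≤ k := by exact_mod_cast hk1
  obtain ⟨lam, hlam⟩ : ∃ lam, lam = Real.log (n + 1) := ⟨_, rfl⟩
  have hlam1 : 1 ≤ 2 * lam := by
    have := one_le_two_mul_log (show 2 ≤ n + 1 by omega)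
    push_cast at this
    rwa [hlam]
  have hlam0 : 0 ≤ lam := by linarith
  have h1 : Real.log (matroidRank M) ≤ lam := by
    rw [hlam]
    exact Real.log_le_log (by positivity) (by exact_mod_cast hrn.trans (Nat.le_succ n))
  have h2 : Real.log k ≤ lam := by
    rw [hlam]
    exact Real.log_le_log (by positivity) (by exact_mod_cast (hk.le.trans (Nat.le_succ n)))
  have h3 : Real.log (k * matroidRank M) ≤ 2 * lam := by
    rw [Real.log_mul (by positivity) (by positivity)]
    linarith
  have hρ := log_matroidRank_nonneg M
  have hO0 : (0 : ℝ) ≤ unionOpt M u k := Nat.cast_nonneg _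
  have h4 : min (n : ℝ) (k * matroidRank M * Real.log (matroidRank M)) +
      unionOpt M u k * Real.log (matroidRank M) ≤ 3 * (n * lam) := by
    have h5 : unionOpt M u k * Real.log (matroidRank M) ≤ n * lam :=
      mul_le_mul hOn h1 hρ (by positivity)
    have h6 := min_le_left (n : ℝ) (k * matroidRank M * Real.log (matroidRank M))
    nlinarith
  have h5 : √((min (n : ℝ) (k * matroidRank M * Real.log (matroidRank M)) +
      unionOpt M u k * Real.log (matroidRank M)) * Real.log (k * matroidRank M)) ≤
      3 * (√n * lam) := by
    rw [Real.sqrt_le_left (by positivity), mul_pow, mul_pow, Real.sq_sqrt (by positivity)]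
    have := mul_le_mul h4 h3 (log_mul_nonneg k M) (by positivity)
    nlinarith [mul_nonneg (by positivity : (0 : ℝ) ≤ n) (sq_nonneg lam)]
  rw [exactBound, ← hlam]
  have h6 : (n : ℝ) ^ (3 / 2 : ℝ) = n * √n := by
    rw [show (3 / 2 : ℝ) = 1 + 1 / 2 by norm_num, Real.rpow_add (by positivity), Real.rpow_one,
      Real.sqrt_eq_rpow]
  rw [h6]
  have := mul_le_mul hOn h5 (Real.sqrt_nonneg _) (by positivity)
  linarith

/-- The exact algorithm. -/
theorem exists_exact_alg (n k : ℕ) (u : Fin n → ℕ) :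
    ∃ A : OracleAlg n (Fin k → Finset (Fin n)),
      ∀ M : Matroid (Fin n), M.E = Set.univ →
        IsMaximumPacking M u (A.run (indepOracle M)) ∧
        (A.queries (indepOracle M) : ℝ) ≤ 6000 * (n + unionOpt M u k *
          Real.sqrt ((min (n : ℝ) (k * matroidRank M * Real.log (matroidRank M)) +
            unionOpt M u k * Real.log (matroidRank M)) * Real.log (k * matroidRank M))) ∧
        ((∀ e, u e = 1) →
          (A.queries (indepOracle M) : ℝ) ≤ 6000 * ((n : ℝ) ^ (3 / 2 : ℝ) * Real.log (n + 1))) := by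
  have hn : (0 : ℝ) ≤ n := Nat.cast_nonneg _
  have hlin : (n : ℝ) ≤ 2 * ((n : ℝ) ^ (3 / 2 : ℝ) * Real.log (n + 1)) := by
    rcases Nat.eq_zero_or_pos n with rfl | hpos
    · simp
    · have hn1 : (1 : ℝ) ≤ n := by exact_mod_cast hpos
      have h1 := one_le_two_mul_log (show 2 ≤ n + 1 by omega)
      push_cast at h1
      have h2 : (n : ℝ) ≤ (n : ℝ) ^ (3 / 2 : ℝ) := by
        simpa using Real.rpow_le_rpow_of_exponent_le hn1 (by norm_num : (1 : ℝ) ≤ 3 / 2)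
      nlinarith
  have finish : ∀ (M : Matroid (Fin n)) (c : ℕ), c ≤ 4 * n ∨ (2 ≤ matroidRank M ∧ 1 ≤ k ∧
      k < ∑ e, min (u e) k ∧ (c : ℝ) ≤ 2 * n + 1000 * (n + exactBound u k M)) →
      (c : ℝ) ≤ 6000 * (n + exactBound u k M) ∧ ((∀ e, u e = 1) →
        (c : ℝ) ≤ 6000 * ((n : ℝ) ^ (3 / 2 : ℝ) * Real.log (n + 1))) := by
    intro M c h
    have h0 := exactBound_nonneg u k M
    rcases h with h | ⟨hr, hk1, hk, h⟩
    · have h' : (c : ℝ) ≤ 4 * n := by exact_mod_cast h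
      exact ⟨by linarith, fun _ => by linarith⟩
    · refine ⟨by linarith, fun hu => ?_⟩
      have hkn : k < n := hk.trans_le
        ((Finset.sum_le_card_nsmul _ _ 1 fun e _ => (min_le_left _ _).trans_eq (hu e)).trans_eq
          (by simp))
      have := exactBound_le_of_lt hu hk1 hkn hr
      linarith
  rcases Nat.eq_zero_or_pos k with rfl | hk
  · refine ⟨.result fun i => i.elim0, fun M _ => ⟨isMaximumPacking_zero _, ?_⟩⟩
    exact finish M _ (.inl (Nat.zero_le _))
  obtain ⟨A, hA⟩ := (solvable_exact (n := n) u hk).of_matroidRank_of_imp fun M hM => hM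
  refine ⟨A, fun M hE => ?_⟩
  obtain ⟨h1, h2⟩ := hA M hE
  refine ⟨h1, finish M _ ?_⟩
  rcases h2 with ⟨-, h2⟩ | ⟨hr, c', h3 | ⟨h3, h4⟩, h2⟩
  · exact .inl (by omega)
  · exact .inl (by omega)
  · refine .inr ⟨hr, hk, h3, ?_⟩
    have : (A.queries (indepOracle M) : ℝ) ≤ 2 * n + c' := by exact_mod_cast h2
    linarith

/-- The optimum is at most `k * r`, so the cost of one augmentation satisfies both bounds of the
minimum with the same algorithm. -/
theorem mul_log_le_min (M : Matroid (Fin n)) (u : Fin n → ℕ) (k : ℕ) :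
    unionOpt M u k * Real.log (matroidRank M) ≤
      min (n + unionOpt M u k * Real.log (matroidRank M))
        (matroidRank M * k * Real.log (k * matroidRank M)) := by
  have hρ := log_matroidRank_nonneg M
  refine le_min (by linarith [Nat.cast_nonneg (α := ℝ) n]) ?_
  have h1 : (unionOpt M u k : ℝ) ≤ matroidRank M * k := by
    rw [mul_comm]; exact_mod_cast unionOpt_le_mul M u k
  rcases Nat.eq_zero_or_pos k with rfl | hk
  · have : unionOpt M u 0 = 0 := by
      have := unionOpt_le_mul M u 0
      omega
    simp [this]
  rcases Nat.eq_zero_or_pos (matroidRank M) with hr | hr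
  · simp [hr]
  · refine mul_le_mul h1 (Real.log_le_log (by positivity) ?_) hρ (by positivity)
    have : (1 : ℝ) ≤ k := by exact_mod_cast hk
    have : (0 : ℝ) ≤ matroidRank M := Nat.cast_nonneg _
    nlinarith

end Exact

/-! ### Assembly with one absolute constant. -/

theorem mainTheorem8 :
    ∃ C : ℝ, 0 < C ∧
      -- approximate push-relabel, with a packing to start the augmentations from
      (∀ (n k : ℕ) (u : Fin n → ℕ) (ε : ℝ), 0 < ε → ε < 1 →
        ∃ A : OracleAlg n (PushRelabelConfig n k × (Fin k → Finset (Fin n))),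
          ∀ M : Matroid (Fin n), M.E = Set.univ →
            (∃ h : ℕ, 1 / ε + 2 < (h : ℝ) ∧ (A.run (indepOracle M)).1.Valid M u h) ∧
            (A.run (indepOracle M)).1.IsTrimming u (A.run (indepOracle M)).2 ∧
            IsGoodPacking M u (A.run (indepOracle M)).2 ∧
            (1 - ε) * (unionOpt M u k : ℝ) ≤ (packingSize (A.run (indepOracle M)).2 : ℝ) ∧
            (A.queries (indepOracle M) : ℝ) ≤
              C * (n + unionOpt M u k * Real.log (k * matroidRank M) / ε)) ∧
      -- one search for an augmenting path
      (∀ (n k : ℕ) (u : Fin n → ℕ) (I : Fin k → Finset (Fin n)),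
        ∃ A : OracleAlg n (Option (List (Fin n × Fin k))),
          ∀ M : Matroid (Fin n), M.E = Set.univ → IsGoodPacking M u I →
            (∀ p, A.run (indepOracle M) = some p →
              IsSTPath M u I p ∧ IsGoodPacking M u (augmentAlong I p) ∧
              packingSize (augmentAlong I p) = packingSize I + 1) ∧
            (A.run (indepOracle M) = none →
              (¬ ∃ p, IsSTPath M u I p) ∧ IsMaximumPacking M u I) ∧
            (A.queries (indepOracle M) : ℝ) ≤
              C * (n + unionOpt M u k * Real.log (matroidRank M))) ∧
      -- extending a packing to an optimum solution: cost per additional element, after one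
      -- preprocessing pass over the elements
      (∀ (n k : ℕ) (u : Fin n → ℕ) (I : Fin k → Finset (Fin n)),
        ∃ A : OracleAlg n (Fin k → Finset (Fin n)),
          ∀ M : Matroid (Fin n), M.E = Set.univ → IsGoodPacking M u I →
            IsMaximumPacking M u (A.run (indepOracle M)) ∧
            (∀ e, numCovered I e ≤ numCovered (A.run (indepOracle M)) e) ∧
            (A.queries (indepOracle M) : ℝ) ≤
              C * (n + ((unionOpt M u k : ℝ) - packingSize I + 1) *
                min (n + unionOpt M u k * Real.log (matroidRank M))
                  (matroidRank M * k * Real.log (k * matroidRank M)))) ∧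
      -- the exact algorithm
      (∀ (n k : ℕ) (u : Fin n → ℕ),
        ∃ A : OracleAlg n (Fin k → Finset (Fin n)),
          ∀ M : Matroid (Fin n), M.E = Set.univ →
            IsMaximumPacking M u (A.run (indepOracle M)) ∧
            (A.queries (indepOracle M) : ℝ) ≤
              C * (n + unionOpt M u k *
                Real.sqrt ((min (n : ℝ) (k * matroidRank M * Real.log (matroidRank M)) +
                    unionOpt M u k * Real.log (matroidRank M)) *
                  Real.log (k * matroidRank M))) ∧
            ((∀ e, u e = 1) →
              (A.queries (indepOracle M) : ℝ) ≤
                C * ((n : ℝ) ^ (3 / 2 : ℝ) * Real.log (n + 1)))) := by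
  refine ⟨6000, by norm_num, fun n k u ε hε hε1 => ?_, fun n k u I => ?_, fun n k u I => ?_,
    exists_exact_alg⟩
  · obtain ⟨A, hA⟩ := exists_approx_alg n k u ε hε hε1
    refine ⟨A, fun M hE => ?_⟩
    obtain ⟨h1, h2, h3, h4, h5⟩ := hA M hE
    have : 0 ≤ n + unionOpt M u k * Real.log (k * matroidRank M) / ε := by
      have := log_mul_nonneg k M
      positivity
    exact ⟨h1, h2, h3, h4, by linarith⟩
  · obtain ⟨A, hA⟩ := exists_augment_alg n k u I
    refine ⟨A, fun M hE hI => ?_⟩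
    obtain ⟨h1, h2, h3⟩ := hA M hE hI
    have : 0 ≤ n + unionOpt M u k * Real.log (matroidRank M) := by
      have := log_matroidRank_nonneg M
      positivity
    exact ⟨h1, h2, by linarith⟩
  · obtain ⟨A, hA⟩ := exists_extend_alg n k u I
    refine ⟨A, fun M hE hI => ?_⟩
    obtain ⟨h1, h2, h3⟩ := hA M hE hI
    have hq : (0 : ℝ) ≤ (unionOpt M u k : ℝ) - packingSize I :=
      sub_nonneg.2 (by exact_mod_cast packingSize_le_unionOpt hI.1)
    have hY : (0 : ℝ) ≤ unionOpt M u k * Real.log (matroidRank M) :=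
      mul_nonneg (Nat.cast_nonneg _) (log_matroidRank_nonneg M)
    have hmin := mul_log_le_min M u k
    have h4 := mul_le_mul_of_nonneg_left hmin (by linarith : (0 : ℝ) ≤ unionOpt M u k -
      packingSize I + 1)
    have h5 := mul_nonneg (by linarith : (0 : ℝ) ≤ unionOpt M u k - packingSize I + 1)
      (hY.trans hmin)
    exact ⟨h1, h2, by linarith [Nat.cast_nonneg (α := ℝ) n]⟩
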